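/- Let $d,k\ge 1$ be integers and $\nu>1$. Let $\mathcal P_d$ be the set of positive definite symmetric real $d\times d$ matrices, and for $y,\mu\in\mathbb R^d$, $\Sigma\in\mathcal P_d$ put $$\rho(y,(\mu,\Sigma))=\tfrac12\log\det\Sigma+\tfrac{\nu+d}{2}\log\frac{\nu+(y-\mu)'\Sigma^{-1}(y-\mu)}{\nu},\qquad h_\nu(y,(\mu,\Sigma))=\rho(y,(\mu,\Sigma))-\rho(y,(0,I)).$$ The $t_\nu$ location and scatter functionals are defined at a law (Borel probability measure) $Q$ on $\mathbb R^d$ if $(\mu,\Sigma)\mapsto\int h_\nu(y,(\mu,\Sigma))\,dQ(y)$ is finite on $\mathbb R^d\times\mathcal P_d$ and attains its minimum at a unique point; that point is $(\mu_\nu(Q),\Sigma_\nu(Q))$. Let $\mathcal V_{d,\nu+d}$ be the set of all laws $P$ on $\mathbb R^d$ such that $P(J)<1-(d-q)/(\nu+d)$ for every affine subspace $J$ of $\mathbb R^d$ of dimension $q$, $0\le q\le d-1$. For an integer $r\geq 1$ let $\mathcal E(r,d)$ be the collection of all sets $\{x\in\mathbb R^d: p(x)>0\}$, $p$ a real polynomial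 in $d$ variables of degree at most $r$, and for a finite signed Borel measure $\varphi$ on $\mathbb R^d$ let $\|\varphi\|_{\mathcal E(r,d)}=\sup_{E\in\mathcal E(r,d)}|\varphi(E)|$. Then at every $P\in\mathcal V_{d,\nu+d}$ the functional $(\mu_\nu,\Sigma_\nu)$ is Fréchet $C^k$ with respect to $\|\cdot\|_{\mathcal E(2k+4,d)}$, in the following sense. Let $X$ be the Banach space obtained by completing the space of finite signed Borel measures on $\mathbb R^d$ for the norm $\|\cdot\|_{\mathcal E(2k+4,d)}$. For every $P\in\mathcal V_{d,\nu+d}$ there are an open neighbourhood $U$ of $P$ in $X$ and a map $T:U\to\mathbb R^d\times\mathcal P_d$, $k$ times continuously Fréchet differentiable on $U$, such that every law $Q\in U$ belongs to $\mathcal V_{d,\nu+d}$, the functionals $\mu_\nu,\Sigma_\nu$ are defined at $Q$, and $T(Q)=(\mu_\nu(Q),\Sigma_\nu(Q))$. -/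

import Mathlib

open MeasureTheory

noncomputable section

/-- `ℰ(r, d)`: all sets `{x ∈ ℝᵈ : p(x) > 0}`, with `p` a real polynomial in `d` variables of
degree at most `r`. -/
def positivitySets (r d : ℕ) : Set (Set (EuclideanSpace ℝ (Fin d))) :=
  {E | ∃ p : MvPolynomial (Fin d) ℝ, p.totalDegree ≤ r ∧
    E = {x | 0 < MvPolynomial.eval (fun i => x i) p}}

/-- The vector space of finite signed Borel measures on `ℝᵈ`, to be normed by
`‖φ‖ = sup {|φ(E)| : E ∈ ℰ(r, d)}`. -/
def SignedMeasureE (r d : ℕ) : Type :=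
  let _ := r
  SignedMeasure (EuclideanSpace ℝ (Fin d))

namespace SignedMeasureE

variable {r d : ℕ}

instance : AddCommGroup (SignedMeasureE r d) :=
  inferInstanceAs (AddCommGroup (SignedMeasure (EuclideanSpace ℝ (Fin d))))

instance : Module ℝ (SignedMeasureE r d) :=
  inferInstanceAs (Module ℝ (SignedMeasure (EuclideanSpace ℝ (Fin d))))

/-- The element of the space given by a signed measure. -/
def of (r : ℕ) {d : ℕ} (φ : SignedMeasure (EuclideanSpace ℝ (Fin d))) : SignedMeasureE r d := φ

/-- The underlying signed measure. -/
def toSigned (φ : SignedMeasureE r d) : SignedMeasure (EuclideanSpace ℝ (Fin d)) := φ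

/-- `‖φ‖_{ℰ(r, d)} = sup {|φ(E)| : E ∈ ℰ(r, d)}`. -/
instance : Norm (SignedMeasureE r d) :=
  ⟨fun φ => ⨆ E : positivitySets r d, |φ.toSigned (E : Set (EuclideanSpace ℝ (Fin d)))|⟩

theorem norm_def (φ : SignedMeasureE r d) :
    ‖φ‖ = ⨆ E : positivitySets r d, |φ.toSigned (E : Set (EuclideanSpace ℝ (Fin d)))| := rfl

theorem bddAbove (φ : SignedMeasureE r d) : BddAbove (Set.range
    fun E : positivitySets r d => |φ.toSigned (E : Set (EuclideanSpace ℝ (Fin d)))|) := by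
  refine ⟨φ.toSigned.totalVariation.real Set.univ, ?_⟩
  rintro _ ⟨E, rfl⟩
  exact (φ.toSigned.norm_le_totalVariation E).trans
    (measureReal_mono (Set.subset_univ _) (measure_ne_top _ _))

instance : Nonempty (positivitySets r d) := ⟨⟨_, 0, by simp, rfl⟩⟩

theorem core : SeminormedSpace.Core ℝ (SignedMeasureE r d) where
  norm_nonneg φ := Real.iSup_nonneg fun _ => abs_nonneg _
  norm_smul c φ := by
    simp only [norm_def, Real.norm_eq_abs, Real.mul_iSup_of_nonneg (abs_nonneg c), ← abs_mul]
    rfl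
  norm_triangle φ ψ := ciSup_le fun E =>
    (abs_add_le (φ.toSigned E) (ψ.toSigned E)).trans
      (add_le_add (le_ciSup (bddAbove φ) E) (le_ciSup (bddAbove ψ) E))

instance : SeminormedAddCommGroup (SignedMeasureE r d) :=
  SeminormedAddCommGroup.ofCore core

instance : NormedSpace ℝ (SignedMeasureE r d) where
  norm_smul_le c φ := (core.norm_smul c φ).le

end SignedMeasureE

/-- The Banach space obtained by completing the space of finite signed Borel measures on `ℝᵈ`
for the norm `‖·‖_{ℰ(r, d)}`. -/
abbrev SetNormSpace (r d : ℕ) : Type := UniformSpace.Completion (SignedMeasureE r d)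

/-- A law on `ℝᵈ`, viewed as a point of the Banach space `SetNormSpace r d`. -/
def lawPoint (r : ℕ) {d : ℕ} (P : ProbabilityMeasure (EuclideanSpace ℝ (Fin d))) :
    SetNormSpace r d :=
  (SignedMeasureE.of r (P : Measure (EuclideanSpace ℝ (Fin d))).toSignedMeasure :
    SignedMeasureE r d)

/-- `𝒱_{d,a}`: all laws `P` on `ℝᵈ` with `P(J) < 1 - (d - q) / a` for every (nonempty) affine
subspace `J` of `ℝᵈ` of dimension `q ≤ d - 1`. -/
def lawsV (d : ℕ) (a : ℝ) : Set (ProbabilityMeasure (EuclideanSpace ℝ (Fin d))) :=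
  {P | ∀ J : AffineSubspace ℝ (EuclideanSpace ℝ (Fin d)),
    (J : Set (EuclideanSpace ℝ (Fin d))).Nonempty → Module.finrank ℝ J.direction < d →
      (P : Measure (EuclideanSpace ℝ (Fin d))).real J
        < 1 - ((d : ℝ) - (Module.finrank ℝ J.direction : ℝ)) / a}

/-- `ρ_{ν,d}(s) = ((ν + d) / 2) log ((ν + s) / ν)`. -/
def tRho (ν : ℝ) (d : ℕ) (s : ℝ) : ℝ := (ν + d) / 2 * Real.log ((ν + s) / ν)

/-- The squared distance `(y - μ)' Σ⁻¹ (y - μ)`. -/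
def mahalanobis {d : ℕ} (y μ : EuclideanSpace ℝ (Fin d)) (S : Matrix (Fin d) (Fin d) ℝ) : ℝ :=
  (fun i => (y - μ) i) ⬝ᵥ (S⁻¹.mulVec fun i => (y - μ) i)

/-- `ρ(y, (μ, Σ)) = (1/2) log det Σ + ρ_{ν,d}((y - μ)' Σ⁻¹ (y - μ))`. -/
def tLoss (ν : ℝ) {d : ℕ} (y : EuclideanSpace ℝ (Fin d))
    (θ : EuclideanSpace ℝ (Fin d) × Matrix (Fin d) (Fin d) ℝ) : ℝ :=
  1 / 2 * Real.log θ.2.det + tRho ν d (mahalanobis y θ.1 θ.2)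

/-- The adjusted function `h_ν(y, (μ, Σ)) = ρ(y, (μ, Σ)) - ρ(y, (0, I))`. -/
def tAdjustedLoss (ν : ℝ) {d : ℕ} (y : EuclideanSpace ℝ (Fin d))
    (θ : EuclideanSpace ℝ (Fin d) × Matrix (Fin d) (Fin d) ℝ) : ℝ :=
  tLoss ν y θ - tLoss ν y (0, 1)

/-- `θ = (μ, Σ)` is the value at the law `Q` of the `t_ν` location-scatter functional
`(μ_ν, Σ_ν)`: it is the unique point of `ℝᵈ × 𝒫_d` where
`(μ, Σ) ↦ Qh_ν(μ, Σ) = ∫ h_ν(y, (μ, Σ)) dQ(y)`, which is finite on all of `ℝᵈ × 𝒫_d`,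
attains its minimum. -/
def IsTLocationScatter (ν : ℝ) {d : ℕ} (Q : ProbabilityMeasure (EuclideanSpace ℝ (Fin d)))
    (θ : EuclideanSpace ℝ (Fin d) × Matrix (Fin d) (Fin d) ℝ) : Prop :=
  θ.2.PosDef ∧
  (∀ η : EuclideanSpace ℝ (Fin d) × Matrix (Fin d) (Fin d) ℝ, η.2.PosDef →
    Integrable (fun y => tAdjustedLoss ν y η) (Q : Measure (EuclideanSpace ℝ (Fin d)))) ∧
  ∀ η : EuclideanSpace ℝ (Fin d) × Matrix (Fin d) (Fin d) ℝ, η.2.PosDef → η ≠ θ →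
    ∫ y, tAdjustedLoss ν y θ ∂(Q : Measure (EuclideanSpace ℝ (Fin d)))
      < ∫ y, tAdjustedLoss ν y η ∂(Q : Measure (EuclideanSpace ℝ (Fin d)))

end

attribute [local instance] Matrix.frobeniusNormedAddCommGroup Matrix.frobeniusNormedSpace

/-! ### Simultaneous diagonalization of two positive definite matrices. -/

section SimultaneousDiagonalization

open Matrix

variable {ι : Type*} [Fintype ι]

/-! Put z = (y, 1), A = [[Σ + μμ', μ], [μ', 1]] and C = A⁻¹. Then det A = det Σ and z'Cz = 1 + (y -
μ)'Σ⁻¹(y - μ). With a = ν + d and c = ν - 1 > 0, twice the loss is, up to a constant, -log det C + a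
log(c + z'Cz). The location-scatter problem thus becomes a pure scatter problem over positive
definite matrices of size d + 1, with critical equation a ∫ zz'/(c + z'Cz) dQ = C⁻¹. Taking its
trace against C shows that the last diagonal entry of C⁻¹ is 1, so every critical C has the required
block form (`IsCriticalShape.isTLocationScatter`).

Uniqueness: writing two matrices as R'R and R' diag(exp κ) R turns the comparison of objectives into
Jensen's inequality for log-sum-exp, so a critical point is the strict global minimum
(`IsCriticalShape.log_det_sub_lt`). Existence: along a ray κ the objective is convex, and its slope
at infinity is positive exactly because flats have small mass; the condition defining `lawsV` is
made uniform by compactness (`exists_measureReal_flat_le`, `exists_isCriticalShape`).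

Smoothness: the critical equation makes sense on the whole completed space, because the functions
p(y)/(c + z'Cz)^n with deg p ≤ 2n have level sets in ℰ(2n, d), and the layer cake formula bounds
their integrals by the norm. Differentiating in C raises n by one, so k derivatives starting from n
= 1, plus one more to get continuity of the last, reach n = k + 2, that is degree 2k + 4
(`contDiffOn_setNormFunctional`). The partial derivative in C is injective at a critical point by
Cauchy–Schwarz (`eq_zero_of_weightedMoments_mul_eq`), so the implicit function theorem gives C as a
C^k function of Q, and (μ, Σ) is read off from the moment matrix. -/

theorem dotProduct_transpose_diagonal_mulVec {m : Type*} [Fintype m] [DecidableEq m]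
    (R : Matrix m ι ℝ) (w : m → ℝ) (z : ι → ℝ) :
    z ⬝ᵥ (Rᵀ * diagonal w * R) *ᵥ z = ∑ i, w i * (R *ᵥ z) i ^ 2 := by
  rw [← mulVec_mulVec, ← mulVec_mulVec, dotProduct_mulVec, vecMul_transpose, dotProduct]
  refine Finset.sum_congr rfl fun i _ => ?_
  rw [mulVec_diagonal]
  ring

theorem dotProduct_transpose_mul_self_mulVec {m : Type*} [Fintype m]
    (R : Matrix m ι ℝ) (z : ι → ℝ) :
    z ⬝ᵥ (Rᵀ * R) *ᵥ z = ∑ i, (R *ᵥ z) i ^ 2 := by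
  rw [← mulVec_mulVec, dotProduct_mulVec, vecMul_transpose, dotProduct]
  exact Finset.sum_congr rfl fun i _ => (sq _).symm

variable [DecidableEq ι]

/-- Eigenvalues are recorded by their logarithms κ, so that (R, κ) are polar coordinates with κ
ranging over a whole vector space. -/
theorem Matrix.PosDef.exists_orthogonal_exp {M : Matrix ι ι ℝ} (hM : M.PosDef) :
    ∃ (R : Matrix ι ι ℝ) (κ : ι → ℝ), R * Rᵀ = 1 ∧ Rᵀ * R = 1 ∧
      M = Rᵀ * diagonal (fun i => Real.exp (κ i)) * R := by
  have hH := hM.isHermitian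
  set U : Matrix ι ι ℝ := (hH.eigenvectorUnitary : Matrix ι ι ℝ) with hU
  have h1 : star U * U = 1 := Unitary.coe_star_mul_self hH.eigenvectorUnitary
  have h2 : U * star U = 1 := Unitary.coe_mul_star_self hH.eigenvectorUnitary
  have hs : star U = Uᵀ := by
    rw [star_eq_conjTranspose, conjTranspose_eq_transpose_of_trivial]
  rw [hs] at h1 h2
  refine ⟨Uᵀ, fun i => Real.log (hH.eigenvalues i), by simpa using h1, by simpa using h2, ?_⟩
  have h := hH.spectral_theorem
  rw [Unitary.conjStarAlgAut_apply] at h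
  conv_lhs => rw [h]
  rw [transpose_transpose, ← hU]
  have : (RCLike.ofReal ∘ hH.eigenvalues : ι → ℝ)
      = fun i => Real.exp (Real.log (hH.eigenvalues i)) := by
    funext i
    simp [Real.exp_log (hM.eigenvalues_pos i)]
  rw [this]
  congr 1

theorem posDef_transpose_diagonal_mul {R : Matrix ι ι ℝ} (hR : IsUnit R) {w : ι → ℝ}
    (hw : ∀ i, 0 < w i) : (Rᵀ * diagonal w * R).PosDef := by
  have := (IsUnit.posDef_star_left_conjugate_iff (x := diagonal w) hR).2 (PosDef.diagonal hw)
  rwa [star_eq_conjTranspose, conjTranspose_eq_transpose_of_trivial] at this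

theorem Matrix.PosDef.exists_transpose_mul_self {M : Matrix ι ι ℝ} (hM : M.PosDef) :
    ∃ B : Matrix ι ι ℝ, IsUnit B ∧ M = Bᵀ * B := by
  obtain ⟨R, κ, h1, h2, rfl⟩ := hM.exists_orthogonal_exp
  refine ⟨diagonal (fun i => Real.exp (κ i / 2)) * R, ?_, ?_⟩
  · refine IsUnit.mul ?_ (IsUnit.of_mul_eq_one _ h1)
    rw [isUnit_diagonal, Pi.isUnit_iff]
    exact fun i => (Real.exp_pos _).ne'.isUnit
  · rw [transpose_mul, diagonal_transpose, Matrix.mul_assoc Rᵀ (diagonal _) (_ * R),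
      ← Matrix.mul_assoc (diagonal _) (diagonal _) R, diagonal_mul_diagonal, Matrix.mul_assoc]
    simp only [← Real.exp_add, add_halves]

/-- Factor M = B'B, diagonalize B'⁻¹M'B⁻¹ by an orthogonal V and take R = VB. In the coordinates Rz
both quadratic forms are weighted sums of squares, and comparing them is a scalar problem in κ. -/
theorem Matrix.PosDef.exists_simultaneous_diagonal {M M' : Matrix ι ι ℝ} (hM : M.PosDef)
    (hM' : M'.PosDef) :
    ∃ (R : Matrix ι ι ℝ) (κ : ι → ℝ), IsUnit R ∧ M = Rᵀ * R ∧
      M' = Rᵀ * diagonal (fun i => Real.exp (κ i)) * R := by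
  obtain ⟨B, hB, rfl⟩ := hM.exists_transpose_mul_self
  have hBd : IsUnit B.det := (isUnit_iff_isUnit_det _).1 hB
  have hK : (B⁻¹ᵀ * M' * B⁻¹).PosDef := by
    have := (IsUnit.posDef_star_left_conjugate_iff (x := M')
      ((isUnit_nonsing_inv_iff (A := B)).2 hB)).2 hM'
    rwa [star_eq_conjTranspose, conjTranspose_eq_transpose_of_trivial] at this
  obtain ⟨V, κ, h1, h2, h3⟩ := hK.exists_orthogonal_exp
  refine ⟨V * B, κ, (IsUnit.of_mul_eq_one _ h1).mul hB, ?_, ?_⟩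
  · rw [transpose_mul, Matrix.mul_assoc, ← Matrix.mul_assoc Vᵀ, h2, Matrix.one_mul]
  · have : M' = Bᵀ * (B⁻¹ᵀ * M' * B⁻¹) * B := by
      rw [Matrix.mul_assoc, Matrix.mul_assoc _ B⁻¹, nonsing_inv_mul _ hBd, Matrix.mul_one,
        ← Matrix.mul_assoc, ← transpose_mul, nonsing_inv_mul _ hBd]
      simp
    rw [this, h3, transpose_mul]
    simp only [Matrix.mul_assoc]

end SimultaneousDiagonalization

/-! ### Bounds, Jensen's inequality and convexity for the logarithmic ratio. -/

section LogRatio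

variable {ι : Type*} [Fintype ι]

/-- The logarithm of the factor by which `c + ∑ i, s i` changes when each `s i` is multiplied by
`exp (κ i)`. -/
noncomputable def logRatio (c : ℝ) (s κ : ι → ℝ) : ℝ :=
  Real.log ((c + ∑ i, Real.exp (κ i) * s i) / (c + ∑ i, s i))

variable {c : ℝ} {s : ι → ℝ}

theorem add_sum_pos (hc : 0 < c) (hs : ∀ i, 0 ≤ s i) : 0 < c + ∑ i, s i :=
  add_pos_of_pos_of_nonneg hc (Finset.sum_nonneg fun i _ => hs i)

theorem add_sum_exp_mul_pos (hc : 0 < c) (hs : ∀ i, 0 ≤ s i) (κ : ι → ℝ) :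
    0 < c + ∑ i, Real.exp (κ i) * s i :=
  add_sum_pos hc fun i => mul_nonneg (Real.exp_pos _).le (hs i)

/-- Each term of the numerator lies within factors exp(-M) and exp M of the corresponding term of
the denominator. The bound does not depend on s, which is why no moment condition on the law is ever
needed. -/
theorem abs_logRatio_le (hc : 0 < c) (hs : ∀ i, 0 ≤ s i) {κ : ι → ℝ} {M : ℝ} (hM0 : 0 ≤ M)
    (hM : ∀ i, |κ i| ≤ M) : |logRatio c s κ| ≤ M := by
  have h0 := add_sum_pos hc hs
  have h1 := add_sum_exp_mul_pos hc hs κ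
  rw [abs_le, logRatio]
  constructor
  · rw [Real.le_log_iff_exp_le (div_pos h1 h0), le_div_iff₀ h0, mul_add, Finset.mul_sum]
    refine add_le_add ?_ (Finset.sum_le_sum fun i _ => ?_)
    · exact mul_le_of_le_one_left hc.le (Real.exp_le_one_iff.2 (by linarith))
    · exact mul_le_mul_of_nonneg_right (Real.exp_le_exp.2 (abs_le.1 (hM i)).1) (hs i)
  · rw [Real.log_le_iff_le_exp (div_pos h1 h0), div_le_iff₀ h0, mul_add, Finset.mul_sum]
    refine add_le_add ?_ (Finset.sum_le_sum fun i _ => ?_)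
    · exact le_mul_of_one_le_left hc.le (Real.one_le_exp hM0)
    · exact mul_le_mul_of_nonneg_right (Real.exp_le_exp.2 (abs_le.1 (hM i)).2) (hs i)

/-- Jensen's inequality for `logRatio`. -/
theorem sum_mul_div_le_logRatio (hc : 0 < c) (hs : ∀ i, 0 ≤ s i) (κ : ι → ℝ) :
    ∑ i, κ i * (s i / (c + ∑ j, s j)) ≤ logRatio c s κ := by
  have h0 := add_sum_pos hc hs
  have h1 := add_sum_exp_mul_pos hc hs κ
  set u := c + ∑ i, s i with hu
  set m := ∑ i, κ i * (s i / u) with hm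
  have hmu : m * u = ∑ i, κ i * s i := by
    rw [hm, Finset.sum_mul]
    exact Finset.sum_congr rfl fun i _ => by field_simp
  rw [logRatio, Real.le_log_iff_exp_le (div_pos h1 h0), le_div_iff₀ h0]
  -- Tangent line of exp at the weighted mean m. Averaged with weight c/u at the point 0 and weights
  -- s i/u at κ i, its linear part cancels.
  have key : ∀ x : ℝ, Real.exp m * (x - m + 1) ≤ Real.exp x := fun x => by
    have := mul_le_mul_of_nonneg_left (Real.add_one_le_exp (x - m)) (Real.exp_pos m).le
    rwa [← Real.exp_add, add_sub_cancel] at this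
  calc Real.exp m * u = Real.exp m * (0 - m + 1) * c
        + ∑ i, Real.exp m * (κ i - m + 1) * s i := by
        have : ∑ i, Real.exp m * (κ i - m + 1) * s i
            = Real.exp m * (∑ i, κ i * s i + (1 - m) * ∑ i, s i) := by
          rw [Finset.mul_sum, ← Finset.sum_add_distrib, Finset.mul_sum]
          exact Finset.sum_congr rfl fun i _ => by ring
        rw [this, ← hmu, hu]; ring
    _ ≤ c + ∑ i, Real.exp (κ i) * s i :=
        add_le_add (by simpa using mul_le_mul_of_nonneg_right (key 0) hc.le)
          (Finset.sum_le_sum fun i _ => mul_le_mul_of_nonneg_right (key _) (hs i))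

/-- The constant c is an atom at exponent 0, so a single active κ i₀ ≠ 0 already gives two distinct
points of positive weight, even when κ is constant. -/
theorem sum_mul_div_lt_logRatio (hc : 0 < c) (hs : ∀ i, 0 ≤ s i) (κ : ι → ℝ) {i₀ : ι}
    (hκ : κ i₀ ≠ 0) (hs₀ : s i₀ ≠ 0) :
    ∑ i, κ i * (s i / (c + ∑ j, s j)) < logRatio c s κ := by
  have h0 := add_sum_pos hc hs
  have h1 := add_sum_exp_mul_pos hc hs κ
  set u := c + ∑ i, s i with hu
  set m := ∑ i, κ i * (s i / u) with hm
  have hmu : m * u = ∑ i, κ i * s i := by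
    rw [hm, Finset.sum_mul]
    exact Finset.sum_congr rfl fun i _ => by field_simp
  rw [logRatio, Real.lt_log_iff_exp_lt (div_pos h1 h0), lt_div_iff₀ h0]
  have key : ∀ x : ℝ, Real.exp m * (x - m + 1) ≤ Real.exp x := fun x => by
    have := mul_le_mul_of_nonneg_left (Real.add_one_le_exp (x - m)) (Real.exp_pos m).le
    rwa [← Real.exp_add, add_sub_cancel] at this
  have key' : ∀ x : ℝ, x ≠ m → Real.exp m * (x - m + 1) < Real.exp x := fun x hx => by
    have := mul_lt_mul_of_pos_left (Real.add_one_lt_exp (sub_ne_zero.2 hx)) (Real.exp_pos m)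
    rwa [← Real.exp_add, add_sub_cancel] at this
  have hcalc : Real.exp m * u = Real.exp m * (0 - m + 1) * c
        + ∑ i, Real.exp m * (κ i - m + 1) * s i := by
    have : ∑ i, Real.exp m * (κ i - m + 1) * s i
        = Real.exp m * (∑ i, κ i * s i + (1 - m) * ∑ i, s i) := by
      rw [Finset.mul_sum, ← Finset.sum_add_distrib, Finset.mul_sum]
      exact Finset.sum_congr rfl fun i _ => by ring
    rw [this, ← hmu, hu]; ring
  rw [hcalc]
  -- The mean m cannot equal both 0 and κ i₀; the tangent inequality is strict at whichever point
  -- differs from m.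
  rcases eq_or_ne 0 m with h | h
  · refine add_lt_add_of_le_of_lt (by simpa using mul_le_mul_of_nonneg_right (key 0) hc.le)
      (Finset.sum_lt_sum (fun i _ => mul_le_mul_of_nonneg_right (key _) (hs i))
        ⟨i₀, Finset.mem_univ _, ?_⟩)
    exact mul_lt_mul_of_pos_right (key' _ (h ▸ hκ)) ((hs i₀).lt_of_ne' hs₀)
  · refine add_lt_add_of_lt_of_le ?_
      (Finset.sum_le_sum fun i _ => mul_le_mul_of_nonneg_right (key _) (hs i))
    simpa using mul_lt_mul_of_pos_right (key' 0 h) hc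

/-- Convexity of `logRatio` along rays. -/
theorem logRatio_smul_le (hc : 0 < c) (hs : ∀ i, 0 ≤ s i) (κ : ι → ℝ) {t : ℝ} (ht0 : 0 < t)
    (ht1 : t ≤ 1) : logRatio c s (t • κ) ≤ t * logRatio c s κ := by
  have h0 := add_sum_pos hc hs
  have h1 := add_sum_exp_mul_pos hc hs κ
  have h2 := add_sum_exp_mul_pos hc hs (t • κ)
  set u := c + ∑ i, s i with hu
  have hr := div_pos h1 h0
  rw [logRatio, Real.log_le_iff_le_exp (div_pos h2 h0), logRatio, mul_comm,
    ← Real.rpow_def_of_pos hr]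
  have hw : ∑ i : Option ι, (i.elim (c / u) fun i => s i / u) = 1 := by
    rw [Fintype.sum_option]
    simp only [Option.elim]
    rw [← Finset.sum_div, ← add_div, ← hu, div_self h0.ne']
  have hw0 : ∀ i ∈ (Finset.univ : Finset (Option ι)), 0 ≤ (i.elim (c / u) fun i => s i / u) := by
    rintro (_ | i) -
    · exact (div_pos hc h0).le
    · exact div_nonneg (hs i) h0.le
  have hp : 1 ≤ t⁻¹ := (one_le_inv₀ ht0).2 ht1
  -- Power mean inequality with exponent 1/t; the index `none` carries the weight c/u and the value
  -- 1.
  have := Real.arith_mean_le_rpow_mean Finset.univ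
    (fun i : Option ι => i.elim (c / u) fun i => s i / u)
    (fun i : Option ι => i.elim 1 fun i => Real.exp (t * κ i)) hw0 hw
    (by rintro (_ | i) -
        · exact zero_le_one
        · exact (Real.exp_pos _).le) hp
  rw [Fintype.sum_option, Fintype.sum_option] at this
  simp only [Option.elim, one_div, inv_inv] at this
  convert this using 1
  · rw [add_div, Finset.sum_div, mul_one]
    congr 1
    refine Finset.sum_congr rfl fun i _ => ?_
    simp only [Pi.smul_apply, smul_eq_mul]; ring
  · congr 1
    rw [add_div, Finset.sum_div, Real.one_rpow, mul_one]
    congr 1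
    refine Finset.sum_congr rfl fun i _ => ?_
    rw [← Real.exp_mul, mul_comm t, mul_assoc, mul_inv_cancel₀ ht0.ne', mul_one]; ring

end LogRatio

/-! ### Critical points of the scatter objective and their global minimality. -/

section Critical

open Matrix

variable {ι Ω : Type*} [Fintype ι] [MeasurableSpace Ω]

theorem measurable_dotProduct_mulVec {z : Ω → ι → ℝ} (hz : Measurable z) (C : Matrix ι ι ℝ) :
    Measurable fun y => z y ⬝ᵥ C *ᵥ z y := by
  have : Continuous fun v : ι → ℝ => v ⬝ᵥ C *ᵥ v :=
    continuous_id.dotProduct (continuous_const.matrix_mulVec continuous_id)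
  exact this.measurable.comp hz

theorem Matrix.PosDef.quadratic_nonneg {C : Matrix ι ι ℝ} (hC : C.PosDef) (v : ι → ℝ) :
    0 ≤ v ⬝ᵥ C *ᵥ v := by
  simpa using hC.posSemidef.dotProduct_mulVec_nonneg v

theorem integrable_row_sq_div (Q : Measure Ω) [IsFiniteMeasure Q] {z : Ω → ι → ℝ}
    (hz : Measurable z) {c : ℝ} (hc : 0 < c) (R : Matrix ι ι ℝ) (i : ι) :
    Integrable (fun y => (R *ᵥ z y) i ^ 2 / (c + z y ⬝ᵥ (Rᵀ * R) *ᵥ z y)) Q := by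
  refine Integrable.of_bound (C := 1) ?_ (Filter.Eventually.of_forall fun y => ?_)
  · have : Measurable fun y => (R *ᵥ z y) i :=
      ((continuous_apply i).comp (continuous_const.matrix_mulVec continuous_id)).measurable.comp hz
    exact ((this.pow_const 2).div
      (measurable_const.add (measurable_dotProduct_mulVec hz _))).aestronglyMeasurable
  · rw [dotProduct_transpose_mul_self_mulVec]
    have h1 : (R *ᵥ z y) i ^ 2 ≤ ∑ j, (R *ᵥ z y) j ^ 2 :=
      Finset.single_le_sum (f := fun j => (R *ᵥ z y) j ^ 2) (fun _ _ => sq_nonneg _)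
        (Finset.mem_univ i)
    have h2 : 0 < c + ∑ j, (R *ᵥ z y) j ^ 2 := add_sum_pos hc fun j => sq_nonneg _
    rw [Real.norm_of_nonneg (div_nonneg (sq_nonneg _) h2.le), div_le_one h2]
    linarith

variable [DecidableEq ι]

theorem integrable_log_quadratic_ratio (Q : Measure Ω) [IsFiniteMeasure Q] {z : Ω → ι → ℝ}
    (hz : Measurable z) {c : ℝ} (hc : 0 < c) {C C' : Matrix ι ι ℝ} (hC : C.PosDef)
    (hC' : C'.PosDef) :
    Integrable (fun y => Real.log ((c + z y ⬝ᵥ C' *ᵥ z y) / (c + z y ⬝ᵥ C *ᵥ z y))) Q := by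
  obtain ⟨R, κ, hR, rfl, rfl⟩ := hC.exists_simultaneous_diagonal hC'
  refine Integrable.of_bound (C := ∑ i, |κ i|) ?_ (Filter.Eventually.of_forall fun y => ?_)
  · exact ((measurable_const.add (measurable_dotProduct_mulVec hz _)).div
      (measurable_const.add (measurable_dotProduct_mulVec hz _))).log.aestronglyMeasurable
  · rw [dotProduct_transpose_diagonal_mulVec, dotProduct_transpose_mul_self_mulVec]
    exact abs_logRatio_le hc (fun i => sq_nonneg _)
      (Finset.sum_nonneg fun i _ => abs_nonneg _)
      fun i => Finset.single_le_sum (f := fun i => |κ i|) (fun i _ => abs_nonneg _)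
        (Finset.mem_univ i)

/-- `C` is a critical point of `C ↦ -log det C + a ∫ log (c + z' C z) dQ`. -/
def IsCriticalShape (a c : ℝ) (Q : Measure Ω) (z : Ω → ι → ℝ) (C : Matrix ι ι ℝ) : Prop :=
  ∀ h : ι → ℝ, a * ∫ y, (h ⬝ᵥ z y) ^ 2 / (c + z y ⬝ᵥ C *ᵥ z y) ∂Q = h ⬝ᵥ C⁻¹ *ᵥ h

/-- Test the critical equation on the i-th row of R and use R(R'R)⁻¹R' = 1. These normalizations are
what turns the linear term of Jensen's inequality into ∑ κ i. -/
theorem IsCriticalShape.integral_row {a c : ℝ} {Q : Measure Ω} {z : Ω → ι → ℝ}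
    {R : Matrix ι ι ℝ} (hR : IsUnit R) (h : IsCriticalShape a c Q z (Rᵀ * R)) (i : ι) :
    a * ∫ y, (R *ᵥ z y) i ^ 2 / (c + z y ⬝ᵥ (Rᵀ * R) *ᵥ z y) ∂Q = 1 := by
  have hRd : IsUnit R.det := (isUnit_iff_isUnit_det _).1 hR
  refine (h (R i)).trans ?_
  rw [Matrix.mul_inv_rev]
  have h1 : (R * (R⁻¹ * Rᵀ⁻¹) * Rᵀ) i i = 1 := by
    rw [← Matrix.mul_assoc, mul_nonsing_inv _ hRd, Matrix.one_mul, nonsing_inv_mul, one_apply_eq]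
    rwa [det_transpose]
  rw [← h1, Matrix.mul_assoc, mul_apply, dotProduct]
  refine Finset.sum_congr rfl fun j _ => ?_
  rw [mul_apply]
  rfl

/-- A critical point is the strict global minimum if the law is not carried by a hyperplane. -/
theorem IsCriticalShape.log_det_sub_lt {a c : ℝ} (ha : 0 < a) (hc : 0 < c) {Q : Measure Ω}
    [IsProbabilityMeasure Q] {z : Ω → ι → ℝ} (hz : Measurable z)
    (hQ : ∀ h : ι → ℝ, h ≠ 0 → ¬ ∀ᵐ y ∂Q, h ⬝ᵥ z y = 0)
    {C C' : Matrix ι ι ℝ} (hcrit : IsCriticalShape a c Q z C) (hC : C.PosDef) (hC' : C'.PosDef)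
    (hne : C' ≠ C) :
    Real.log C'.det - Real.log C.det
      < a * ∫ y, Real.log ((c + z y ⬝ᵥ C' *ᵥ z y) / (c + z y ⬝ᵥ C *ᵥ z y)) ∂Q := by
  have hint := integrable_log_quadratic_ratio Q hz hc hC hC'
  obtain ⟨R, κ, hR, rfl, rfl⟩ := hC.exists_simultaneous_diagonal hC'
  have hRd : IsUnit R.det := (isUnit_iff_isUnit_det _).1 hR
  have hd1 : (Rᵀ * R).det ≠ 0 := hC.det_pos.ne'
  have hdet : Real.log (Rᵀ * diagonal (fun i => Real.exp (κ i)) * R).det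
      - Real.log (Rᵀ * R).det = ∑ i, κ i := by
    have : (Rᵀ * diagonal (fun i => Real.exp (κ i)) * R).det
        = (Rᵀ * R).det * Real.exp (∑ i, κ i) := by
      rw [det_mul, det_mul, det_mul, det_diagonal, Real.exp_sum]; ring
    rw [this, Real.log_mul hd1 (Real.exp_pos _).ne', Real.log_exp]; ring
  obtain ⟨i₀, hi₀⟩ : ∃ i, κ i ≠ 0 := by
    by_contra! h
    apply hne
    simp [h]
  set s : Ω → ι → ℝ := fun y i => (R *ᵥ z y) i ^ 2 with hs
  have hs0 : ∀ y i, 0 ≤ s y i := fun y i => sq_nonneg _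
  have hrow : ∀ i, Integrable (fun y => s y i / (c + ∑ j, s y j)) Q := fun i => by
    simpa only [dotProduct_transpose_mul_self_mulVec] using integrable_row_sq_div Q hz hc R i
  have hone : ∀ i, a * ∫ y, s y i / (c + ∑ j, s y j) ∂Q = 1 := fun i => by
    simpa only [dotProduct_transpose_mul_self_mulVec] using hcrit.integral_row hR i
  have heq : ∀ y, Real.log ((c + z y ⬝ᵥ (Rᵀ * diagonal (fun i => Real.exp (κ i)) * R) *ᵥ z y)
      / (c + z y ⬝ᵥ (Rᵀ * R) *ᵥ z y)) = logRatio c (s y) κ := fun y => by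
    rw [dotProduct_transpose_diagonal_mulVec, dotProduct_transpose_mul_self_mulVec]; rfl
  simp only [heq] at hint ⊢
  have hlin : Integrable (fun y => ∑ i, κ i * (s y i / (c + ∑ j, s y j))) Q :=
    integrable_finsetSum _ fun i _ => (hrow i).const_mul _
  -- By criticality the integrated Jensen bound is exactly the difference of the log determinants.
  have hsum : a * ∫ y, ∑ i, κ i * (s y i / (c + ∑ j, s y j)) ∂Q = ∑ i, κ i := by
    rw [integral_finsetSum _ fun i _ => (hrow i).const_mul _, Finset.mul_sum]
    refine Finset.sum_congr rfl fun i _ => ?_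
    rw [integral_const_mul, mul_left_comm, hone, mul_one]
  rw [hdet, ← hsum]
  refine mul_lt_mul_of_pos_left ?_ ha
  refine lt_of_le_of_ne (integral_mono hlin hint fun y =>
    sum_mul_div_le_logRatio hc (hs0 y) κ) fun heq' => ?_
  have h0 : ∫ y, (logRatio c (s y) κ - ∑ i, κ i * (s y i / (c + ∑ j, s y j))) ∂Q = 0 := by
    rw [integral_sub hint hlin, heq', sub_self]
  -- Equality would force equality in Jensen almost everywhere, hence (Rz)_{i₀} = 0 almost
  -- everywhere, putting the law on a hyperplane.
  rw [integral_eq_zero_iff_of_nonneg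
    (fun y => sub_nonneg.2 (sum_mul_div_le_logRatio hc (hs0 y) κ)) (hint.sub hlin)] at h0
  refine hQ (R i₀) (fun h => ?_) ?_
  · exact hRd.ne_zero (det_eq_zero_of_row_eq_zero i₀ fun j => congrFun h j)
  · filter_upwards [h0] with y hy
    by_contra hne'
    have := sum_mul_div_lt_logRatio hc (hs0 y) κ hi₀ (pow_ne_zero 2 hne')
    simp only [Pi.zero_apply] at hy
    linarith

/-- The trace identity at a critical point. -/
theorem IsCriticalShape.integral_inv {a c : ℝ} (hc : 0 < c) {Q : Measure Ω}
    [IsProbabilityMeasure Q] {z : Ω → ι → ℝ} (hz : Measurable z)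
    {C : Matrix ι ι ℝ} (hcrit : IsCriticalShape a c Q z C) (hC : C.PosDef) :
    a * (c * ∫ y, 1 / (c + z y ⬝ᵥ C *ᵥ z y) ∂Q) = a - Fintype.card ι := by
  obtain ⟨R, hR, rfl⟩ := hC.exists_transpose_mul_self
  have hpos : ∀ y, 0 < c + z y ⬝ᵥ (Rᵀ * R) *ᵥ z y := fun y =>
    add_pos_of_pos_of_nonneg hc (hC.quadratic_nonneg _)
  have h1 : ∀ y, c * (1 / (c + z y ⬝ᵥ (Rᵀ * R) *ᵥ z y))
      = 1 - ∑ i, (R *ᵥ z y) i ^ 2 / (c + z y ⬝ᵥ (Rᵀ * R) *ᵥ z y) := fun y => by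
    have := (hpos y).ne'
    rw [← Finset.sum_div, ← dotProduct_transpose_mul_self_mulVec]
    field_simp
    ring
  rw [← integral_const_mul]
  simp only [h1]
  rw [integral_sub (integrable_const _)
    (integrable_finsetSum _ fun i _ => integrable_row_sq_div Q hz hc R i),
    integral_finsetSum _ fun i _ => integrable_row_sq_div Q hz hc R i, mul_sub, Finset.mul_sum]
  simp [hcrit.integral_row hR]

end Critical

/-! ### Reduction of location and scatter in dimension d to scatter in dimension d + 1. -/

section LocationScatter

open Matrix

variable {d : ℕ}

/-- The vector `(y, 1)`. -/
def homog (y : EuclideanSpace ℝ (Fin d)) : Fin d ⊕ Unit → ℝ := Sum.elim (fun i => y i) fun _ => 1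

theorem continuous_homog : Continuous (homog (d := d)) := by
  refine continuous_pi fun i => ?_
  rcases i with i | i
  · exact (EuclideanSpace.proj i : EuclideanSpace ℝ (Fin d) →L[ℝ] ℝ).continuous
  · exact continuous_const

/-- The second moment matrix of `(y, 1)` when `y` has location `μ` and scatter `S`. -/
def momentBlock (μ : Fin d → ℝ) (S : Matrix (Fin d) (Fin d) ℝ) :
    Matrix (Fin d ⊕ Unit) (Fin d ⊕ Unit) ℝ :=
  fromBlocks (S + vecMulVec μ μ) (replicateCol Unit μ) (replicateRow Unit μ) 1

theorem momentBlock_injective {μ μ' : Fin d → ℝ} {S S' : Matrix (Fin d) (Fin d) ℝ}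
    (h : momentBlock μ S = momentBlock μ' S') : μ = μ' ∧ S = S' := by
  rw [momentBlock, momentBlock, fromBlocks_inj] at h
  have h1 : μ = μ' := by
    funext i
    exact congrFun (congrFun h.2.1 i) ()
  subst h1
  exact ⟨rfl, add_right_cancel h.1⟩

theorem det_momentBlock (μ : Fin d → ℝ) (S : Matrix (Fin d) (Fin d) ℝ) :
    (momentBlock μ S).det = S.det := by
  rw [momentBlock, det_fromBlocks_one₂₂, ← vecMulVec_eq, add_sub_cancel_right]

theorem dotProduct_momentBlock_mulVec (μ : Fin d → ℝ) (S : Matrix (Fin d) (Fin d) ℝ)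
    (w : Fin d ⊕ Unit → ℝ) :
    w ⬝ᵥ momentBlock μ S *ᵥ w
      = (w ∘ Sum.inl) ⬝ᵥ S *ᵥ (w ∘ Sum.inl) + (μ ⬝ᵥ (w ∘ Sum.inl) + w (Sum.inr ())) ^ 2 := by
  have h1 : replicateCol Unit μ *ᵥ (w ∘ Sum.inr) = w (Sum.inr ()) • μ := by
    funext i
    simp [mulVec, dotProduct, mul_comm]
  have h2 : replicateRow Unit μ *ᵥ (w ∘ Sum.inl) = fun _ => μ ⬝ᵥ (w ∘ Sum.inl) := rfl
  rw [momentBlock, fromBlocks_mulVec, dotProduct_block, h1, h2]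
  simp only [Sum.elim_comp_inl, Sum.elim_comp_inr, add_mulVec, vecMulVec_mulVec, one_mulVec,
    dotProduct_add, dotProduct_smul]
  have h3 : ((w ∘ Sum.inr) ⬝ᵥ fun _ : Unit => μ ⬝ᵥ (w ∘ Sum.inl))
      = w (Sum.inr ()) * (μ ⬝ᵥ (w ∘ Sum.inl)) := by simp [dotProduct]
  have h4 : ((w ∘ Sum.inr) ⬝ᵥ (w ∘ Sum.inr)) = w (Sum.inr ()) * w (Sum.inr ()) := by
    simp [dotProduct]
  rw [h3, h4, dotProduct_comm (w ∘ Sum.inl) μ]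
  simp only [smul_eq_mul, MulOpposite.smul_eq_mul_unop, MulOpposite.unop_op]
  ring

theorem momentBlock_isHermitian {μ : Fin d → ℝ} {S : Matrix (Fin d) (Fin d) ℝ}
    (hS : S.IsHermitian) : (momentBlock μ S).IsHermitian := by
  rw [IsHermitian, conjTranspose_eq_transpose_of_trivial] at hS ⊢
  rw [momentBlock, fromBlocks_transpose, transpose_add, hS, transpose_vecMulVec,
    transpose_replicateCol, transpose_replicateRow, transpose_one]

theorem posDef_momentBlock {μ : Fin d → ℝ} {S : Matrix (Fin d) (Fin d) ℝ} (hS : S.PosDef) :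
    (momentBlock μ S).PosDef := by
  refine posDef_iff_dotProduct_mulVec.2 ⟨momentBlock_isHermitian hS.isHermitian, fun w hw => ?_⟩
  rw [star_trivial, dotProduct_momentBlock_mulVec]
  by_cases h : w ∘ Sum.inl = 0
  · rw [h]
    simp only [zero_dotProduct, dotProduct_zero, zero_add]
    refine sq_pos_of_ne_zero fun h' => hw ?_
    funext i
    rcases i with i | i
    · exact congrFun h i
    · exact h'
  · have := (posDef_iff_dotProduct_mulVec.1 hS).2 h
    rw [star_trivial] at this
    positivity

theorem posDef_of_posDef_momentBlock {μ : Fin d → ℝ} {S : Matrix (Fin d) (Fin d) ℝ}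
    (h : (momentBlock μ S).PosDef) (hS : S.IsHermitian) : S.PosDef := by
  refine posDef_iff_dotProduct_mulVec.2 ⟨hS, fun x hx => ?_⟩
  have hw : Sum.elim x (fun _ : Unit => -(μ ⬝ᵥ x)) ≠ 0 := fun h0 => hx <| by
    funext i
    exact congrFun h0 (Sum.inl i)
  have := (posDef_iff_dotProduct_mulVec.1 h).2 hw
  rw [star_trivial, dotProduct_momentBlock_mulVec] at this
  simpa using this

/-- This is what makes the lift work: ν + mahalanobis equals (ν - 1) + z'Cz, so passing to z = (y,
1) only lowers the constant from ν to ν - 1. -/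
theorem homog_dotProduct_inv_momentBlock (y μ : EuclideanSpace ℝ (Fin d))
    {S : Matrix (Fin d) (Fin d) ℝ} (hS : S.PosDef) :
    homog y ⬝ᵥ (momentBlock (fun i => μ i) S)⁻¹ *ᵥ homog y = 1 + mahalanobis y μ S := by
  have hSd : IsUnit S.det := hS.det_pos.ne'.isUnit
  have hAd : IsUnit (momentBlock (fun i => μ i) S).det := by rwa [det_momentBlock]
  set v : Fin d → ℝ := fun i => (y - μ) i with hv
  -- The solution of `momentBlock μ S *ᵥ w = homog y` found by block elimination; it avoids
  -- computing the inverse.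
  set w : Fin d ⊕ Unit → ℝ := Sum.elim (S⁻¹ *ᵥ v) fun _ => 1 - (fun i => μ i) ⬝ᵥ S⁻¹ *ᵥ v with hw
  have hyv : (fun i => y i) = v + fun i => μ i := by
    funext i; simp [hv]
  have hAw : momentBlock (fun i => μ i) S *ᵥ w = homog y := by
    have h1 : replicateCol Unit (fun i => μ i) *ᵥ (w ∘ Sum.inr)
        = w (Sum.inr ()) • fun i => μ i := by
      funext i
      simp [mulVec, dotProduct, mul_comm]
    have h2 : replicateRow Unit (fun i => μ i) *ᵥ (w ∘ Sum.inl)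
        = fun _ => (fun i => μ i) ⬝ᵥ (w ∘ Sum.inl) := rfl
    rw [momentBlock, fromBlocks_mulVec, h1, h2, homog, hyv]
    congr 1
    · rw [hw, Sum.elim_comp_inl, add_mulVec, mulVec_mulVec, mul_nonsing_inv _ hSd, one_mulVec,
        vecMulVec_mulVec]
      funext i
      simp [mul_comm]
      ring
    · funext i
      rw [hw, Sum.elim_comp_inl, Sum.elim_comp_inr, one_mulVec]
      simp
  rw [← hAw, mulVec_mulVec, nonsing_inv_mul _ hAd, one_mulVec, hAw, homog, hw,
    dotProduct_block, Sum.elim_comp_inl, Sum.elim_comp_inr, Sum.elim_comp_inl, Sum.elim_comp_inr,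
    hyv, add_dotProduct, mahalanobis]
  change _ = 1 + v ⬝ᵥ S⁻¹ *ᵥ v
  have h1 : ((fun _ : Unit => (1 : ℝ)) ⬝ᵥ fun _ => 1 - (fun i => μ i) ⬝ᵥ S⁻¹ *ᵥ v)
      = 1 - (fun i => μ i) ⬝ᵥ S⁻¹ *ᵥ v := by simp [dotProduct]
  rw [h1]
  ring

theorem mahalanobis_nonneg (y μ : EuclideanSpace ℝ (Fin d)) {S : Matrix (Fin d) (Fin d) ℝ}
    (hS : S.PosDef) : 0 ≤ mahalanobis y μ S :=
  hS.inv.quadratic_nonneg _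

/-- A critical shape matrix for the laws of `(y, 1)` whose inverse has the block form of a second
moment matrix gives the location and scatter. -/
theorem isTLocationScatter_of_critical {ν : ℝ} (hν : 1 < ν)
    (Q : ProbabilityMeasure (EuclideanSpace ℝ (Fin d)))
    (hQ : ∀ h : Fin d ⊕ Unit → ℝ, h ≠ 0 →
      ¬ ∀ᵐ y ∂(Q : Measure (EuclideanSpace ℝ (Fin d))), h ⬝ᵥ homog y = 0)
    (μ : EuclideanSpace ℝ (Fin d)) (S : Matrix (Fin d) (Fin d) ℝ) (hS : S.PosDef)
    (hcrit : IsCriticalShape (ν + d) (ν - 1) (Q : Measure (EuclideanSpace ℝ (Fin d))) homog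
      (momentBlock (fun i => μ i) S)⁻¹) :
    IsTLocationScatter ν Q (μ, S) := by
  have hc : 0 < ν - 1 := by linarith
  have ha : 0 < ν + d := by positivity
  have hz : Measurable (homog (d := d)) := continuous_homog.measurable
  have hu : ∀ y (η : EuclideanSpace ℝ (Fin d) × Matrix (Fin d) (Fin d) ℝ), η.2.PosDef →
      ν - 1 + homog y ⬝ᵥ (momentBlock (fun i => η.1 i) η.2)⁻¹ *ᵥ homog y
        = ν + mahalanobis y η.1 η.2 := fun y η hη => by
    rw [homog_dotProduct_inv_momentBlock y η.1 hη]; ring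
  have hupos : ∀ y (η : EuclideanSpace ℝ (Fin d) × Matrix (Fin d) (Fin d) ℝ), η.2.PosDef →
      0 < ν + mahalanobis y η.1 η.2 := fun y η hη => by
    have := mahalanobis_nonneg y η.1 hη
    linarith
  have hpd : ∀ η : EuclideanSpace ℝ (Fin d) × Matrix (Fin d) (Fin d) ℝ, η.2.PosDef →
      (momentBlock (fun i => η.1 i) η.2)⁻¹.PosDef := fun η hη => (posDef_momentBlock hη).inv
  have h01 : ((0, 1) : EuclideanSpace ℝ (Fin d) × Matrix (Fin d) (Fin d) ℝ).2.PosDef := PosDef.one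
  have hdiff : ∀ y (η θ : EuclideanSpace ℝ (Fin d) × Matrix (Fin d) (Fin d) ℝ), η.2.PosDef →
      θ.2.PosDef → tLoss ν y η - tLoss ν y θ = 1 / 2 * (Real.log η.2.det - Real.log θ.2.det)
        + (ν + d) / 2 * Real.log
          ((ν - 1 + homog y ⬝ᵥ (momentBlock (fun i => η.1 i) η.2)⁻¹ *ᵥ homog y)
          / (ν - 1 + homog y ⬝ᵥ (momentBlock (fun i => θ.1 i) θ.2)⁻¹ *ᵥ homog y)) := by
    intro y η θ hη hθ
    rw [hu y η hη, hu y θ hθ, tLoss, tLoss, tRho, tRho,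
      Real.log_div (hupos y η hη).ne' (by linarith), Real.log_div (hupos y θ hθ).ne' (by linarith),
      Real.log_div (hupos y η hη).ne' (hupos y θ hθ).ne']
    ring
  have hint : ∀ η θ : EuclideanSpace ℝ (Fin d) × Matrix (Fin d) (Fin d) ℝ, η.2.PosDef →
      θ.2.PosDef → Integrable (fun y => tLoss ν y η - tLoss ν y θ)
        (Q : Measure (EuclideanSpace ℝ (Fin d))) := by
    intro η θ hη hθ
    simp only [fun y => hdiff y η θ hη hθ]
    exact (integrable_const _).add
      ((integrable_log_quadratic_ratio _ hz hc (hpd θ hθ) (hpd η hη)).const_mul _)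
  refine ⟨hS, fun η hη => hint η (0, 1) hη h01, fun η hη hne => ?_⟩
  have hadj : ∀ η : EuclideanSpace ℝ (Fin d) × Matrix (Fin d) (Fin d) ℝ, η.2.PosDef →
      Integrable (fun y => tAdjustedLoss ν y η) (Q : Measure (EuclideanSpace ℝ (Fin d))) :=
    fun η hη => hint η _ hη h01
  rw [← sub_pos, ← integral_sub (hadj η hη) (hadj (μ, S) hS)]
  have : ∀ y, tAdjustedLoss ν y η - tAdjustedLoss ν y (μ, S) = tLoss ν y η - tLoss ν y (μ, S) :=
    fun y => by rw [tAdjustedLoss, tAdjustedLoss]; ring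
  simp only [this, fun y => hdiff y η (μ, S) hη hS]
  rw [integral_add (integrable_const _)
    ((integrable_log_quadratic_ratio _ hz hc (hpd (μ, S) hS) (hpd η hη)).const_mul _),
    integral_const_mul]
  have hne' : (momentBlock (fun i => η.1 i) η.2)⁻¹ ≠ (momentBlock (fun i => μ i) S)⁻¹ := by
    intro h
    have h2 := congrArg (fun M => M⁻¹) h
    simp only at h2
    rw [nonsing_inv_nonsing_inv _ (posDef_momentBlock hη).det_pos.ne'.isUnit,
      nonsing_inv_nonsing_inv _ (posDef_momentBlock hS).det_pos.ne'.isUnit] at h2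
    obtain ⟨h3, h4⟩ := momentBlock_injective h2
    refine hne (Prod.ext ?_ h4)
    ext i
    exact congrFun h3 i
  have key := hcrit.log_det_sub_lt ha hc hz hQ (hpd (μ, S) hS) (hpd η hη) hne'
  rw [det_nonsing_inv, det_nonsing_inv, det_momentBlock, det_momentBlock, Ring.inverse_eq_inv',
    Real.log_inv, Real.log_inv] at key
  rw [integral_const_mul]
  simp only [integral_const, probReal_univ, smul_eq_mul]
  linarith

/-- The location and scatter read off from a critical shape matrix. -/
theorem IsCriticalShape.isTLocationScatter {ν : ℝ} (hν : 1 < ν)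
    (Q : ProbabilityMeasure (EuclideanSpace ℝ (Fin d)))
    (hQ : ∀ h : Fin d ⊕ Unit → ℝ, h ≠ 0 →
      ¬ ∀ᵐ y ∂(Q : Measure (EuclideanSpace ℝ (Fin d))), h ⬝ᵥ homog y = 0)
    {C A : Matrix (Fin d ⊕ Unit) (Fin d ⊕ Unit) ℝ} (hC : C.PosDef) (hA : C⁻¹ = A)
    (hcrit : IsCriticalShape (ν + d) (ν - 1) (Q : Measure (EuclideanSpace ℝ (Fin d))) homog C) :
    IsTLocationScatter ν Q (WithLp.toLp 2 fun i => A (Sum.inl i) (Sum.inr ()),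
      of fun i j => A (Sum.inl i) (Sum.inl j)
        - A (Sum.inl i) (Sum.inr ()) * A (Sum.inl j) (Sum.inr ())) := by
  have hc : 0 < ν - 1 := by linarith
  have hApd : A.PosDef := hA ▸ hC.inv
  have hsymm : ∀ i j, A i j = A j i := fun i j => by
    have := hApd.isHermitian
    rw [IsHermitian, conjTranspose_eq_transpose_of_trivial] at this
    exact congrFun (congrFun this j) i
  -- Here the choices a = ν + d and c = ν - 1 matter: the trace identity in dimension d + 1 gives a
  -- c ∫ 1/(c + z'Cz) = ν - 1 = c, while testing on the last basis vector identifies a ∫ 1/(c +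
  -- z'Cz) with the corner entry.
  have hN : A (Sum.inr ()) (Sum.inr ()) = 1 := by
    have h1 := hcrit.integral_inv hc continuous_homog.measurable hC
    have h2 := hcrit (Pi.single (Sum.inr ()) 1)
    simp only [single_one_dotProduct, mulVec_single_one, hA] at h2
    have h3 : ∀ y : EuclideanSpace ℝ (Fin d), homog y (Sum.inr ()) ^ 2 = 1 := fun y => by
      simp [homog]
    simp only [h3] at h2
    change _ = A (Sum.inr ()) (Sum.inr ()) at h2
    rw [mul_left_comm, h2] at h1
    have h4 : (Fintype.card (Fin d ⊕ Unit) : ℝ) = d + 1 := by simp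
    rw [h4] at h1
    have h5 : (ν - 1) * A (Sum.inr ()) (Sum.inr ()) = (ν - 1) * 1 := by rw [h1]; ring
    exact mul_left_cancel₀ hc.ne' h5
  set S : Matrix (Fin d) (Fin d) ℝ := of fun i j => A (Sum.inl i) (Sum.inl j)
        - A (Sum.inl i) (Sum.inr ()) * A (Sum.inl j) (Sum.inr ()) with hSdef
  have hAm : momentBlock (fun i => A (Sum.inl i) (Sum.inr ())) S = A := by
    ext (i | i) (j | j)
    · simp [momentBlock, hSdef, vecMulVec_apply]
    · simp [momentBlock]
    · simp [momentBlock, hsymm (Sum.inr ()) (Sum.inl j)]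
    · simp [momentBlock, hN]
  have hSpd : S.PosDef := by
    refine posDef_of_posDef_momentBlock (hAm.symm ▸ hApd) ?_
    ext i j
    simp [hSdef, hsymm (Sum.inl i) (Sum.inl j), mul_comm]
  refine isTLocationScatter_of_critical hν Q hQ _ S hSpd ?_
  have : momentBlock (fun i => (WithLp.toLp 2 fun i => A (Sum.inl i) (Sum.inr ()) :
    EuclideanSpace ℝ (Fin d)) i) S = A := hAm
  rw [this, ← hA, nonsing_inv_nonsing_inv _ hC.det_pos.ne'.isUnit]
  exact hcrit

end LocationScatter

/-! ### Masses of affine flats: uniformity of the condition on P and stability under perturbation.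
-/

section Flats

open Matrix Filter Topology

variable {d : ℕ}

/-- The affine flat `{y : R (y, 1) = 0}`. -/
def flat {m : Type*} (R : Matrix m (Fin d ⊕ Unit) ℝ) : Set (EuclideanSpace ℝ (Fin d)) :=
  {y | R *ᵥ homog y = 0}

theorem continuous_mulVec_homog {m : Type*} (R : Matrix m (Fin d ⊕ Unit) ℝ) :
    Continuous fun y => R *ᵥ homog y :=
  continuous_const.matrix_mulVec continuous_homog

theorem isClosed_flat {m : Type*} (R : Matrix m (Fin d ⊕ Unit) ℝ) : IsClosed (flat R) :=
  isClosed_eq (continuous_mulVec_homog R) continuous_const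

theorem card_le_of_mul_transpose_eq_one {m ι : Type*} [Fintype m] [DecidableEq m] [Fintype ι]
    {R : Matrix m ι ℝ} (hR : R * Rᵀ = 1) : Fintype.card m ≤ Fintype.card ι :=
  calc Fintype.card m = (R * Rᵀ).rank := by rw [hR, rank_one]
    _ ≤ R.rank := rank_mul_le_left _ _
    _ ≤ Fintype.card ι := rank_le_card_width R

/-- The linear part `v ↦ R (v, 0)` of `y ↦ R (y, 1)`. -/
def flatLinear {m : Type*} (R : Matrix m (Fin d ⊕ Unit) ℝ) :
    EuclideanSpace ℝ (Fin d) →ₗ[ℝ] m → ℝ where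
  toFun v := R *ᵥ Sum.elim (fun i => v i) fun _ => 0
  map_add' v w := by
    rw [← mulVec_add]
    congr 1
    ext (i | i) <;> simp
  map_smul' c v := by
    rw [RingHom.id_apply, ← mulVec_smul]
    congr 1
    ext (i | i) <;> simp

theorem flatLinear_sub {m : Type*} (R : Matrix m (Fin d ⊕ Unit) ℝ)
    (y y₀ : EuclideanSpace ℝ (Fin d)) :
    flatLinear R (y - y₀) = R *ᵥ homog y - R *ᵥ homog y₀ := by
  rw [← mulVec_sub]
  change R *ᵥ _ = _
  congr 1
  ext (i | i) <;> simp [homog]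

theorem coe_mk'_ker_flatLinear {m : Type*} {R : Matrix m (Fin d ⊕ Unit) ℝ}
    {y₀ : EuclideanSpace ℝ (Fin d)} (h₀ : y₀ ∈ flat R) :
    (AffineSubspace.mk' y₀ (LinearMap.ker (flatLinear R)) : Set (EuclideanSpace ℝ (Fin d)))
      = flat R := by
  ext y
  rw [SetLike.mem_coe, AffineSubspace.mem_mk', vsub_eq_sub, LinearMap.mem_ker, flatLinear_sub,
    show R *ᵥ homog y₀ = 0 from h₀, sub_zero]
  rfl

/-- If y₀ lies on the flat then R kills (y₀, 1). Subtracting a multiple of this vector makes the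
last coordinate zero without changing the image, so R stays onto after restriction to vectors (v,
0). -/
theorem finrank_ker_flatLinear {m : Type*} [Fintype m] [DecidableEq m]
    {R : Matrix m (Fin d ⊕ Unit) ℝ} (hR : R * Rᵀ = 1)
    {y₀ : EuclideanSpace ℝ (Fin d)} (h₀ : y₀ ∈ flat R) :
    Module.finrank ℝ (LinearMap.ker (flatLinear R)) + Fintype.card m = d := by
  have hsurj : LinearMap.range (flatLinear R) = ⊤ := by
    refine LinearMap.range_eq_top.2 fun w => ?_
    set x : Fin d ⊕ Unit → ℝ := Rᵀ *ᵥ w with hx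
    have hRx : R *ᵥ x = w := by rw [hx, mulVec_mulVec, hR, one_mulVec]
    refine ⟨WithLp.toLp 2 fun i => x (Sum.inl i) - x (Sum.inr ()) * y₀ i, ?_⟩
    have : (Sum.elim (fun i => x (Sum.inl i) - x (Sum.inr ()) * y₀ i) fun _ => 0 :
        Fin d ⊕ Unit → ℝ) = x - x (Sum.inr ()) • homog y₀ := by
      ext (i | i) <;> simp [homog]
    change R *ᵥ (Sum.elim (fun i => x (Sum.inl i) - x (Sum.inr ()) * y₀ i) fun _ => 0) = w
    rw [this, mulVec_sub, mulVec_smul, show R *ᵥ homog y₀ = 0 from h₀, smul_zero, sub_zero, hRx]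
  have h := LinearMap.finrank_range_add_finrank_ker (flatLinear R)
  rw [hsurj, finrank_top, Module.finrank_fintype_fun_eq_card, finrank_euclideanSpace_fin] at h
  omega

/-- An empty flat is not covered by the hypothesis and may have up to d + 1 rows; the bound is still
positive because d + 1 < ν + d. -/
theorem measureReal_flat_lt {ν : ℝ} (hν : 1 < ν)
    {P : ProbabilityMeasure (EuclideanSpace ℝ (Fin d))} (hP : P ∈ lawsV d (ν + d))
    {m : Type*} [Fintype m] [DecidableEq m] [Nonempty m] {R : Matrix m (Fin d ⊕ Unit) ℝ}
    (hR : R * Rᵀ = 1) :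
    (P : Measure (EuclideanSpace ℝ (Fin d))).real (flat R)
      < 1 - Fintype.card m / (ν + d) := by
  have ha : 0 < ν + d := by positivity
  have hm : 0 < Fintype.card m := Fintype.card_pos
  rcases (flat R).eq_empty_or_nonempty with h | ⟨y₀, h₀⟩
  · have h1 : (Fintype.card m : ℝ) ≤ d + 1 := by
      have := card_le_of_mul_transpose_eq_one hR
      rw [Fintype.card_sum, Fintype.card_fin, Fintype.card_unit] at this
      exact_mod_cast this
    rw [h, measureReal_empty, sub_pos, div_lt_one ha]
    linarith
  · have hcoe := coe_mk'_ker_flatLinear h₀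
    have hfin := finrank_ker_flatLinear hR h₀
    have := hP (AffineSubspace.mk' y₀ (LinearMap.ker (flatLinear R))) (by rw [hcoe]; exact ⟨_, h₀⟩)
      (by rw [AffineSubspace.direction_mk']; omega)
    rw [hcoe, AffineSubspace.direction_mk'] at this
    convert this using 3
    rw [eq_sub_iff_add_eq, add_comm]
    exact_mod_cast hfin

theorem not_ae_dotProduct_homog_eq_zero {ν : ℝ} (hν : 1 < ν)
    {P : ProbabilityMeasure (EuclideanSpace ℝ (Fin d))} (hP : P ∈ lawsV d (ν + d))
    {h : Fin d ⊕ Unit → ℝ} (hh : h ≠ 0) :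
    ¬ ∀ᵐ y ∂(P : Measure (EuclideanSpace ℝ (Fin d))), h ⬝ᵥ homog y = 0 := by
  intro hae
  have ha : 0 < ν + d := by positivity
  have hpos : 0 < h ⬝ᵥ h := by
    have := dotProduct_star_self_pos_iff.2 hh
    rwa [star_trivial] at this
  set R : Matrix Unit (Fin d ⊕ Unit) ℝ := replicateRow Unit ((√(h ⬝ᵥ h))⁻¹ • h) with hRdef
  have hR : R * Rᵀ = 1 := by
    ext i j
    rw [hRdef, transpose_replicateRow, mul_apply]
    change ((√(h ⬝ᵥ h))⁻¹ • h) ⬝ᵥ ((√(h ⬝ᵥ h))⁻¹ • h) = _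
    rw [smul_dotProduct, dotProduct_smul, smul_eq_mul, smul_eq_mul, ← mul_assoc, ← mul_inv,
      Real.mul_self_sqrt hpos.le, inv_mul_cancel₀ hpos.ne']
    simp
  have h1 := measureReal_flat_lt hν hP hR
  have h2 : (P : Measure (EuclideanSpace ℝ (Fin d))).real (flat R) = 1 := by
    rw [← probReal_univ (μ := (P : Measure (EuclideanSpace ℝ (Fin d))))]
    refine measureReal_congr (eventuallyEq_set.2 ?_)
    filter_upwards [hae] with y hy
    simp only [Set.mem_univ, iff_true]
    funext i
    change ((√(h ⬝ᵥ h))⁻¹ • h) ⬝ᵥ homog y = 0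
    rw [smul_dotProduct, hy, smul_zero]
  rw [h2] at h1
  have : 0 < (Fintype.card Unit : ℝ) / (ν + d) := by simpa using ha
  linarith

theorem continuous_sum_mulVec_sq {m ι : Type*} [Fintype m] [Fintype ι] (z : ι → ℝ) :
    Continuous fun R : m → ι → ℝ => ∑ i, (of R *ᵥ z) i ^ 2 := by
  refine continuous_finsetSum _ fun i _ => Continuous.pow ?_ 2
  exact continuous_finsetSum _ fun j _ => (continuous_apply_apply i j).mul continuous_const

/-- Upper semicontinuity of R ↦ P(flat R): with ψ the squared length of R(y, 1), the mass is the
limit, and a lower bound, of the continuous functions ∫ 1/(1 + kψ) dP. -/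
theorem isOpen_setOf_measureReal_flat_lt (P : Measure (EuclideanSpace ℝ (Fin d)))
    [IsProbabilityMeasure P] {m : Type*} [Fintype m] (t : ℝ) :
    IsOpen {R : m → Fin d ⊕ Unit → ℝ | P.real (flat (of R)) < t} := by
  set ψ : (m → Fin d ⊕ Unit → ℝ) → EuclideanSpace ℝ (Fin d) → ℝ :=
    fun R y => ∑ i, (of R *ᵥ homog y) i ^ 2 with hψ
  have hψ0 : ∀ R y, 0 ≤ ψ R y := fun R y => Finset.sum_nonneg fun i _ => sq_nonneg _
  have hflat : ∀ R y, y ∈ flat (of R) ↔ ψ R y = 0 := fun R y => by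
    rw [hψ, Finset.sum_eq_zero_iff_of_nonneg fun i _ => sq_nonneg _]
    simp only [Finset.mem_univ, true_imp_iff, sq_eq_zero_iff]
    exact funext_iff
  have hψy : ∀ R, Continuous (ψ R) := fun R =>
    continuous_finsetSum _ fun i _ =>
      ((continuous_apply i).comp (continuous_mulVec_homog (of R))).pow 2
  have hden : ∀ (k : ℕ) R y, 0 < 1 + (k : ℝ) * ψ R y := fun k R y =>
    add_pos_of_pos_of_nonneg one_pos (mul_nonneg k.cast_nonneg (hψ0 R y))
  set e : ℕ → (m → Fin d ⊕ Unit → ℝ) → EuclideanSpace ℝ (Fin d) → ℝ :=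
    fun k R y => (1 + (k : ℝ) * ψ R y)⁻¹ with he
  have hebd : ∀ k R y, ‖e k R y‖ ≤ 1 := fun k R y => by
    rw [he, Real.norm_of_nonneg (inv_nonneg.2 (hden k R y).le)]
    exact inv_le_one_of_one_le₀ (le_add_of_nonneg_right (mul_nonneg k.cast_nonneg (hψ0 R y)))
  have hmeas : ∀ k R, AEStronglyMeasurable (e k R) P := fun k R =>
    ((continuous_const.add (continuous_const.mul (hψy R))).inv₀
      fun y => (hden k R y).ne').aestronglyMeasurable
  have hecont : ∀ k, Continuous fun R => ∫ y, e k R y ∂P := fun k => by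
    refine continuous_of_dominated (hmeas k) (fun R => ae_of_all _ (hebd k R))
      (integrable_const 1) (ae_of_all _ fun y => ?_)
    exact (continuous_const.add (continuous_const.mul (continuous_sum_mulVec_sq _))).inv₀
      fun R => (hden k R y).ne'
  have hle : ∀ k R, P.real (flat (of R)) ≤ ∫ y, e k R y ∂P := fun k R => by
    rw [← integral_indicator_one (isClosed_flat (of R)).measurableSet]
    refine integral_mono_of_nonneg (ae_of_all _ fun y => Set.indicator_nonneg (by simp) y)
      (Integrable.of_bound (hmeas k R) 1 (ae_of_all _ (hebd k R))) (ae_of_all _ fun y => ?_)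
    by_cases hy : y ∈ flat (of R)
    · simp [Set.indicator_of_mem hy, he, (hflat R y).1 hy]
    · rw [Set.indicator_of_notMem hy]
      exact inv_nonneg.2 (hden k R y).le
  have htend : ∀ R, Tendsto (fun k => ∫ y, e k R y ∂P) atTop (𝓝 (P.real (flat (of R)))) := by
    intro R
    rw [← integral_indicator_one (isClosed_flat (of R)).measurableSet]
    refine tendsto_integral_of_dominated_convergence (fun _ => 1) (fun k => hmeas k R)
      (integrable_const 1) (fun k => ae_of_all _ (hebd k R)) (ae_of_all _ fun y => ?_)
    by_cases hy : y ∈ flat (of R)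
    · simp [Set.indicator_of_mem hy, he, (hflat R y).1 hy]
    · rw [Set.indicator_of_notMem hy]
      refine tendsto_inv_atTop_zero.comp (tendsto_atTop_add_const_left _ _ ?_)
      exact tendsto_natCast_atTop_atTop.atTop_mul_const
        ((hψ0 R y).lt_of_ne' fun h => hy ((hflat R y).2 h))
  refine isOpen_iff_mem_nhds.2 fun R hR => ?_
  obtain ⟨k, hk⟩ := ((htend R).eventually_lt_const hR).exists
  filter_upwards [(hecont k).continuousAt.eventually_lt_const hk] with R' hR'
  exact (hle k R').trans_lt hR'

theorem isCompact_setOf_mul_transpose_eq_one (m ι : Type*) [Fintype m] [DecidableEq m]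
    [Fintype ι] : IsCompact {R : m → ι → ℝ | of R * (of R)ᵀ = 1} := by
  refine (isCompact_univ_pi fun _ : m => isCompact_univ_pi fun _ : ι =>
    isCompact_Icc (a := (-1 : ℝ)) (b := 1)).of_isClosed_subset ?_ ?_
  · have : Continuous fun R : m → ι → ℝ => (of R * (of R)ᵀ : Matrix m m ℝ) :=
      continuous_id.matrix_mul continuous_id.matrix_transpose
    exact isClosed_eq this continuous_const
  · intro R hR i _ j _
    have h := congrFun (congrFun hR i) i
    rw [mul_apply, one_apply_eq] at h
    have h1 : R i j ^ 2 ≤ 1 := by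
      rw [← h, sq]
      exact Finset.single_le_sum (f := fun j => of R i j * (of R)ᵀ j i)
        (fun j _ => mul_self_nonneg (R i j)) (Finset.mem_univ j)
    exact abs_le.1 ((sq_le_one_iff_abs_le_one _).1 h1)

/-- The defining condition of `lawsV` holds uniformly over all flats. -/
theorem exists_measureReal_flat_le {ν : ℝ} (hν : 1 < ν)
    {P : ProbabilityMeasure (EuclideanSpace ℝ (Fin d))} (hP : P ∈ lawsV d (ν + d)) :
    ∃ b : ℝ, 1 / (ν + d) < b ∧ ∀ (m : Type) [Fintype m] [DecidableEq m] [Nonempty m]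
      (R : Matrix m (Fin d ⊕ Unit) ℝ), R * Rᵀ = 1 →
      (P : Measure (EuclideanSpace ℝ (Fin d))).real (flat R) ≤ 1 - b * Fintype.card m := by
  have ha : 0 < ν + d := by positivity
  have hstep : ∀ n : ℕ, ∃ b : ℝ, 1 / (ν + d) < b ∧ (0 < n →
      ∀ R : Matrix (Fin n) (Fin d ⊕ Unit) ℝ, R * Rᵀ = 1 →
      (P : Measure (EuclideanSpace ℝ (Fin d))).real (flat R) ≤ 1 - b * n) := by
    intro n
    rcases Set.eq_empty_or_nonempty {R : Fin n → Fin d ⊕ Unit → ℝ | of R * (of R)ᵀ = 1} with h | h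
    · refine ⟨1 / (ν + d) + 1, lt_add_one _, fun _ R hR => ?_⟩
      have : (R : Fin n → Fin d ⊕ Unit → ℝ) ∈
        {R : Fin n → Fin d ⊕ Unit → ℝ | of R * (of R)ᵀ = 1} := hR
      rw [h] at this
      exact this.elim
    -- An upper semicontinuous function attains its maximum on the compact set of orthonormal
    -- frames, so the strict inequality at the maximizer yields a gap valid for all frames with n
    -- rows.
    · have husc : UpperSemicontinuous fun R : Fin n → Fin d ⊕ Unit → ℝ =>
          (P : Measure (EuclideanSpace ℝ (Fin d))).real (flat (of R)) :=
        upperSemicontinuous_iff_isOpen_preimage.2 fun t => isOpen_setOf_measureReal_flat_lt _ t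
      obtain ⟨R₀, hR₀, hmax⟩ := (husc.upperSemicontinuousOn _).exists_isMaxOn h
        (isCompact_setOf_mul_transpose_eq_one (Fin n) (Fin d ⊕ Unit))
      rcases Nat.eq_zero_or_pos n with hn | hn
      · exact ⟨1 / (ν + d) + 1, lt_add_one _, fun h => by omega⟩
      · have hn' : (0 : ℝ) < n := by exact_mod_cast hn
        have : Nonempty (Fin n) := ⟨⟨0, hn⟩⟩
        have hlt := measureReal_flat_lt hν hP (R := of R₀) hR₀
        rw [Fintype.card_fin] at hlt
        refine ⟨(1 - (P : Measure (EuclideanSpace ℝ (Fin d))).real (flat (of R₀))) / n, ?_,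
          fun _ R hR => ?_⟩
        · rw [lt_div_iff₀ hn', one_div_mul_eq_div]
          linarith
        · rw [div_mul_cancel₀ _ hn'.ne', sub_sub_cancel]
          exact hmax hR
  choose b hb hb' using hstep
  -- Orthonormal families in dimension d + 1 have at most d + 1 members, so a finite minimum over n
  -- suffices.
  have hne : (Finset.Icc 0 (d + 1)).Nonempty := ⟨0, by simp⟩
  refine ⟨(Finset.Icc 0 (d + 1)).inf' hne b, (Finset.lt_inf'_iff _).2 fun n _ => hb n,
    fun m _ _ _ R hR => ?_⟩
  have hcard : Fintype.card m ∈ Finset.Icc 0 (d + 1) := by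
    have := card_le_of_mul_transpose_eq_one hR
    rw [Fintype.card_sum, Fintype.card_fin, Fintype.card_unit] at this
    simpa using this
  set e := Fintype.equivFin m
  set R' : Matrix (Fin (Fintype.card m)) (Fin d ⊕ Unit) ℝ := R.submatrix e.symm id with hR'
  have h1 : R' * R'ᵀ = 1 := by
    rw [hR', transpose_submatrix]
    change R.submatrix e.symm (Equiv.refl _) * Rᵀ.submatrix (Equiv.refl _) e.symm = 1
    rw [submatrix_mul_equiv R Rᵀ e.symm (Equiv.refl _) e.symm, hR]
    exact submatrix_one_equiv _
  have h2 : flat R ⊆ flat R' := fun y hy => by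
    funext i
    exact congrFun (show R *ᵥ homog y = 0 from hy) (e.symm i)
  calc (P : Measure (EuclideanSpace ℝ (Fin d))).real (flat R)
      ≤ (P : Measure (EuclideanSpace ℝ (Fin d))).real (flat R') := measureReal_mono h2
    _ ≤ 1 - b (Fintype.card m) * Fintype.card m := hb' _ Fintype.card_pos R' h1
    _ ≤ _ := by
      gcongr
      exact Finset.inf'_le _ hcard

/-- The coordinates of `(y, 1)` as polynomials in `y`. -/
noncomputable def homogPoly (d : ℕ) : Fin d ⊕ Unit → MvPolynomial (Fin d) ℝ :=
  Sum.elim MvPolynomial.X fun _ => 1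

theorem eval_homogPoly (y : EuclideanSpace ℝ (Fin d)) (i : Fin d ⊕ Unit) :
    MvPolynomial.eval (fun i => y i) (homogPoly d i) = homog y i := by
  rcases i with i | i <;> simp [homogPoly, homog]

theorem totalDegree_homogPoly_le (i : Fin d ⊕ Unit) : (homogPoly d i).totalDegree ≤ 1 := by
  rcases i with i | i
  · exact (MvPolynomial.totalDegree_X i).le
  · simp [homogPoly]

/-- A sum of squares of affine forms is positive exactly off their common zero set. Through
complements, the norm therefore controls the masses that laws give to flats. -/
theorem compl_flat_mem_positivitySets {m : Type*} [Fintype m] (R : Matrix m (Fin d ⊕ Unit) ℝ)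
    {r : ℕ} (hr : 2 ≤ r) : (flat R)ᶜ ∈ positivitySets r d := by
  refine ⟨∑ i, (∑ j, MvPolynomial.C (R i j) * homogPoly d j) ^ 2, ?_, ?_⟩
  · refine MvPolynomial.totalDegree_finsetSum_le fun i _ => ?_
    refine (MvPolynomial.totalDegree_pow _ _).trans (le_trans ?_ hr)
    have : (∑ j, MvPolynomial.C (R i j) * homogPoly d j).totalDegree ≤ 1 := by
      refine MvPolynomial.totalDegree_finsetSum_le fun j _ => ?_
      refine (MvPolynomial.totalDegree_mul _ _).trans ?_
      rw [MvPolynomial.totalDegree_C, zero_add]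
      exact totalDegree_homogPoly_le j
    omega
  · ext y
    simp only [map_sum, map_pow, map_mul, MvPolynomial.eval_C, eval_homogPoly, Set.mem_ofPred_eq,
      Set.mem_compl_iff]
    have hsum : ∀ i, ∑ j, R i j * homog y j = (R *ᵥ homog y) i := fun i => rfl
    simp only [hsum]
    rw [(Finset.sum_nonneg fun i _ => sq_nonneg _).lt_iff_ne', ne_eq,
      Finset.sum_eq_zero_iff_of_nonneg fun i _ => sq_nonneg _]
    simp only [Finset.mem_univ, true_imp_iff, sq_eq_zero_iff]
    exact not_congr funext_iff

theorem measurableSet_of_mem_positivitySets {r : ℕ} {E : Set (EuclideanSpace ℝ (Fin d))}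
    (hE : E ∈ positivitySets r d) : MeasurableSet E := by
  obtain ⟨p, -, rfl⟩ := hE
  have : Continuous fun y : EuclideanSpace ℝ (Fin d) => MvPolynomial.eval (fun i => y i) p :=
    (MvPolynomial.continuous_eval p).comp (PiLp.continuous_ofLp 2 _)
  exact (isOpen_lt continuous_const this).measurableSet

theorem abs_measureReal_sub_le {r : ℕ} (P Q : ProbabilityMeasure (EuclideanSpace ℝ (Fin d)))
    {E : Set (EuclideanSpace ℝ (Fin d))} (hE : E ∈ positivitySets r d) :
    |(P : Measure (EuclideanSpace ℝ (Fin d))).real E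
      - (Q : Measure (EuclideanSpace ℝ (Fin d))).real E| ≤ ‖lawPoint r P - lawPoint r Q‖ := by
  have hm := measurableSet_of_mem_positivitySets hE
  rw [lawPoint, lawPoint, ← UniformSpace.Completion.coe_sub, UniformSpace.Completion.norm_coe,
    SignedMeasureE.norm_def]
  refine le_trans (le_of_eq ?_) (le_ciSup (SignedMeasureE.bddAbove _) ⟨E, hE⟩)
  rw [← Measure.toSignedMeasure_apply_measurable hm, ← Measure.toSignedMeasure_apply_measurable hm]
  rfl

/-- Every flat of codimension `q` is contained in some `flat R` with at least `q` orthonormal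
rows. -/
theorem exists_subset_flat (J : AffineSubspace ℝ (EuclideanSpace ℝ (Fin d)))
    (hJ : (J : Set (EuclideanSpace ℝ (Fin d))).Nonempty) :
    ∃ (n : ℕ) (R : Matrix (Fin n) (Fin d ⊕ Unit) ℝ), R * Rᵀ = 1 ∧
      (J : Set (EuclideanSpace ℝ (Fin d))) ⊆ flat R ∧ d ≤ n + Module.finrank ℝ J.direction := by
  obtain ⟨y₀, h₀⟩ := hJ
  let L : EuclideanSpace ℝ (Fin d) →ₗ[ℝ] EuclideanSpace ℝ (Fin d ⊕ Unit) :=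
    { toFun := fun v => WithLp.toLp 2 (Sum.elim (fun i => v i) fun _ => 0)
      map_add' := fun v w => by ext (i | i) <;> simp
      map_smul' := fun c v => by ext (i | i) <;> simp }
  let e : EuclideanSpace ℝ (Fin d) → EuclideanSpace ℝ (Fin d ⊕ Unit) :=
    fun y => WithLp.toLp 2 (homog y)
  -- The linear span of the points (y, 1), y ∈ J, lies in W, of dimension at most dim J + 1 in
  -- ℝ^(d+1); an orthonormal basis of its orthogonal complement supplies at least d - dim J rows.
  let W : Submodule ℝ (EuclideanSpace ℝ (Fin d ⊕ Unit)) :=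
    J.direction.map L ⊔ Submodule.span ℝ {e y₀}
  have hW : Module.finrank ℝ W ≤ Module.finrank ℝ J.direction + 1 := by
    refine (Submodule.finrank_add_le_finrank_add_finrank _ _).trans (add_le_add ?_ ?_)
    · exact Submodule.finrank_map_le _ _
    · exact (finrank_span_le_card _).trans (by simp)
  have hmem : ∀ y ∈ J, e y ∈ W := by
    intro y hy
    have : e y = L (y - y₀) + e y₀ := by
      ext (i | i) <;> simp [L, e, homog]
    rw [this]
    refine Submodule.add_mem_sup (Submodule.mem_map_of_mem ?_) (Submodule.mem_span_singleton_self _)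
    exact AffineSubspace.vsub_mem_direction hy h₀
  have hperp := Submodule.finrank_add_finrank_orthogonal W
  rw [finrank_euclideanSpace, Fintype.card_sum, Fintype.card_fin, Fintype.card_unit] at hperp
  let b := stdOrthonormalBasis ℝ Wᗮ
  refine ⟨Module.finrank ℝ Wᗮ, of fun i j => (b i : EuclideanSpace ℝ (Fin d ⊕ Unit)) j, ?_,
    fun y hy => ?_, by omega⟩
  · ext i j
    have := orthonormal_iff_ite.1 b.orthonormal i j
    rw [Submodule.coe_inner, EuclideanSpace.inner_eq_star_dotProduct] at this
    rw [one_apply, ← this, mul_apply, dotProduct]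
    exact Finset.sum_congr rfl fun l _ => mul_comm _ _
  · funext i
    have := Submodule.inner_right_of_mem_orthogonal (hmem y hy) (b i).2
    rw [EuclideanSpace.inner_eq_star_dotProduct] at this
    simp only [e, star_trivial] at this
    exact this

/-- A law close to one in `lawsV` belongs to `lawsV`. -/
theorem mem_lawsV_of_norm_sub_lt {r : ℕ} (hr : 2 ≤ r) {a b : ℝ}
    {P Q : ProbabilityMeasure (EuclideanSpace ℝ (Fin d))}
    (hb : ∀ (m : Type) [Fintype m] [DecidableEq m] [Nonempty m]
      (R : Matrix m (Fin d ⊕ Unit) ℝ), R * Rᵀ = 1 →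
      (P : Measure (EuclideanSpace ℝ (Fin d))).real (flat R) ≤ 1 - b * Fintype.card m)
    (hb0 : 0 ≤ 1 / a) (hQ : ‖lawPoint r Q - lawPoint r P‖ < b - 1 / a) : Q ∈ lawsV d a := by
  intro J hJ hq
  obtain ⟨n, R, hR, hsub, hn⟩ := exists_subset_flat J hJ
  set q := Module.finrank ℝ J.direction
  have hn0 : 0 < n := by omega
  have : Nonempty (Fin n) := ⟨⟨0, hn0⟩⟩
  have h1 := hb (Fin n) R hR
  rw [Fintype.card_fin] at h1
  have h2 := abs_measureReal_sub_le Q P (compl_flat_mem_positivitySets R hr)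
  rw [probReal_compl_eq_one_sub (isClosed_flat R).measurableSet,
    probReal_compl_eq_one_sub (isClosed_flat R).measurableSet] at h2
  have h3 := (abs_le.1 h2).1
  have h4 : (Q : Measure (EuclideanSpace ℝ (Fin d))).real J
      ≤ (Q : Measure (EuclideanSpace ℝ (Fin d))).real (flat R) := measureReal_mono hsub
  have h5 : (1 : ℝ) ≤ (d : ℝ) - q := by
    rw [le_sub_iff_add_le]
    exact_mod_cast (by omega : 1 + q ≤ d)
  have h6 : (d : ℝ) - q ≤ n := by
    rw [sub_le_iff_le_add]
    exact_mod_cast hn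
  have hba : 0 < b - 1 / a := (norm_nonneg _).trans_lt hQ
  have h7 : b * ((d : ℝ) - q) ≤ b * n := mul_le_mul_of_nonneg_left h6 (by linarith)
  -- Weakening the slope b to 1/a leaves the room (b - 1/a)(d - q), which absorbs the perturbation
  -- since d - q ≥ 1.
  have h8 : b - 1 / a ≤ (b - 1 / a) * ((d : ℝ) - q) := le_mul_of_one_le_right hba.le h5
  rw [div_eq_mul_one_div]
  nlinarith

end Flats

/-! ### Growth of the logarithmic ratio along rays. -/

section LogRatioAsymptotics

open Filter Topology

variable {ι : Type*} [Fintype ι]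

/-- The largest `κ i` with `s i ≠ 0`, or `0` if that is larger. -/
noncomputable def activeMax (s κ : ι → ℝ) : ℝ :=
  (Finset.univ : Finset (Option ι)).sup' ⟨none, Finset.mem_univ _⟩
    fun o => o.elim 0 fun i => if s i = 0 then 0 else κ i

theorem activeMax_nonneg (s κ : ι → ℝ) : 0 ≤ activeMax s κ :=
  Finset.le_sup' (fun o : Option ι => o.elim 0 fun i => if s i = 0 then 0 else κ i)
    (Finset.mem_univ none)

theorem le_activeMax {s κ : ι → ℝ} {i : ι} (hi : s i ≠ 0) : κ i ≤ activeMax s κ := by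
  have := Finset.le_sup' (fun o : Option ι => o.elim 0 fun i => if s i = 0 then 0 else κ i)
    (Finset.mem_univ (some i))
  simp only [Option.elim, if_neg hi] at this
  exact this

theorem activeMax_eq (s κ : ι → ℝ) :
    activeMax s κ = 0 ∨ ∃ i, s i ≠ 0 ∧ activeMax s κ = κ i := by
  obtain ⟨o, -, ho⟩ := Finset.exists_mem_eq_sup' (s := (Finset.univ : Finset (Option ι)))
    ⟨none, Finset.mem_univ _⟩ fun o => o.elim 0 fun i => if s i = 0 then 0 else κ i
  rw [activeMax, ho]
  rcases o with _ | i
  · exact Or.inl rfl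
  · by_cases h : s i = 0
    · simp [h]
    · exact Or.inr ⟨i, h, by simp [h]⟩

/-- With s the squares of the coordinates of Rz, the level set above t ≥ 0 is the complement of the
flat cut out by the rows with κ i > t; this is the form that the layer cake formula uses. -/
theorem lt_activeMax_iff {s κ : ι → ℝ} {t : ℝ} (ht : 0 ≤ t) :
    t < activeMax s κ ↔ ∃ i, t < κ i ∧ s i ≠ 0 := by
  constructor
  · intro h
    rcases activeMax_eq s κ with h0 | ⟨i, hi, h1⟩
    · linarith
    · exact ⟨i, h1 ▸ h, hi⟩
  · rintro ⟨i, h1, h2⟩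
    exact h1.trans_le (le_activeMax h2)

/-- Log-sum-exp grows like its largest exponent of positive weight; the constant c contributes the
exponent 0, whence the 0 in `activeMax`. -/
theorem tendsto_logRatio_div {c : ℝ} (hc : 0 < c) {s : ι → ℝ} (hs : ∀ i, 0 ≤ s i) (κ : ι → ℝ) :
    Tendsto (fun n : ℕ => logRatio c s ((n + 1 : ℝ) • κ) / (n + 1)) atTop
      (𝓝 (activeMax s κ)) := by
  have h0 := add_sum_pos hc hs
  obtain ⟨w, hw, hwle⟩ : ∃ w : ℝ, 0 < w ∧ ∀ t : ℝ,
      w * Real.exp (t * activeMax s κ) ≤ c + ∑ i, Real.exp ((t • κ) i) * s i := by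
    rcases activeMax_eq s κ with h | ⟨i, hi, h⟩
    · refine ⟨c, hc, fun t => ?_⟩
      rw [h, mul_zero, Real.exp_zero, mul_one]
      exact le_add_of_nonneg_right
        (Finset.sum_nonneg fun i _ => mul_nonneg (Real.exp_pos _).le (hs i))
    · refine ⟨s i, (hs i).lt_of_ne' hi, fun t => ?_⟩
      rw [h, mul_comm]
      refine le_trans ?_ (le_add_of_nonneg_left hc.le)
      exact Finset.single_le_sum (f := fun i => Real.exp ((t • κ) i) * s i)
        (fun i _ => mul_nonneg (Real.exp_pos _).le (hs i)) (Finset.mem_univ i)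
  have hlow : ∀ n : ℕ, activeMax s κ + Real.log (w / (c + ∑ i, s i)) / (n + 1)
      ≤ logRatio c s ((n + 1 : ℝ) • κ) / (n + 1) := fun n => by
    have hn : (0 : ℝ) < n + 1 := by positivity
    rw [le_div_iff₀ hn, add_mul, div_mul_cancel₀ _ hn.ne', logRatio,
      Real.le_log_iff_exp_le (div_pos (add_sum_exp_mul_pos hc hs _) h0), Real.exp_add,
      Real.exp_log (div_pos hw h0), mul_div_assoc', div_le_div_iff_of_pos_right h0]
    have := hwle (n + 1)
    rwa [mul_comm, mul_comm (activeMax s κ)]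
  have hup : ∀ n : ℕ, logRatio c s ((n + 1 : ℝ) • κ) / (n + 1) ≤ activeMax s κ := fun n => by
    have hn : (0 : ℝ) < n + 1 := by positivity
    rw [div_le_iff₀ hn, logRatio,
      Real.log_le_iff_le_exp (div_pos (add_sum_exp_mul_pos hc hs _) h0), div_le_iff₀ h0, mul_add,
      Finset.mul_sum]
    refine add_le_add ?_ (Finset.sum_le_sum fun i _ => ?_)
    · exact le_mul_of_one_le_left hc.le
        (Real.one_le_exp (mul_nonneg (activeMax_nonneg s κ) hn.le))
    · by_cases hi : s i = 0
      · simp [hi]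
      · refine mul_le_mul_of_nonneg_right (Real.exp_le_exp.2 ?_) (hs i)
        rw [Pi.smul_apply, smul_eq_mul, mul_comm]
        exact mul_le_mul_of_nonneg_right (le_activeMax hi) hn.le
  refine tendsto_of_tendsto_of_tendsto_of_le_of_le ?_ tendsto_const_nhds hlow hup
  have h1 : Tendsto (fun n : ℕ => Real.log (w / (c + ∑ i, s i)) / ((n : ℝ) + 1)) atTop (𝓝 0) :=
    tendsto_const_nhds.div_atTop
      (tendsto_atTop_add_const_right _ _ tendsto_natCast_atTop_atTop)
  simpa using h1.const_add (activeMax s κ)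

end LogRatioAsymptotics

/-! ### Coercivity of the objective in polar coordinates. -/

section Coercivity

open Matrix Filter Topology

variable {ι : Type} [Fintype ι] {Ω : Type*} [MeasurableSpace Ω]

/-- The objective `-log det C + a ∫ log ((c + z' C z) / (c + z' z)) dP` at
`C = R' diag(exp κ) R` with `R` orthogonal. -/
noncomputable def polarObjective (a c : ℝ) (P : Measure Ω) (z : Ω → ι → ℝ)
    (R : ι → ι → ℝ) (κ : ι → ℝ) : ℝ :=
  -∑ i, κ i + a * ∫ y, logRatio c (fun i => (of R *ᵥ z y) i ^ 2) κ ∂P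

theorem measurable_mulVec_apply {m : Type*} {z : Ω → ι → ℝ} (hz : Measurable z) (R : Matrix m ι ℝ)
    (i : m) : Measurable fun y => (R *ᵥ z y) i :=
  ((continuous_apply i).comp (continuous_const.matrix_mulVec continuous_id)).measurable.comp hz

theorem measurable_logRatio_mulVec {z : Ω → ι → ℝ} (hz : Measurable z) (c : ℝ)
    (R : ι → ι → ℝ) (κ : ι → ℝ) :
    Measurable fun y => logRatio c (fun i => (of R *ᵥ z y) i ^ 2) κ := by
  have h := fun i => (measurable_mulVec_apply hz (of R) i).pow_const 2
  exact ((measurable_const.add (Finset.measurable_fun_sum _ fun i _ => (h i).const_mul _)).div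
    (measurable_const.add (Finset.measurable_fun_sum _ fun i _ => h i))).log

theorem abs_logRatio_sq_le {c : ℝ} (hc : 0 < c) (v κ : ι → ℝ) :
    |logRatio c (fun i => v i ^ 2) κ| ≤ ∑ i, |κ i| :=
  abs_logRatio_le hc (fun _ => sq_nonneg _) (Finset.sum_nonneg fun _ _ => abs_nonneg _)
    fun i => Finset.single_le_sum (f := fun i => |κ i|) (fun _ _ => abs_nonneg _)
      (Finset.mem_univ i)

theorem integrable_logRatio_mulVec (P : Measure Ω) [IsFiniteMeasure P] {z : Ω → ι → ℝ}
    (hz : Measurable z) {c : ℝ} (hc : 0 < c) (R : ι → ι → ℝ) (κ : ι → ℝ) :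
    Integrable (fun y => logRatio c (fun i => (of R *ᵥ z y) i ^ 2) κ) P :=
  Integrable.of_bound (measurable_logRatio_mulVec hz c R κ).aestronglyMeasurable _
    (ae_of_all _ fun _ => abs_logRatio_sq_le hc _ κ)

theorem continuous_polarObjective (a : ℝ) {c : ℝ} (hc : 0 < c) (P : Measure Ω)
    [IsFiniteMeasure P] {z : Ω → ι → ℝ} (hz : Measurable z) :
    Continuous fun x : (ι → ι → ℝ) × (ι → ℝ) => polarObjective a c P z x.1 x.2 := by
  have hκ : Continuous fun x : (ι → ι → ℝ) × (ι → ℝ) => ∑ i, |x.2 i| :=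
    continuous_finsetSum _ fun i _ => ((continuous_apply i).comp continuous_snd).abs
  refine Continuous.add (Continuous.neg ?_) (continuous_const.mul ?_)
  · exact continuous_finsetSum _ fun i _ => (continuous_apply i).comp continuous_snd
  · refine continuous_iff_continuousAt.2 fun x₀ => ?_
    refine continuousAt_of_dominated (bound := fun _ => ∑ i, |x₀.2 i| + 1)
      (Eventually.of_forall fun x => (measurable_logRatio_mulVec hz c _ _).aestronglyMeasurable) ?_
      (integrable_const _) (ae_of_all _ fun y => ?_)
    · filter_upwards [hκ.continuousAt.eventually_lt_const (lt_add_one _)] with x hx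
      exact ae_of_all _ fun y => (abs_logRatio_sq_le hc _ _).trans hx.le
    · have hs : ∀ i, Continuous fun x : (ι → ι → ℝ) × (ι → ℝ) => (of x.1 *ᵥ z y) i ^ 2 :=
        fun i => Continuous.pow (continuous_finsetSum _ fun j _ =>
          ((continuous_apply_apply i j).comp continuous_fst).mul continuous_const) 2
      have h0 : ∀ x : (ι → ι → ℝ) × (ι → ℝ), 0 < c + ∑ i, (of x.1 *ᵥ z y) i ^ 2 :=
        fun x => add_sum_pos hc fun i => sq_nonneg _
      have h1 := fun x : (ι → ι → ℝ) × (ι → ℝ) => add_sum_exp_mul_pos hc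
        (s := fun i => (of x.1 *ᵥ z y) i ^ 2) (fun i => sq_nonneg _) x.2
      refine Continuous.continuousAt (Continuous.log (Continuous.div ?_ ?_ fun x => (h0 x).ne')
        fun x => (div_pos (h1 x) (h0 x)).ne')
      · exact continuous_const.add (continuous_finsetSum _ fun i _ =>
          (Real.continuous_exp.comp ((continuous_apply i).comp continuous_snd)).mul (hs i))
      · exact continuous_const.add (continuous_finsetSum _ fun i _ => hs i)

/-- Since the objective vanishes at κ = 0, this is convexity along rays from the origin; it makes
positivity at one radius persist at all larger radii. -/
theorem polarObjective_smul_le {a c : ℝ} (ha : 0 ≤ a) (hc : 0 < c) (P : Measure Ω)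
    [IsFiniteMeasure P] {z : Ω → ι → ℝ} (hz : Measurable z) (R : ι → ι → ℝ) (κ : ι → ℝ) {t : ℝ}
    (ht0 : 0 < t) (ht1 : t ≤ 1) :
    polarObjective a c P z R (t • κ) ≤ t * polarObjective a c P z R κ := by
  have h := integral_mono (integrable_logRatio_mulVec P hz hc R (t • κ))
    ((integrable_logRatio_mulVec P hz hc R κ).const_mul t)
    fun y => logRatio_smul_le hc (fun i => sq_nonneg ((of R *ᵥ z y) i)) κ ht0 ht1
  rw [integral_const_mul] at h
  have h1 : ∑ i, (t • κ) i = t * ∑ i, κ i := by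
    rw [Finset.mul_sum]; rfl
  rw [polarObjective, polarObjective, h1]
  nlinarith [mul_le_mul_of_nonneg_left h ha]

variable [DecidableEq ι]

/-- By the layer cake formula the integral is ∫ P(activeMax > t) dt over t > 0. The event is the
complement of a flat with #{i : κ i > t} rows, so its mass is at least b times that number, and
integrating the number over t gives ∑ max(κ i, 0). -/
theorem mul_sum_max_le_integral_activeMax {P : Measure Ω} [IsProbabilityMeasure P]
    {z : Ω → ι → ℝ} (hz : Measurable z) {b : ℝ} (hb0 : 0 ≤ b)
    (hb : ∀ (m : Type) [Fintype m] [DecidableEq m] [Nonempty m] (R : Matrix m ι ℝ),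
      R * Rᵀ = 1 → P.real {y | R *ᵥ z y = 0} ≤ 1 - b * Fintype.card m)
    {R : Matrix ι ι ℝ} (hR : R * Rᵀ = 1) {κ : ι → ℝ}
    (hint : Integrable (fun y => activeMax (fun i => (R *ᵥ z y) i ^ 2) κ) P) :
    b * ∑ i, max (κ i) 0 ≤ ∫ y, activeMax (fun i => (R *ᵥ z y) i ^ 2) κ ∂P := by
  set M : Ω → ℝ := fun y => activeMax (fun i => (R *ᵥ z y) i ^ 2) κ with hM
  have hM0 : ∀ y, 0 ≤ M y := fun y => activeMax_nonneg _ _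
  rw [← ENNReal.ofReal_le_ofReal_iff (integral_nonneg hM0),
    ofReal_integral_eq_lintegral_ofReal hint (ae_of_all _ hM0),
    lintegral_eq_lintegral_meas_lt P (ae_of_all _ hM0) hint.aemeasurable]
  have hlhs : ENNReal.ofReal (b * ∑ i, max (κ i) 0)
      = ∫⁻ t in Set.Ioi (0 : ℝ), ∑ i, (Set.Iio (κ i)).indicator (fun _ => ENNReal.ofReal b) t := by
    rw [lintegral_finsetSum _ fun i _ => measurable_const.indicator measurableSet_Iio,
      ENNReal.ofReal_mul hb0, ENNReal.ofReal_sum_of_nonneg fun i _ => le_max_right _ _,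
      Finset.mul_sum]
    refine Finset.sum_congr rfl fun i _ => ?_
    rw [lintegral_indicator_const measurableSet_Iio, Measure.restrict_apply measurableSet_Iio,
      Set.Iio_inter_Ioi, Real.volume_Ioo, sub_zero]
    congr 1
    rcases le_total (κ i) 0 with h | h
    · rw [max_eq_right h, ENNReal.ofReal_zero, ENNReal.ofReal_of_nonpos h]
    · rw [max_eq_left h]
  rw [hlhs]
  refine setLIntegral_mono' measurableSet_Ioi fun t ht => ?_
  have ht0 : (0 : ℝ) ≤ t := le_of_lt ht
  set p : ι → Prop := fun i => t < κ i with hp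
  have hsum : ∑ i, (Set.Iio (κ i)).indicator (fun _ => ENNReal.ofReal b) t
      = ENNReal.ofReal (b * Fintype.card {i // p i}) := by
    simp only [Set.indicator_apply, Set.mem_Iio]
    rw [Finset.sum_ite, Finset.sum_const_zero, add_zero, Finset.sum_const, nsmul_eq_mul,
      Fintype.card_subtype, mul_comm b, ENNReal.ofReal_mul (Nat.cast_nonneg _),
      ENNReal.ofReal_natCast]
  rw [hsum]
  rcases isEmpty_or_nonempty {i // p i} with hempty | hnonempty
  · simp
  set R' : Matrix {i // p i} ι ℝ := R.submatrix Subtype.val id with hR'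
  have hRR : R' * R'ᵀ = 1 := by
    rw [hR', transpose_submatrix]
    change R.submatrix Subtype.val (Equiv.refl _) * Rᵀ.submatrix (Equiv.refl _) Subtype.val = 1
    rw [submatrix_mul_equiv, hR]
    exact submatrix_one _ Subtype.val_injective
  have hmeas : MeasurableSet {y | R' *ᵥ z y = 0} := by
    have : {y | R' *ᵥ z y = 0} = ⋂ i, {y | (R' *ᵥ z y) i = 0} := by
      ext y; simp [funext_iff]
    rw [this]
    exact MeasurableSet.iInter fun i =>
      measurableSet_eq_fun (measurable_mulVec_apply hz R' i) measurable_const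
  have hset : {y | t < M y} = {y | R' *ᵥ z y = 0}ᶜ := by
    ext y
    rw [Set.mem_compl_iff, Set.mem_ofPred_eq, Set.mem_ofPred_eq, hM, lt_activeMax_iff ht0,
      funext_iff, not_forall]
    constructor
    · rintro ⟨i, hi, h⟩
      exact ⟨⟨i, hi⟩, fun h0 => h (by rw [sq_eq_zero_iff]; exact h0)⟩
    · rintro ⟨⟨i, hi⟩, h⟩
      exact ⟨i, hi, pow_ne_zero 2 h⟩
  have h1 := hb {i // p i} R' hRR
  have h2 := probReal_compl_eq_one_sub (μ := P) hmeas
  rw [hset, ENNReal.ofReal_le_iff_le_toReal (measure_ne_top _ _)]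
  change _ ≤ P.real _
  linarith

/-- The slope at infinity is at least ∑ (-κ i + a b max(κ i, 0)). As a b > 1, every term with κ i ≠
0 is positive. -/
theorem exists_polarObjective_pos {a c b : ℝ} (ha : 0 < a) (hc : 0 < c) {P : Measure Ω}
    [IsProbabilityMeasure P] {z : Ω → ι → ℝ} (hz : Measurable z) (hab : 1 / a < b)
    (hb : ∀ (m : Type) [Fintype m] [DecidableEq m] [Nonempty m] (R : Matrix m ι ℝ),
      R * Rᵀ = 1 → P.real {y | R *ᵥ z y = 0} ≤ 1 - b * Fintype.card m)
    {R : ι → ι → ℝ} (hR : of R * (of R)ᵀ = 1) {κ : ι → ℝ} (hκ : κ ≠ 0) :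
    ∃ n : ℕ, 0 < polarObjective a c P z R ((n + 1 : ℝ) • κ) := by
  set g : ℕ → Ω → ℝ := fun n y =>
    logRatio c (fun i => (of R *ᵥ z y) i ^ 2) ((n + 1 : ℝ) • κ) / (n + 1) with hg
  set M : Ω → ℝ := fun y => activeMax (fun i => (of R *ᵥ z y) i ^ 2) κ with hM
  have hlim : ∀ y, Tendsto (fun n => g n y) atTop (𝓝 (M y)) := fun y =>
    tendsto_logRatio_div hc (fun i => sq_nonneg _) κ
  have hgm : ∀ n, Measurable (g n) := fun n => (measurable_logRatio_mulVec hz c R _).div_const _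
  have hMm : Measurable M := measurable_of_tendsto_metrizable hgm (tendsto_pi_nhds.2 hlim)
  have hgb : ∀ n y, ‖g n y‖ ≤ ∑ i, |κ i| := fun n y => by
    have hn : (0 : ℝ) < n + 1 := by positivity
    rw [hg, norm_div, Real.norm_of_nonneg hn.le, div_le_iff₀ hn]
    refine (abs_logRatio_sq_le hc _ _).trans (le_of_eq ?_)
    rw [Finset.sum_mul]
    refine Finset.sum_congr rfl fun i _ => ?_
    rw [Pi.smul_apply, smul_eq_mul, abs_mul, abs_of_pos hn, mul_comm]
  have hMint : Integrable M P := Integrable.of_bound hMm.aestronglyMeasurable (∑ i, |κ i|)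
    (ae_of_all _ fun y => le_of_tendsto (hlim y).norm (Eventually.of_forall fun n => hgb n y))
  have htend := tendsto_integral_of_dominated_convergence (fun _ => ∑ i, |κ i|)
    (fun n => (hgm n).aestronglyMeasurable) (integrable_const _)
    (fun n => ae_of_all P (hgb n)) (ae_of_all _ hlim)
  have hb0 : 0 < b := (div_pos one_pos ha).trans hab
  have hslope := mul_sum_max_le_integral_activeMax hz hb0.le hb hR hMint
  have hab1 : 1 < a * b := by rwa [div_lt_iff₀' ha] at hab
  have hpos : 0 < -∑ i, κ i + a * ∫ y, M y ∂P := by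
    have h1 : 0 < ∑ i, (-κ i + a * b * max (κ i) 0) := by
      obtain ⟨i₀, hi₀⟩ : ∃ i, κ i ≠ 0 := Function.ne_iff.1 hκ
      refine Finset.sum_pos' (fun i _ => ?_) ⟨i₀, Finset.mem_univ _, ?_⟩
      · rcases le_total (κ i) 0 with h | h
        · rw [max_eq_right h]; linarith
        · rw [max_eq_left h]; nlinarith
      · rcases lt_or_gt_of_ne hi₀ with h | h
        · rw [max_eq_right h.le]; linarith
        · rw [max_eq_left h.le]; nlinarith
    rw [Finset.sum_add_distrib, Finset.sum_neg_distrib, ← Finset.mul_sum] at h1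
    have h2 := mul_le_mul_of_nonneg_left hslope ha.le
    rw [← mul_assoc] at h2
    linarith
  have htend' := (htend.const_mul a).const_add (-∑ i, κ i)
  obtain ⟨n, hn⟩ := (htend'.eventually_const_lt hpos).exists
  refine ⟨n, ?_⟩
  have hn1 : (0 : ℝ) < n + 1 := by positivity
  have heq : polarObjective a c P z R ((n + 1 : ℝ) • κ)
      = (n + 1) * (-∑ i, κ i + a * ∫ y, g n y ∂P) := by
    rw [polarObjective, hg, integral_div]
    have : ∑ i, ((n + 1 : ℝ) • κ) i = (n + 1) * ∑ i, κ i := by rw [Finset.mul_sum]; rfl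
    rw [this]
    field_simp
  rw [heq]
  exact mul_pos hn1 hn

theorem exists_polarObjective_minimizer {a c b : ℝ} (ha : 0 < a) (hc : 0 < c) {P : Measure Ω}
    [IsProbabilityMeasure P] {z : Ω → ι → ℝ} (hz : Measurable z) (hab : 1 / a < b)
    (hb : ∀ (m : Type) [Fintype m] [DecidableEq m] [Nonempty m] (R : Matrix m ι ℝ),
      R * Rᵀ = 1 → P.real {y | R *ᵥ z y = 0} ≤ 1 - b * Fintype.card m) :
    ∃ (R : ι → ι → ℝ) (κ : ι → ℝ), of R * (of R)ᵀ = 1 ∧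
      ∀ (R' : ι → ι → ℝ) (κ' : ι → ℝ), of R' * (of R')ᵀ = 1 →
        polarObjective a c P z R κ ≤ polarObjective a c P z R' κ' := by
  set O : Set (ι → ι → ℝ) := {R | of R * (of R)ᵀ = 1} with hO
  have hOc : IsCompact O := isCompact_setOf_mul_transpose_eq_one ι ι
  have hcont := continuous_polarObjective a hc P hz
  -- Compactness of frames and unit directions gives one radius n + 1 at which the objective is
  -- positive in all directions. By convexity along rays it is positive beyond, and it is 0 at κ =
  -- 0, so the minimum over the ball is global.
  obtain ⟨n, hn⟩ := (hOc.prod (isCompact_sphere (0 : ι → ℝ) 1)).elim_directed_cover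
    (fun n : ℕ => {x | 0 < polarObjective a c P z x.1 ((n + 1 : ℝ) • x.2)})
    (fun n => isOpen_lt continuous_const (hcont.comp (continuous_fst.prodMk
      ((continuous_const_smul (n + 1 : ℝ)).comp continuous_snd))))
    (fun x hx => Set.mem_iUnion.2 <| exists_polarObjective_pos ha hc hz hab hb hx.1
      fun h => by simpa [h] using hx.2)
    (directed_of_isDirected_le fun n k hnk x hx => by
      have hn1 : (0 : ℝ) < n + 1 := by positivity
      have hk1 : (0 : ℝ) < k + 1 := by positivity
      have hnk' : (n : ℝ) + 1 ≤ k + 1 := by exact_mod_cast Nat.succ_le_succ hnk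
      have := polarObjective_smul_le ha.le hc P hz x.1 ((k + 1 : ℝ) • x.2) (div_pos hn1 hk1)
        ((div_le_one hk1).2 hnk')
      rw [smul_smul, div_mul_cancel₀ _ hk1.ne'] at this
      exact pos_of_mul_pos_right ((show 0 < polarObjective a c P z x.1 ((n + 1 : ℝ) • x.2)
        from hx).trans_le this) (div_pos hn1 hk1).le)
  have hzero : ∀ R, polarObjective a c P z R 0 = 0 := fun R => by
    simp [polarObjective, logRatio, div_self (add_sum_pos hc fun i => sq_nonneg _).ne']
  have h1 : (1 : Matrix ι ι ℝ) ∈ O := by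
    change (1 : Matrix ι ι ℝ) * (1 : Matrix ι ι ℝ)ᵀ = 1
    simp
  obtain ⟨⟨R, κ⟩, hx, hmin⟩ := (hOc.prod
    (isCompact_closedBall (0 : ι → ℝ) (n + 1))).exists_isMinOn
    ⟨((1 : Matrix ι ι ℝ), 0), h1, by simp; positivity⟩ hcont.continuousOn
  refine ⟨R, κ, hx.1, fun R' κ' hR' => ?_⟩
  by_cases hκ' : κ' ∈ Metric.closedBall (0 : ι → ℝ) (n + 1)
  · exact hmin (show (R', κ') ∈ O ×ˢ Metric.closedBall (0 : ι → ℝ) (n + 1) from ⟨hR', hκ'⟩)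
  · have hle : polarObjective a c P z R κ ≤ 0 := by
      rw [← hzero (1 : Matrix ι ι ℝ)]
      exact hmin (show ((1 : Matrix ι ι ℝ), (0 : ι → ℝ)) ∈
        O ×ˢ Metric.closedBall (0 : ι → ℝ) (n + 1) from ⟨h1, by simp; positivity⟩)
    refine hle.trans (le_of_lt ?_)
    have hn1 : (0 : ℝ) < n + 1 := by positivity
    rw [mem_closedBall_zero_iff, not_le] at hκ'
    have hκ0 : 0 < ‖κ'‖ := hn1.trans hκ'
    have hmem : (R', ‖κ'‖⁻¹ • κ') ∈ O ×ˢ Metric.sphere (0 : ι → ℝ) 1 := by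
      refine ⟨hR', ?_⟩
      rw [mem_sphere_zero_iff_norm, norm_smul, norm_inv, norm_norm, inv_mul_cancel₀ hκ0.ne']
    have h2 : 0 < polarObjective a c P z R' ((n + 1 : ℝ) • ‖κ'‖⁻¹ • κ') := hn hmem
    have h3 := polarObjective_smul_le ha.le hc P hz R' κ' (div_pos hn1 hκ0)
      ((div_le_one hκ0).2 hκ'.le)
    rw [smul_smul, ← div_eq_mul_inv] at h2
    exact pos_of_mul_pos_right (h2.trans_le h3) (div_pos hn1 hκ0).le

end Coercivity

/-! ### Minimizers are critical points; existence of a critical shape. -/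

section Existence

open Matrix Filter Topology

variable {ι : Type} [Fintype ι] [DecidableEq ι] {Ω : Type*} [MeasurableSpace Ω]

/-- Cauchy–Schwarz for a positive definite matrix and its inverse. -/
theorem Matrix.PosDef.dotProduct_sq_le {C : Matrix ι ι ℝ} (hC : C.PosDef) (h v : ι → ℝ) :
    (h ⬝ᵥ v) ^ 2 ≤ (h ⬝ᵥ C⁻¹ *ᵥ h) * (v ⬝ᵥ C *ᵥ v) := by
  have hd : IsUnit C.det := hC.det_pos.ne'.isUnit
  have hsymm : ∀ x y : ι → ℝ, x ⬝ᵥ C *ᵥ y = y ⬝ᵥ C *ᵥ x := fun x y => by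
    have := hC.isHermitian
    rw [IsHermitian, conjTranspose_eq_transpose_of_trivial] at this
    rw [dotProduct_mulVec, dotProduct_comm, ← mulVec_transpose, this]
  set w := C⁻¹ *ᵥ h with hw
  have hCw : C *ᵥ w = h := by rw [hw, mulVec_mulVec, mul_nonsing_inv _ hd, one_mulVec]
  have h1 : h ⬝ᵥ v = v ⬝ᵥ C *ᵥ w := by rw [hCw, dotProduct_comm]
  have h2 : h ⬝ᵥ w = w ⬝ᵥ C *ᵥ w := by rw [hCw, dotProduct_comm]
  rw [h1, h2]
  have hquad : ∀ t : ℝ, 0 ≤ (w ⬝ᵥ C *ᵥ w) * (t * t) + 2 * (v ⬝ᵥ C *ᵥ w) * t + v ⬝ᵥ C *ᵥ v := by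
    intro t
    have := hC.quadratic_nonneg (t • w + v)
    rw [mulVec_add, mulVec_smul, dotProduct_add, add_dotProduct, add_dotProduct, smul_dotProduct,
      smul_dotProduct, dotProduct_smul, dotProduct_smul, hsymm w v] at this
    simp only [smul_eq_mul] at this
    linarith
  have := discrim_le_zero hquad
  rw [discrim] at this
  linarith

/-- Rank-one perturbations in both directions ±hh' are the only variations needed to derive the
critical equation; Cauchy–Schwarz bounds the size allowed. -/
theorem Matrix.PosDef.add_smul_vecMulVec {C : Matrix ι ι ℝ} (hC : C.PosDef) (h : ι → ℝ) {s : ℝ}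
    (hs : |s| * (h ⬝ᵥ C⁻¹ *ᵥ h) < 1) : (C + s • vecMulVec h h).PosDef := by
  refine posDef_iff_dotProduct_mulVec.2 ⟨?_, fun v hv => ?_⟩
  · refine hC.isHermitian.add ?_
    rw [IsHermitian, conjTranspose_eq_transpose_of_trivial, transpose_smul, transpose_vecMulVec]
  · have h1 := (posDef_iff_dotProduct_mulVec.1 hC).2 hv
    rw [star_trivial] at h1 ⊢
    have h2 := hC.dotProduct_sq_le h v
    have h3 : v ⬝ᵥ (C + s • vecMulVec h h) *ᵥ v = v ⬝ᵥ C *ᵥ v + s * (h ⬝ᵥ v) ^ 2 := by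
      rw [add_mulVec, smul_mulVec, vecMulVec_mulVec, dotProduct_add, dotProduct_smul,
        dotProduct_smul, dotProduct_comm v h]
      simp only [smul_eq_mul, MulOpposite.smul_eq_mul_unop, MulOpposite.unop_op]
      ring
    rw [h3]
    have h4 : -(|s| * (h ⬝ᵥ v) ^ 2) ≤ s * (h ⬝ᵥ v) ^ 2 := by
      rw [← neg_mul]
      exact mul_le_mul_of_nonneg_right (neg_abs_le s) (sq_nonneg _)
    have h5 : |s| * (h ⬝ᵥ v) ^ 2 ≤ |s| * (h ⬝ᵥ C⁻¹ *ᵥ h) * (v ⬝ᵥ C *ᵥ v) := by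
      rw [mul_assoc]
      exact mul_le_mul_of_nonneg_left h2 (abs_nonneg s)
    nlinarith

theorem Matrix.PosDef.det_add_smul_vecMulVec {C : Matrix ι ι ℝ} (hC : C.PosDef) (h : ι → ℝ)
    (s : ℝ) : (C + s • vecMulVec h h).det = C.det * (1 + s * (h ⬝ᵥ C⁻¹ *ᵥ h)) := by
  rw [← smul_vecMulVec, vecMulVec_eq Unit,
    det_add_replicateCol_mul_replicateRow (ι := Unit) hC.det_pos.ne'.isUnit]
  congr 1
  rw [det_unique, add_apply, one_apply_eq, Matrix.mul_assoc, ← replicateCol_mulVec, mulVec_smul,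
    replicateRow_mul_replicateCol_apply, dotProduct_smul, smul_eq_mul]

/-- A minimizer of the objective is a critical point. -/
theorem isCriticalShape_of_forall_le {a c : ℝ} (ha : 0 < a) (hc : 0 < c) {P : Measure Ω}
    [IsProbabilityMeasure P] {z : Ω → ι → ℝ} (hz : Measurable z) {C : Matrix ι ι ℝ}
    (hC : C.PosDef)
    (hmin : ∀ C' : Matrix ι ι ℝ, C'.PosDef → Real.log C'.det - Real.log C.det
      ≤ a * ∫ y, Real.log ((c + z y ⬝ᵥ C' *ᵥ z y) / (c + z y ⬝ᵥ C *ᵥ z y)) ∂P) :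
    IsCriticalShape a c P z C := by
  intro h
  set q := h ⬝ᵥ C⁻¹ *ᵥ h with hq
  have hq0 : 0 ≤ q := hC.inv.quadratic_nonneg h
  have hu : ∀ y, 0 < c + z y ⬝ᵥ C *ᵥ z y := fun y =>
    add_pos_of_pos_of_nonneg hc (hC.quadratic_nonneg _)
  set w : Ω → ℝ := fun y => (h ⬝ᵥ z y) ^ 2 / (c + z y ⬝ᵥ C *ᵥ z y) with hw
  have hw0 : ∀ y, 0 ≤ w y := fun y => div_nonneg (sq_nonneg _) (hu y).le
  have hwq : ∀ y, w y ≤ q := fun y => by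
    rw [hw, div_le_iff₀ (hu y)]
    refine (hC.dotProduct_sq_le h (z y)).trans (mul_le_mul_of_nonneg_left ?_ hq0)
    linarith
  have hwm : Measurable w := by
    have h1 : Measurable fun y => h ⬝ᵥ z y :=
      (continuous_const.dotProduct continuous_id).measurable.comp hz
    exact (h1.pow_const 2).div (measurable_const.add (measurable_dotProduct_mulVec hz _))
  have hwint : Integrable w P := Integrable.of_bound hwm.aestronglyMeasurable q
    (ae_of_all _ fun y => by rw [Real.norm_of_nonneg (hw0 y)]; exact hwq y)
  -- Bounding log(1 + sq) from below by sq/(1 + sq) and the integrand from above by log x ≤ x - 1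
  -- avoids differentiating under the integral. Division by s and the limits s → 0 from both sides
  -- then give the equality.
  have key : ∀ s : ℝ, |s| * q < 1 → s * q / (1 + s * q) ≤ s * (a * ∫ y, w y ∂P) := by
    intro s hs
    have hsq : 0 < 1 + s * q := by
      have : -(|s| * q) ≤ s * q := by
        rw [← neg_mul]
        exact mul_le_mul_of_nonneg_right (neg_abs_le s) hq0
      linarith
    have hC' := hC.add_smul_vecMulVec h hs
    have h1 := hmin _ hC'
    rw [hC.det_add_smul_vecMulVec, Real.log_mul hC.det_pos.ne' hsq.ne', add_sub_cancel_left] at h1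
    have h2 : s * q / (1 + s * q) ≤ Real.log (1 + s * q) := by
      have := Real.one_sub_inv_le_log_of_pos hsq
      refine le_trans (le_of_eq ?_) this
      field_simp
      ring
    refine h2.trans (h1.trans ?_)
    rw [mul_left_comm, ← integral_const_mul s]
    refine mul_le_mul_of_nonneg_left (integral_mono
      (integrable_log_quadratic_ratio P hz hc hC hC') (hwint.const_mul s) fun y => ?_) ha.le
    have h3 : 0 < c + z y ⬝ᵥ (C + s • vecMulVec h h) *ᵥ z y :=
      add_pos_of_pos_of_nonneg hc (hC'.quadratic_nonneg _)
    refine (Real.log_le_sub_one_of_pos (div_pos h3 (hu y))).trans (le_of_eq ?_)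
    have h4 : z y ⬝ᵥ (C + s • vecMulVec h h) *ᵥ z y
        = z y ⬝ᵥ C *ᵥ z y + s * (h ⬝ᵥ z y) ^ 2 := by
      rw [add_mulVec, smul_mulVec, vecMulVec_mulVec, dotProduct_add, dotProduct_smul,
        dotProduct_smul, dotProduct_comm (z y) h]
      simp only [smul_eq_mul, MulOpposite.smul_eq_mul_unop, MulOpposite.unop_op]
      ring
    have h5 := (hu y).ne'
    rw [h4, hw]
    field_simp
    ring
  have hsmall : ∀ᶠ s : ℝ in 𝓝 0, |s| * q < 1 := by
    have : Continuous fun s : ℝ => |s| * q := continuous_abs.mul continuous_const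
    exact this.continuousAt.eventually_lt_const (by simp)
  have hlim : Tendsto (fun s : ℝ => q / (1 + s * q)) (𝓝 0) (𝓝 q) := by
    have : ContinuousAt (fun s : ℝ => q / (1 + s * q)) 0 :=
      continuousAt_const.div (by fun_prop) (by simp)
    simpa [ContinuousAt] using this
  refine le_antisymm ?_ ?_
  · refine ge_of_tendsto (hlim.mono_left (nhdsWithin_le_nhds (s := Set.Iio 0))) ?_
    filter_upwards [nhdsWithin_le_nhds hsmall, self_mem_nhdsWithin] with s hs hs0
    have := key s hs
    rw [mul_div_assoc] at this
    exact (mul_le_mul_left_of_neg hs0).1 this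
  · refine le_of_tendsto (hlim.mono_left (nhdsWithin_le_nhds (s := Set.Ioi 0))) ?_
    filter_upwards [nhdsWithin_le_nhds hsmall, self_mem_nhdsWithin] with s hs hs0
    have := key s hs
    rw [mul_div_assoc] at this
    exact le_of_mul_le_mul_left this hs0

theorem log_det_transpose_diagonal_mul {R : Matrix ι ι ℝ} (hR : R * Rᵀ = 1) (κ : ι → ℝ) :
    Real.log (Rᵀ * diagonal (fun i => Real.exp (κ i)) * R).det = ∑ i, κ i := by
  have h1 : R.det * R.det = 1 := by
    have := congrArg det hR
    rwa [det_mul, det_transpose, det_one] at this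
  rw [det_mul, det_mul, det_transpose, det_diagonal, mul_right_comm, h1, one_mul, ← Real.exp_sum,
    Real.log_exp]

theorem exists_isCriticalShape {a c b : ℝ} (ha : 0 < a) (hc : 0 < c) {P : Measure Ω}
    [IsProbabilityMeasure P] {z : Ω → ι → ℝ} (hz : Measurable z) (hab : 1 / a < b)
    (hb : ∀ (m : Type) [Fintype m] [DecidableEq m] [Nonempty m] (R : Matrix m ι ℝ),
      R * Rᵀ = 1 → P.real {y | R *ᵥ z y = 0} ≤ 1 - b * Fintype.card m) :
    ∃ C : Matrix ι ι ℝ, C.PosDef ∧ IsCriticalShape a c P z C := by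
  obtain ⟨R, κ, hR, hmin⟩ := exists_polarObjective_minimizer ha hc hz hab hb
  have hC : ((of R)ᵀ * diagonal (fun i => Real.exp (κ i)) * of R).PosDef :=
    posDef_transpose_diagonal_mul (IsUnit.of_mul_eq_one _ hR) fun i => Real.exp_pos _
  refine ⟨_, hC, isCriticalShape_of_forall_le ha hc hz hC fun C' hC' => ?_⟩
  obtain ⟨R', κ', hR', -, rfl⟩ := hC'.exists_orthogonal_exp
  have hle := hmin R' κ' hR'
  -- Orthogonality of R makes the identity matrix a common reference point for all polar
  -- coordinates; it cancels when two objectives are subtracted.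
  have hlog : ∀ (R : Matrix ι ι ℝ) (κ : ι → ℝ), R * Rᵀ = 1 → ∀ y,
      Real.log ((c + z y ⬝ᵥ (Rᵀ * diagonal (fun i => Real.exp (κ i)) * R) *ᵥ z y)
        / (c + z y ⬝ᵥ (1 : Matrix ι ι ℝ) *ᵥ z y)) = logRatio c (fun i => (R *ᵥ z y) i ^ 2) κ := by
    intro R κ hR y
    rw [← mul_eq_one_comm.1 hR, dotProduct_transpose_diagonal_mulVec,
      dotProduct_transpose_mul_self_mulVec]
    rfl
  have hpos : ∀ {C : Matrix ι ι ℝ}, C.PosDef → ∀ y, c + z y ⬝ᵥ C *ᵥ z y ≠ 0 := fun hC y =>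
    (add_pos_of_pos_of_nonneg hc (hC.quadratic_nonneg _)).ne'
  have hsub : ∀ y, Real.log
      ((c + z y ⬝ᵥ (R'ᵀ * diagonal (fun i => Real.exp (κ' i)) * R') *ᵥ z y)
        / (c + z y ⬝ᵥ ((of R)ᵀ * diagonal (fun i => Real.exp (κ i)) * of R) *ᵥ z y))
      = logRatio c (fun i => (of R' *ᵥ z y) i ^ 2) κ'
        - logRatio c (fun i => (of R *ᵥ z y) i ^ 2) κ := fun y => by
    rw [← hlog (of R) κ hR y, show of R' = R' from rfl, ← hlog R' κ' hR' y,
      Real.log_div (hpos hC' y) (hpos hC y),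
      Real.log_div (hpos hC' y) (hpos PosDef.one y), Real.log_div (hpos hC y) (hpos PosDef.one y)]
    ring
  simp only [hsub]
  rw [integral_sub (integrable_logRatio_mulVec P hz hc R' κ')
    (integrable_logRatio_mulVec P hz hc R κ), log_det_transpose_diagonal_mul hR',
    log_det_transpose_diagonal_mul hR]
  simp only [polarObjective] at hle
  linarith

end Existence

/-! ### Integration of bounded functions against signed measures. -/

section SignedIntegral

open VectorMeasure

variable {Ω : Type*} [MeasurableSpace Ω]

theorem SignedMeasure.integrable_of_bound (φ : SignedMeasure Ω) {g : Ω → ℝ} (hg : Measurable g)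
    {M : ℝ} (hM : ∀ y, |g y| ≤ M) : φ.Integrable g := by
  have : IsFiniteMeasure φ.variation := by
    rw [← SignedMeasure.totalVariation_eq_variation]; infer_instance
  exact MeasureTheory.Integrable.of_bound hg.aestronglyMeasurable M (ae_of_all _ hM)

theorem SignedMeasure.integral_eq_sub (φ : SignedMeasure Ω) {g : Ω → ℝ} (hg : Measurable g)
    {M : ℝ} (hM : ∀ y, |g y| ≤ M) :
    φ.integral g (ContinuousLinearMap.lsmul ℝ ℝ).flip
      = ∫ y, g y ∂φ.toJordanDecomposition.posPart - ∫ y, g y ∂φ.toJordanDecomposition.negPart := by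
  conv_lhs => rw [← φ.toSignedMeasure_toJordanDecomposition, JordanDecomposition.toSignedMeasure]
  rw [integral_sub_vectorMeasure (SignedMeasure.integrable_of_bound _ hg hM)
    (SignedMeasure.integrable_of_bound _ hg hM), integral_toSignedMeasure, integral_toSignedMeasure]

theorem integral_eq_setIntegral_measureReal (μ : Measure Ω) [IsFiniteMeasure μ] {g : Ω → ℝ}
    (hg : Measurable g) {M : ℝ} (h0 : ∀ y, 0 ≤ g y) (hM : ∀ y, g y ≤ M) :
    ∫ y, g y ∂μ = ∫ t in Set.Ioc 0 M, μ.real {y | t < g y} := by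
  have hint : Integrable g μ := Integrable.of_bound hg.aestronglyMeasurable M
    (ae_of_all _ fun y => by rw [Real.norm_of_nonneg (h0 y)]; exact hM y)
  rw [hint.integral_eq_integral_meas_lt (ae_of_all _ h0)]
  refine (setIntegral_eq_of_subset_of_forall_sdiff_eq_zero
    (f := fun t => μ.real {y | t < g y}) (measurableSet_Ioi (a := (0 : ℝ)))
    (fun t (ht : t ∈ Set.Ioc 0 M) => ht.1) fun t ht => ?_)
  have hMt : M < t := by
    by_contra h
    exact ht.2 ⟨ht.1, not_lt.1 h⟩
  have : {y | t < g y} = ∅ := by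
    ext y
    simp only [Set.mem_ofPred_eq, Set.mem_empty_iff_false, iff_false, not_lt]
    exact (hM y).trans hMt.le
  rw [this, measureReal_empty]

theorem integrableOn_measureReal_lt (μ : Measure Ω) [IsFiniteMeasure μ] (g : Ω → ℝ) (M : ℝ) :
    IntegrableOn (fun t => μ.real {y | t < g y}) (Set.Ioc 0 M) := by
  have h : Antitone fun t => μ.real {y | t < g y} := fun s t hst =>
    measureReal_mono fun y (hy : t < g y) => hst.trans_lt hy
  exact ((h.antitoneOn _).integrableOn_isCompact isCompact_Icc).mono_set Set.Ioc_subset_Icc_self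

/-- The layer cake bound: the integral of a bounded function against a signed measure is controlled
by the values of the measure on the level sets. -/
theorem SignedMeasure.abs_integral_le (φ : SignedMeasure Ω) {g : Ω → ℝ} (hg : Measurable g)
    {M : ℝ} (hM0 : 0 ≤ M) (hM : ∀ y, |g y| ≤ M) {K : ℝ} (hK : ∀ t, |φ {y | t < g y}| ≤ K)
    (hK' : |φ Set.univ| ≤ K) :
    |φ.integral g (ContinuousLinearMap.lsmul ℝ ℝ).flip| ≤ 3 * M * K := by
  set μ := φ.toJordanDecomposition.posPart with hμ
  set ν := φ.toJordanDecomposition.negPart with hν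
  have happ : ∀ {E : Set Ω}, MeasurableSet E → φ E = μ.real E - ν.real E := fun hE =>
    φ.apply_eq_posPart_real_sub_negPart_real hE
  -- After the shift the values lie in [0, 2M]: the level sets contribute 2MK and undoing the shift
  -- costs M times the total mass, together 3MK.
  have hgM : Measurable fun y => g y + M := hg.add_const M
  have h0 : ∀ y, 0 ≤ g y + M := fun y => by have := (abs_le.1 (hM y)).1; linarith
  have h1 : ∀ y, g y + M ≤ 2 * M := fun y => by have := (abs_le.1 (hM y)).2; linarith
  have hshift : ∀ (m : Measure Ω) [IsFiniteMeasure m],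
      ∫ y, g y ∂m
        = (∫ t in Set.Ioc 0 (2 * M), m.real {y | t < g y + M}) - M * m.real Set.univ := by
    intro m _
    have hint : Integrable g m :=
      Integrable.of_bound hg.aestronglyMeasurable M (ae_of_all _ hM)
    have h2 : ∫ y, (g y + M) ∂m = ∫ t in Set.Ioc 0 (2 * M), m.real {y | t < g y + M} :=
      integral_eq_setIntegral_measureReal m hgM h0 h1
    rw [← h2, MeasureTheory.integral_add hint (integrable_const _),
      MeasureTheory.integral_const, smul_eq_mul]
    ring
  rw [SignedMeasure.integral_eq_sub φ hg hM, hshift μ, hshift ν]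
  have h2 : ∫ t in Set.Ioc 0 (2 * M), (μ.real {y | t < g y + M} - ν.real {y | t < g y + M})
      = (∫ t in Set.Ioc 0 (2 * M), μ.real {y | t < g y + M})
        - ∫ t in Set.Ioc 0 (2 * M), ν.real {y | t < g y + M} :=
    MeasureTheory.integral_sub (integrableOn_measureReal_lt μ (fun y => g y + M) (2 * M))
      (integrableOn_measureReal_lt ν (fun y => g y + M) (2 * M))
  have h3 : ‖∫ t in Set.Ioc 0 (2 * M), (μ.real {y | t < g y + M} - ν.real {y | t < g y + M})‖
      ≤ K * volume.real (Set.Ioc 0 (2 * M)) := by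
    refine norm_setIntegral_le_of_norm_le_const measure_Ioc_lt_top fun t _ => ?_
    rw [← happ (measurableSet_lt measurable_const hgM), Real.norm_eq_abs]
    have : {y | t < g y + M} = {y | t - M < g y} := by
      ext y; simp [sub_lt_iff_lt_add]
    rw [this]
    exact hK _
  rw [Real.volume_real_Ioc_of_le (by linarith), sub_zero] at h3
  rw [happ MeasurableSet.univ] at hK'
  calc _ = |(∫ t in Set.Ioc 0 (2 * M), (μ.real {y | t < g y + M} - ν.real {y | t < g y + M}))
        - M * (μ.real Set.univ - ν.real Set.univ)| := by rw [h2]; congr 1; ring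
    _ ≤ K * (2 * M) + M * K := by
        refine (abs_sub _ _).trans (add_le_add h3 ?_)
        rw [abs_mul, abs_of_nonneg hM0]
        exact mul_le_mul_of_nonneg_left hK' hM0
    _ = 3 * M * K := by ring

end SignedIntegral

/-! ### Integrals as continuous functionals for the set norm. -/

section SetNormFunctional

variable {r d : ℕ}

/-- A bounded function all of whose level sets `{g > t}` belong to `ℰ(r, d)`. -/
structure HasPositivityLevels (r : ℕ) (M : ℝ) (g : EuclideanSpace ℝ (Fin d) → ℝ) : Prop where
  bound : ∀ y, |g y| ≤ M
  levels : ∀ t, {y | t < g y} ∈ positivitySets r d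

namespace HasPositivityLevels

variable {M : ℝ} {g : EuclideanSpace ℝ (Fin d) → ℝ}

theorem measurable (h : HasPositivityLevels r M g) : Measurable g :=
  measurable_of_Ioi fun t => measurableSet_of_mem_positivitySets (h.levels t)

theorem nonneg (h : HasPositivityLevels r M g) : 0 ≤ M := (abs_nonneg _).trans (h.bound 0)

end HasPositivityLevels

theorem abs_apply_le_norm (φ : SignedMeasureE r d) {E : Set (EuclideanSpace ℝ (Fin d))}
    (hE : E ∈ positivitySets r d) : |φ.toSigned E| ≤ ‖φ‖ := by
  rw [SignedMeasureE.norm_def]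
  exact le_ciSup (SignedMeasureE.bddAbove φ) ⟨E, hE⟩

theorem univ_mem_positivitySets : Set.univ ∈ positivitySets r d :=
  ⟨1, by simp, by simp⟩

open Classical in
/-- Integration of `g` as a continuous linear functional for the norm `‖·‖_{ℰ(r, d)}`
(zero unless `g` is bounded with level sets in `ℰ(r, d)`). -/
noncomputable def setNormFunctional (r : ℕ) (g : EuclideanSpace ℝ (Fin d) → ℝ) :
    SignedMeasureE r d →L[ℝ] ℝ :=
  if h : ∃ M, HasPositivityLevels r M g then
    LinearMap.mkContinuous
      { toFun := fun φ => φ.toSigned.integral g (ContinuousLinearMap.lsmul ℝ ℝ).flip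
        map_add' := fun _ _ => VectorMeasure.integral_add_vectorMeasure
          (SignedMeasure.integrable_of_bound _ h.choose_spec.measurable h.choose_spec.bound)
          (SignedMeasure.integrable_of_bound _ h.choose_spec.measurable h.choose_spec.bound)
        map_smul' := fun c _ => VectorMeasure.integral_smul_vectorMeasure g c }
      (3 * h.choose)
      fun φ => SignedMeasure.abs_integral_le φ.toSigned h.choose_spec.measurable
        h.choose_spec.nonneg h.choose_spec.bound
        (fun t => abs_apply_le_norm φ (h.choose_spec.levels t))
        (abs_apply_le_norm φ univ_mem_positivitySets)
  else 0

variable {M : ℝ} {g : EuclideanSpace ℝ (Fin d) → ℝ}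

theorem setNormFunctional_apply (h : HasPositivityLevels r M g) (φ : SignedMeasureE r d) :
    setNormFunctional r g φ
      = φ.toSigned.integral g (ContinuousLinearMap.lsmul ℝ ℝ).flip := by
  rw [setNormFunctional, dif_pos ⟨M, h⟩]
  rfl

theorem setNormFunctional_apply_eq_sub (h : HasPositivityLevels r M g) (φ : SignedMeasureE r d) :
    setNormFunctional r g φ = ∫ y, g y ∂φ.toSigned.toJordanDecomposition.posPart
      - ∫ y, g y ∂φ.toSigned.toJordanDecomposition.negPart := by
  rw [setNormFunctional_apply h, SignedMeasure.integral_eq_sub _ h.measurable h.bound]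

theorem norm_setNormFunctional_le (h : HasPositivityLevels r M g) :
    ‖setNormFunctional r g‖ ≤ 3 * M := by
  refine ContinuousLinearMap.opNorm_le_bound _ (mul_nonneg (by norm_num) h.nonneg) fun φ => ?_
  rw [setNormFunctional_apply h]
  exact SignedMeasure.abs_integral_le φ.toSigned h.measurable h.nonneg h.bound
    (fun t => abs_apply_le_norm φ (h.levels t)) (abs_apply_le_norm φ univ_mem_positivitySets)

theorem setNormFunctional_of (h : HasPositivityLevels r M g)
    (P : Measure (EuclideanSpace ℝ (Fin d))) [IsFiniteMeasure P] :
    setNormFunctional r g (SignedMeasureE.of r P.toSignedMeasure) = ∫ y, g y ∂P := by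
  rw [setNormFunctional_apply h]
  exact VectorMeasure.integral_toSignedMeasure

end SetNormFunctional

/-! ### Extension of functionals to the Banach space. -/

section CompletionExtension

variable {E : Type*} [SeminormedAddCommGroup E] [NormedSpace ℝ E]

open UniformSpace

theorem isUniformInducing_toComplL :
    IsUniformInducing (Completion.toComplL : E →L[ℝ] Completion E) :=
  Completion.isUniformInducing_coe E

theorem denseRange_toComplL : DenseRange (Completion.toComplL : E →L[ℝ] Completion E) :=
  Completion.denseRange_coe

/-- Extension of a continuous linear functional to the completion. -/
noncomputable def extendFunctional (f : E →L[ℝ] ℝ) : Completion E →L[ℝ] ℝ :=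
  f.extend Completion.toComplL

theorem extendFunctional_coe (f : E →L[ℝ] ℝ) (x : E) :
    extendFunctional f (x : Completion E) = f x :=
  ContinuousLinearMap.extend_eq f denseRange_toComplL isUniformInducing_toComplL x

theorem extendFunctional_unique {f : E →L[ℝ] ℝ} {g : Completion E →L[ℝ] ℝ}
    (h : ∀ x : E, g (x : Completion E) = f x) : extendFunctional f = g :=
  ContinuousLinearMap.extend_unique f denseRange_toComplL isUniformInducing_toComplL g
    (ContinuousLinearMap.ext h)

theorem norm_extendFunctional_le (f : E →L[ℝ] ℝ) : ‖extendFunctional f‖ ≤ ‖f‖ := by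
  refine ContinuousLinearMap.opNorm_le_bound _ (norm_nonneg f) fun x => ?_
  refine Completion.induction_on x ?_ fun x => ?_
  · exact isClosed_le (ContinuousLinearMap.continuous _).norm
      (continuous_const.mul continuous_norm)
  · rw [Completion.norm_coe, extendFunctional_coe]
    exact f.le_opNorm x

/-- Extension of continuous linear functionals to the completion. -/
noncomputable def completionExtension : (E →L[ℝ] ℝ) →L[ℝ] (Completion E →L[ℝ] ℝ) :=
  LinearMap.mkContinuous
    { toFun := extendFunctional
      map_add' := fun f g => extendFunctional_unique fun x => by
        rw [add_apply, extendFunctional_coe, extendFunctional_coe]; rfl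
      map_smul' := fun c f => extendFunctional_unique fun x => by
        rw [smul_apply, extendFunctional_coe]; rfl } 1
    fun f => by
      rw [one_mul]
      exact norm_extendFunctional_le f

theorem completionExtension_coe (f : E →L[ℝ] ℝ) (x : E) :
    completionExtension f (x : Completion E) = f x :=
  extendFunctional_coe f x

end CompletionExtension

/-! ### Differentiability in operator norm from differentiability at each fixed measure. -/

section DualCalculus

variable {V E : Type*} [NormedAddCommGroup V] [NormedSpace ℝ V] [SeminormedAddCommGroup E]
  [NormedSpace ℝ E] {g : V → E →L[ℝ] ℝ} {D : V → V →L[ℝ] E →L[ℝ] ℝ} {s : Set V}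

/-- Differentiation under the integral only works for one φ at a time. The mean value inequality for
each φ has constant K‖φ‖, and this uniformity upgrades it to the operator norm. -/
theorem norm_sub_le_of_forall_hasFDerivAt_apply (hs : Convex ℝ s)
    (hg : ∀ x ∈ s, ∀ φ, HasFDerivAt (fun x => g x φ) ((D x).flip φ) x) {K : ℝ} (hK0 : 0 ≤ K)
    {L : V →L[ℝ] E →L[ℝ] ℝ} (hK : ∀ x ∈ s, ‖D x - L‖ ≤ K) {x y : V} (hx : x ∈ s) (hy : y ∈ s) :
    ‖g y - g x - L (y - x)‖ ≤ K * ‖y - x‖ := by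
  refine ContinuousLinearMap.opNorm_le_bound _ (by positivity) fun φ => ?_
  have := hs.norm_image_sub_le_of_norm_hasFDerivWithin_le' (f := fun x => g x φ)
    (f' := fun x => (D x).flip φ) (φ := L.flip φ) (C := K * ‖φ‖)
    (fun x hx => (hg x hx φ).hasFDerivWithinAt) (fun x hx => ?_) hx hy
  · calc _ ≤ K * ‖φ‖ * ‖y - x‖ := this
      _ = _ := by ring
  · have h1 : (D x).flip φ - L.flip φ = (D x - L).flip φ := rfl
    rw [h1]
    calc ‖(D x - L).flip φ‖ ≤ ‖(D x - L).flip‖ * ‖φ‖ := ContinuousLinearMap.le_opNorm _ _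
      _ ≤ K * ‖φ‖ := by
        rw [ContinuousLinearMap.opNorm_flip]
        exact mul_le_mul_of_nonneg_right (hK x hx) (norm_nonneg _)

/-- A bounded candidate derivative makes the map Lipschitz. Continuity obtained this way costs one
extra derivative, hence two extra degrees in the class of sets. -/
theorem continuousOn_of_forall_hasFDerivAt_apply (hs : Convex ℝ s)
    (hg : ∀ x ∈ s, ∀ φ, HasFDerivAt (fun x => g x φ) ((D x).flip φ) x) {K : ℝ}
    (hK : ∀ x ∈ s, ‖D x‖ ≤ K) : ContinuousOn g s := by
  rcases s.eq_empty_or_nonempty with rfl | ⟨x₀, hx₀⟩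
  · exact continuousOn_empty g
  have hK0 : 0 ≤ K := (norm_nonneg (D x₀)).trans (hK x₀ hx₀)
  refine (LipschitzOnWith.of_dist_le_mul (K := K.toNNReal) fun x hx y hy => ?_).continuousOn
  have := norm_sub_le_of_forall_hasFDerivAt_apply hs hg hK0 (L := 0)
    (fun x hx => (congrArg norm (sub_zero (D x))).trans_le (hK x hx)) hy hx
  rw [dist_eq_norm, dist_eq_norm, Real.coe_toNNReal _ hK0]
  simpa using this

theorem hasFDerivAt_of_forall_hasFDerivAt_apply (hs : IsOpen s)
    (hg : ∀ x ∈ s, ∀ φ, HasFDerivAt (fun x => g x φ) ((D x).flip φ) x) {x : V} (hx : x ∈ s)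
    (hD : ContinuousAt D x) : HasFDerivAt g (D x) x := by
  refine HasFDerivAt.of_isLittleO (Asymptotics.isLittleO_iff.2 fun ε hε => ?_)
  obtain ⟨δ, hδ, hball⟩ := Metric.mem_nhds_iff.1
    (Filter.inter_mem (hs.mem_nhds hx) (hD (Metric.closedBall_mem_nhds (D x) hε)))
  filter_upwards [Metric.ball_mem_nhds x hδ] with y hy
  refine norm_sub_le_of_forall_hasFDerivAt_apply (convex_ball x δ)
    (fun x hx => hg x (hball hx).1) hε.le (fun x' hx' => ?_) (Metric.mem_ball_self hδ) hy
  exact (dist_eq_norm (D x') (D x)).symm.trans_le (hball hx').2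

end DualCalculus

/-! ### Rational functions whose level sets are polynomial positivity sets. -/

section RationalFunctions

open Matrix

variable {d : ℕ}

/-- Shape matrices for `(y, 1)`, with the sup norm. -/
abbrev ShapeSpace (d : ℕ) : Type := Fin d ⊕ Unit → Fin d ⊕ Unit → ℝ

/-- The matrices whose quadratic form is at least `ε` times the squared Euclidean norm. -/
def coerciveSet (d : ℕ) (ε : ℝ) : Set (ShapeSpace d) :=
  {C | ∀ v : Fin d ⊕ Unit → ℝ, ε * (v ⬝ᵥ v) ≤ v ⬝ᵥ of C *ᵥ v}

theorem dotProduct_of_mulVec_eq_sum (C : ShapeSpace d) (v : Fin d ⊕ Unit → ℝ) :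
    v ⬝ᵥ of C *ᵥ v = ∑ a, ∑ b, C a b * (v a * v b) := by
  rw [dotProduct]
  refine Finset.sum_congr rfl fun a _ => ?_
  rw [mulVec, dotProduct, Finset.mul_sum]
  refine Finset.sum_congr rfl fun b _ => ?_
  rw [of_apply]
  ring

theorem abs_mul_le_dotProduct_self {ι : Type*} [Fintype ι] (v : ι → ℝ) (a b : ι) :
    |v a * v b| ≤ v ⬝ᵥ v := by
  have h : ∀ i, v i ^ 2 ≤ v ⬝ᵥ v := fun i => by
    rw [sq]
    exact Finset.single_le_sum (f := fun i => v i * v i) (fun i _ => mul_self_nonneg (v i))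
      (Finset.mem_univ i)
  rw [abs_mul]
  have h1 := h a
  have h2 := h b
  rw [← sq_abs] at h1 h2
  nlinarith [sq_nonneg (|v a| - |v b|)]

/-- The quadratic form of `C` at `(y, 1)` as a polynomial in `y`. -/
noncomputable def quadPoly (C : ShapeSpace d) : MvPolynomial (Fin d) ℝ :=
  ∑ a, ∑ b, MvPolynomial.C (C a b) * (homogPoly d a * homogPoly d b)

theorem eval_quadPoly (C : ShapeSpace d) (y : EuclideanSpace ℝ (Fin d)) :
    MvPolynomial.eval (fun i => y i) (quadPoly C) = homog y ⬝ᵥ of C *ᵥ homog y := by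
  simp only [quadPoly, map_sum, map_mul, MvPolynomial.eval_C, eval_homogPoly,
    dotProduct_of_mulVec_eq_sum]

theorem totalDegree_homogPoly_mul_le (a b : Fin d ⊕ Unit) :
    (homogPoly d a * homogPoly d b).totalDegree ≤ 2 :=
  (MvPolynomial.totalDegree_mul _ _).trans
    (add_le_add (totalDegree_homogPoly_le a) (totalDegree_homogPoly_le b))

theorem totalDegree_quadPoly_le (C : ShapeSpace d) : (quadPoly C).totalDegree ≤ 2 := by
  refine MvPolynomial.totalDegree_finsetSum_le fun a _ =>
    MvPolynomial.totalDegree_finsetSum_le fun b _ => ?_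
  refine (MvPolynomial.totalDegree_mul _ _).trans ?_
  rw [MvPolynomial.totalDegree_C, zero_add]
  exact totalDegree_homogPoly_mul_le a b

/-- A polynomial of degree at most `2 n` bounded by `|(y, 1)|^(2 n)`. -/
structure IsNumerator (n : ℕ) (p : MvPolynomial (Fin d) ℝ) : Prop where
  degree : p.totalDegree ≤ 2 * n
  bound : ∀ y : EuclideanSpace ℝ (Fin d),
    |MvPolynomial.eval (fun i => y i) p| ≤ (homog y ⬝ᵥ homog y) ^ n

theorem IsNumerator.one : IsNumerator (d := d) 0 1 := ⟨by simp, by simp⟩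

/-- Differentiating p/u^n in an entry of C multiplies p by z_a z_b and raises n by one; the class of
numerators is stable under this. -/
theorem IsNumerator.mul_homogPoly {n : ℕ} {p : MvPolynomial (Fin d) ℝ} (hp : IsNumerator n p)
    (a b : Fin d ⊕ Unit) : IsNumerator (n + 1) (p * (homogPoly d a * homogPoly d b)) where
  degree := (MvPolynomial.totalDegree_mul _ _).trans
    (add_le_add hp.degree (totalDegree_homogPoly_mul_le a b))
  bound y := by
    rw [map_mul, map_mul, eval_homogPoly, eval_homogPoly, abs_mul, pow_succ]
    have h := abs_mul_le_dotProduct_self (homog y) a b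
    exact mul_le_mul (hp.bound y) h (abs_nonneg _) ((abs_nonneg _).trans (hp.bound y))

/-- The function `p(y) / (c + (y, 1)' C (y, 1))^n`. -/
noncomputable def quadRatio (c : ℝ) (p : MvPolynomial (Fin d) ℝ) (n : ℕ) (C : ShapeSpace d)
    (y : EuclideanSpace ℝ (Fin d)) : ℝ :=
  MvPolynomial.eval (fun i => y i) p / (c + homog y ⬝ᵥ of C *ᵥ homog y) ^ n

theorem dotProduct_self_nonneg_real {ι : Type*} [Fintype ι] (v : ι → ℝ) : 0 ≤ v ⬝ᵥ v :=
  Finset.sum_nonneg fun i _ => mul_self_nonneg (v i)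

theorem add_quadratic_pos {c ε : ℝ} (hc : 0 < c) (hε : 0 < ε) {C : ShapeSpace d}
    (hC : C ∈ coerciveSet d ε) (v : Fin d ⊕ Unit → ℝ) : 0 < c + v ⬝ᵥ of C *ᵥ v :=
  add_pos_of_pos_of_nonneg hc
    ((mul_nonneg hε.le (dotProduct_self_nonneg_real v)).trans (hC v))

theorem IsNumerator.abs_quadRatio_le {c ε : ℝ} (hc : 0 < c) (hε : 0 < ε) {C : ShapeSpace d}
    (hC : C ∈ coerciveSet d ε) {n : ℕ} {p : MvPolynomial (Fin d) ℝ} (hp : IsNumerator n p)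
    (y : EuclideanSpace ℝ (Fin d)) : |quadRatio c p n C y| ≤ ε⁻¹ ^ n := by
  have hu := add_quadratic_pos hc hε hC (homog y)
  rw [quadRatio, abs_div, abs_of_pos (pow_pos hu n), div_le_iff₀ (pow_pos hu n), ← mul_pow]
  refine (hp.bound y).trans (pow_le_pow_left₀ (dotProduct_self_nonneg_real _) ?_ n)
  rw [inv_mul_eq_div, le_div_iff₀ hε, mul_comm]
  linarith [hC (homog y)]

/-- Since the denominator u is positive, p/u^n > t means p - t u^n > 0, a polynomial inequality of
degree at most 2n. This is the link between the class ℰ(r, d) and the critical equation. -/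
theorem IsNumerator.hasPositivityLevels {c ε : ℝ} (hc : 0 < c) (hε : 0 < ε) {C : ShapeSpace d}
    (hC : C ∈ coerciveSet d ε) {n r : ℕ} (hnr : 2 * n ≤ r) {p : MvPolynomial (Fin d) ℝ}
    (hp : IsNumerator n p) : HasPositivityLevels r (ε⁻¹ ^ n) (quadRatio c p n C) where
  bound := hp.abs_quadRatio_le hc hε hC
  levels t := by
    refine ⟨p - MvPolynomial.C t * (MvPolynomial.C c + quadPoly C) ^ n, ?_, ?_⟩
    · refine (MvPolynomial.totalDegree_sub _ _).trans (max_le (hp.degree.trans hnr) ?_)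
      refine (MvPolynomial.totalDegree_mul _ _).trans ?_
      rw [MvPolynomial.totalDegree_C, zero_add]
      refine (MvPolynomial.totalDegree_pow _ _).trans (le_trans ?_ hnr)
      rw [mul_comm]
      refine Nat.mul_le_mul_right n ((MvPolynomial.totalDegree_add _ _).trans ?_)
      rw [MvPolynomial.totalDegree_C]
      exact max_le (by norm_num) (totalDegree_quadPoly_le C)
    · ext y
      have hu := pow_pos (add_quadratic_pos hc hε hC (homog y)) n
      simp only [Set.mem_ofPred_eq, quadRatio, map_sub, map_mul, map_pow, map_add,
        MvPolynomial.eval_C, eval_quadPoly]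
      rw [lt_div_iff₀ hu, sub_pos]

end RationalFunctions

/-! ### Smooth dependence of the integral functionals on the shape matrix. -/

section Smoothness

open Matrix

variable {d : ℕ}

/-- The coordinate functional `C ↦ C a b`. -/
noncomputable def entryCLM (a b : Fin d ⊕ Unit) : ShapeSpace d →L[ℝ] ℝ :=
  (ContinuousLinearMap.proj b : (Fin d ⊕ Unit → ℝ) →L[ℝ] ℝ).comp
    (ContinuousLinearMap.proj a : ShapeSpace d →L[ℝ] Fin d ⊕ Unit → ℝ)

theorem entryCLM_apply (a b : Fin d ⊕ Unit) (C : ShapeSpace d) : entryCLM a b C = C a b := rfl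

theorem hasFDerivAt_quadratic (c : ℝ) (v : Fin d ⊕ Unit → ℝ) (C : ShapeSpace d) :
    HasFDerivAt (fun C : ShapeSpace d => c + v ⬝ᵥ of C *ᵥ v)
      (∑ a, ∑ b, (v a * v b) • entryCLM a b) C := by
  simp only [dotProduct_of_mulVec_eq_sum]
  refine HasFDerivAt.const_add c (HasFDerivAt.fun_sum fun a _ => HasFDerivAt.fun_sum fun b _ => ?_)
  exact (entryCLM a b).hasFDerivAt.mul_const (v a * v b)

theorem hasFDerivAt_quadRatio {c ε : ℝ} (hc : 0 < c) (hε : 0 < ε) {C : ShapeSpace d}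
    (hC : C ∈ coerciveSet d ε) (p : MvPolynomial (Fin d) ℝ) (n : ℕ)
    (y : EuclideanSpace ℝ (Fin d)) :
    HasFDerivAt (fun C => quadRatio c p n C y)
      (∑ a, ∑ b, (-(n : ℝ) * quadRatio c (p * (homogPoly d a * homogPoly d b)) (n + 1) C y) •
        entryCLM a b) C := by
  have hu := (add_quadratic_pos hc hε hC (homog y)).ne'
  have h := (((hasDerivAt_inv (pow_ne_zero n hu)).comp_hasFDerivAt C
    ((hasFDerivAt_quadratic c (homog y) C).pow n)).const_mul
    (MvPolynomial.eval (fun i => y i) p))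
  refine h.congr_fderiv ?_
  ext H
  simp only [_root_.smul_apply, _root_.sum_apply, smul_eq_mul, entryCLM_apply, Finset.mul_sum,
    quadRatio, map_mul, eval_homogPoly]
  refine Finset.sum_congr rfl fun a _ => Finset.sum_congr rfl fun b _ => ?_
  rcases n with _ | n
  · simp
  · field_simp
    simp
    ring

theorem integrable_sum_sum {Ω ι V : Type*} [Fintype ι] [MeasurableSpace Ω] {μ : Measure Ω}
    [NormedAddCommGroup V] {f : ι → ι → Ω → V} (hf : ∀ a b, Integrable (f a b) μ) :
    Integrable (fun y => ∑ a, ∑ b, f a b y) μ :=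
  integrable_finsetSum _ fun a _ => integrable_finsetSum _ fun b _ => hf a b

theorem integral_sum_sum {Ω ι V : Type*} [Fintype ι] [MeasurableSpace Ω] {μ : Measure Ω}
    [NormedAddCommGroup V] [NormedSpace ℝ V] {f : ι → ι → Ω → V}
    (hf : ∀ a b, Integrable (f a b) μ) :
    ∫ y, ∑ a, ∑ b, f a b y ∂μ = ∑ a, ∑ b, ∫ y, f a b y ∂μ := by
  rw [integral_finsetSum _ fun a _ => integrable_finsetSum _ fun b _ => hf a b]
  exact Finset.sum_congr rfl fun a _ => integral_finsetSum _ fun b _ => hf a b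

/-- The derivative of `C ↦ quadRatio c p n C y`. -/
noncomputable def quadRatioFDeriv (c : ℝ) (p : MvPolynomial (Fin d) ℝ) (n : ℕ) (C : ShapeSpace d)
    (y : EuclideanSpace ℝ (Fin d)) : ShapeSpace d →L[ℝ] ℝ :=
  ∑ a, ∑ b, (-(n : ℝ) * quadRatio c (p * (homogPoly d a * homogPoly d b)) (n + 1) C y) •
    entryCLM a b

theorem IsNumerator.norm_quadRatioFDeriv_le {c ε : ℝ} (hc : 0 < c) (hε : 0 < ε) {C : ShapeSpace d}
    (hC : C ∈ coerciveSet d ε) {n : ℕ} {p : MvPolynomial (Fin d) ℝ} (hp : IsNumerator n p)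
    (y : EuclideanSpace ℝ (Fin d)) :
    ‖quadRatioFDeriv c p n C y‖ ≤ ∑ a : Fin d ⊕ Unit, ∑ b : Fin d ⊕ Unit,
      (n * ε⁻¹ ^ (n + 1)) * ‖entryCLM (d := d) a b‖ := by
  refine (norm_sum_le _ _).trans (Finset.sum_le_sum fun a _ =>
    (norm_sum_le _ _).trans (Finset.sum_le_sum fun b _ => ?_))
  rw [norm_smul]
  refine mul_le_mul_of_nonneg_right ?_ (norm_nonneg _)
  rw [norm_mul, norm_neg, Real.norm_natCast]
  exact mul_le_mul_of_nonneg_left ((hp.mul_homogPoly a b).abs_quadRatio_le hc hε hC y)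
    n.cast_nonneg

theorem IsNumerator.integrable_quadRatio {c ε : ℝ} (hc : 0 < c) (hε : 0 < ε) {C : ShapeSpace d}
    (hC : C ∈ coerciveSet d ε) (μ : Measure (EuclideanSpace ℝ (Fin d))) [IsFiniteMeasure μ]
    {n : ℕ} {p : MvPolynomial (Fin d) ℝ} (hp : IsNumerator n p) :
    Integrable (quadRatio c p n C) μ :=
  Integrable.of_bound
    (hp.hasPositivityLevels hc hε hC (le_refl (2 * n))).measurable.aestronglyMeasurable _
    (ae_of_all _ (hp.abs_quadRatio_le hc hε hC))

theorem IsNumerator.integrable_quadRatioFDeriv_term {c ε : ℝ} (hc : 0 < c) (hε : 0 < ε)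
    {C : ShapeSpace d} (hC : C ∈ coerciveSet d ε) (μ : Measure (EuclideanSpace ℝ (Fin d)))
    [IsFiniteMeasure μ] {n : ℕ} {p : MvPolynomial (Fin d) ℝ} (hp : IsNumerator n p)
    (a b : Fin d ⊕ Unit) :
    Integrable (fun y => (-(n : ℝ) *
      quadRatio c (p * (homogPoly d a * homogPoly d b)) (n + 1) C y) • entryCLM a b) μ :=
  (((hp.mul_homogPoly a b).integrable_quadRatio hc hε hC μ).const_mul _).smul_const _

theorem IsNumerator.integrable_quadRatioFDeriv {c ε : ℝ} (hc : 0 < c) (hε : 0 < ε)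
    {C : ShapeSpace d} (hC : C ∈ coerciveSet d ε) (μ : Measure (EuclideanSpace ℝ (Fin d)))
    [IsFiniteMeasure μ] {n : ℕ} {p : MvPolynomial (Fin d) ℝ} (hp : IsNumerator n p) :
    Integrable (fun y => quadRatioFDeriv c p n C y) μ := by
  simp only [quadRatioFDeriv]
  exact integrable_sum_sum (f := fun a b y => (-(n : ℝ) *
    quadRatio c (p * (homogPoly d a * homogPoly d b)) (n + 1) C y) • entryCLM a b)
    (hp.integrable_quadRatioFDeriv_term hc hε hC μ)

theorem IsNumerator.integral_quadRatioFDeriv {c ε : ℝ} (hc : 0 < c) (hε : 0 < ε)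
    {C : ShapeSpace d} (hC : C ∈ coerciveSet d ε) (μ : Measure (EuclideanSpace ℝ (Fin d)))
    [IsFiniteMeasure μ] {n : ℕ} {p : MvPolynomial (Fin d) ℝ} (hp : IsNumerator n p) :
    ∫ y, quadRatioFDeriv c p n C y ∂μ = ∑ a, ∑ b, (-(n : ℝ) *
        ∫ y, quadRatio c (p * (homogPoly d a * homogPoly d b)) (n + 1) C y ∂μ) •
        entryCLM a b := by
  have hint := hp.integrable_quadRatioFDeriv_term hc hε hC μ
  simp only [quadRatioFDeriv]
  rw [integral_sum_sum (f := fun a b y => (-(n : ℝ) *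
    quadRatio c (p * (homogPoly d a * homogPoly d b)) (n + 1) C y) • entryCLM a b) hint]
  refine Finset.sum_congr rfl fun a _ => Finset.sum_congr rfl fun b _ => ?_
  rw [integral_smul_const, integral_const_mul]

theorem hasFDerivAt_integral_quadRatio {c ε : ℝ} (hc : 0 < c) (hε : 0 < ε)
    {s : Set (ShapeSpace d)} (hs : IsOpen s) (hsub : s ⊆ coerciveSet d ε)
    (μ : Measure (EuclideanSpace ℝ (Fin d))) [IsFiniteMeasure μ]
    {n : ℕ} {p : MvPolynomial (Fin d) ℝ} (hp : IsNumerator n p) {C : ShapeSpace d} (hC : C ∈ s) :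
    HasFDerivAt (fun C => ∫ y, quadRatio c p n C y ∂μ)
      (∑ a, ∑ b, (-(n : ℝ) *
        ∫ y, quadRatio c (p * (homogPoly d a * homogPoly d b)) (n + 1) C y ∂μ) •
        entryCLM a b) C := by
  rw [← hp.integral_quadRatioFDeriv hc hε (hsub hC) μ]
  exact hasFDerivAt_integral_of_dominated_of_fderiv_le (μ := μ)
    (F' := quadRatioFDeriv c p n)
    (bound := fun _ => ∑ a : Fin d ⊕ Unit, ∑ b : Fin d ⊕ Unit,
      (n * ε⁻¹ ^ (n + 1)) * ‖entryCLM (d := d) a b‖) (hs.mem_nhds hC)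
    (Filter.eventually_of_mem (hs.mem_nhds hC) fun C' hC' =>
      (hp.integrable_quadRatio hc hε (hsub hC') μ).1)
    (hp.integrable_quadRatio hc hε (hsub hC) μ)
    (hp.integrable_quadRatioFDeriv hc hε (hsub hC) μ).1
    (ae_of_all _ fun y C' hC' => hp.norm_quadRatioFDeriv_le hc hε (hsub hC') y)
    (integrable_const _)
    (ae_of_all _ fun y C' hC' => hasFDerivAt_quadRatio hc hε (hsub hC') p n y)

/-- The space of measures carries only a seminorm here, but its dual is genuinely normed: a
functional of operator norm zero vanishes. Differential calculus requires a normed target. -/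
noncomputable instance (r : ℕ) : NormedAddCommGroup (SignedMeasureE r d →L[ℝ] ℝ) :=
  NormedAddCommGroup.ofSeparation fun f hf => ContinuousLinearMap.ext fun φ => by
    have h := f.le_opNorm φ
    rw [hf, zero_mul] at h
    exact norm_le_zero_iff.1 h

/-- The derivative of `C ↦ setNormFunctional r (quadRatio c p n C)`. -/
noncomputable def quadRatioDeriv (r : ℕ) (c : ℝ) (p : MvPolynomial (Fin d) ℝ) (n : ℕ)
    (C : ShapeSpace d) : ShapeSpace d →L[ℝ] SignedMeasureE r d →L[ℝ] ℝ :=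
  ∑ a, ∑ b, (entryCLM a b).smulRight
    (-(n : ℝ) • setNormFunctional r (quadRatio c (p * (homogPoly d a * homogPoly d b)) (n + 1) C))

theorem quadRatioDeriv_apply (r : ℕ) (c : ℝ) (p : MvPolynomial (Fin d) ℝ) (n : ℕ)
    (C H : ShapeSpace d) (φ : SignedMeasureE r d) :
    quadRatioDeriv r c p n C H φ = ∑ a, ∑ b, H a b * (-(n : ℝ) *
      setNormFunctional r (quadRatio c (p * (homogPoly d a * homogPoly d b)) (n + 1) C) φ) := by
  simp only [quadRatioDeriv, _root_.sum_apply, ContinuousLinearMap.smulRight_apply,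
    _root_.smul_apply,
    smul_eq_mul, entryCLM_apply]

/-- For fixed φ the Jordan decomposition reduces this to two finite positive measures and dominated
convergence. -/
theorem hasFDerivAt_setNormFunctional_apply {c ε : ℝ} (hc : 0 < c) (hε : 0 < ε)
    {s : Set (ShapeSpace d)} (hs : IsOpen s) (hsub : s ⊆ coerciveSet d ε)
    {n r : ℕ} (hnr : 2 * (n + 1) ≤ r) {p : MvPolynomial (Fin d) ℝ} (hp : IsNumerator n p)
    {C : ShapeSpace d} (hC : C ∈ s) (φ : SignedMeasureE r d) :
    HasFDerivAt (fun C => setNormFunctional r (quadRatio c p n C) φ)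
      ((quadRatioDeriv r c p n C).flip φ) C := by
  have h := (hasFDerivAt_integral_quadRatio hc hε hs hsub
    φ.toSigned.toJordanDecomposition.posPart hp hC).sub (hasFDerivAt_integral_quadRatio hc hε hs
    hsub φ.toSigned.toJordanDecomposition.negPart hp hC)
  refine (h.congr_of_eventuallyEq ?_).congr_fderiv ?_
  · filter_upwards [hs.mem_nhds hC] with C' hC'
    exact setNormFunctional_apply_eq_sub
      (hp.hasPositivityLevels hc hε (hsub hC') (by omega)) φ
  · ext H
    rw [ContinuousLinearMap.flip_apply, quadRatioDeriv_apply]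
    simp only [_root_.sub_apply, _root_.sum_apply, _root_.smul_apply, smul_eq_mul, entryCLM_apply,
      ← Finset.sum_sub_distrib]
    refine Finset.sum_congr rfl fun a _ => Finset.sum_congr rfl fun b _ => ?_
    rw [setNormFunctional_apply_eq_sub
      ((hp.mul_homogPoly a b).hasPositivityLevels hc hε (hsub hC) hnr)]
    ring

theorem norm_quadRatioDeriv_le {c ε : ℝ} (hc : 0 < c) (hε : 0 < ε) {C : ShapeSpace d}
    (hC : C ∈ coerciveSet d ε) {n r : ℕ} (hnr : 2 * (n + 1) ≤ r) {p : MvPolynomial (Fin d) ℝ}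
    (hp : IsNumerator n p) :
    ‖quadRatioDeriv r c p n C‖ ≤ ∑ a : Fin d ⊕ Unit, ∑ b : Fin d ⊕ Unit,
      ‖entryCLM (d := d) a b‖ * (n * (3 * ε⁻¹ ^ (n + 1))) := by
  rw [quadRatioDeriv]
  refine (norm_sum_le (E := ShapeSpace d →L[ℝ] SignedMeasureE r d →L[ℝ] ℝ) _ _).trans
    (Finset.sum_le_sum fun a _ =>
    (norm_sum_le (E := ShapeSpace d →L[ℝ] SignedMeasureE r d →L[ℝ] ℝ) _ _).trans
    (Finset.sum_le_sum fun b _ => ?_))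
  rw [ContinuousLinearMap.norm_smulRight_apply (entryCLM a b) (-(n : ℝ) •
    setNormFunctional r (quadRatio c (p * (homogPoly d a * homogPoly d b)) (n + 1) C))]
  refine mul_le_mul_of_nonneg_left ?_ (norm_nonneg _)
  rw [norm_smul, norm_neg, Real.norm_natCast]
  exact mul_le_mul_of_nonneg_left (norm_setNormFunctional_le
    ((hp.mul_homogPoly a b).hasPositivityLevels hc hε hC hnr)) n.cast_nonneg

/-- Induction on j: the derivative is a combination of functionals of the same kind with exponent n
+ 1. The j-th derivative has exponent n + j, and its continuity uses a bound with exponent n + j +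
1, whence the condition on r. -/
theorem contDiffOn_setNormFunctional {c ε : ℝ} (hc : 0 < c) (hε : 0 < ε)
    {s : Set (ShapeSpace d)} (hs : IsOpen s) (hconv : Convex ℝ s) (hsub : s ⊆ coerciveSet d ε)
    {r : ℕ} (j : ℕ) : ∀ {n : ℕ} {p : MvPolynomial (Fin d) ℝ}, 2 * (n + j + 1) ≤ r →
    IsNumerator n p → ContDiffOn ℝ j (fun C => setNormFunctional r (quadRatio c p n C)) s := by
  have hcont : ∀ {n : ℕ} {p : MvPolynomial (Fin d) ℝ}, 2 * (n + 1) ≤ r → IsNumerator n p →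
      ContinuousOn (fun C => setNormFunctional r (quadRatio c p n C)) s := fun hnr hp =>
    continuousOn_of_forall_hasFDerivAt_apply hconv
      (fun C hC φ => hasFDerivAt_setNormFunctional_apply hc hε hs hsub hnr hp hC φ)
      fun C hC => norm_quadRatioDeriv_le hc hε (hsub hC) hnr hp
  induction j with
  | zero =>
    intro n p hnr hp
    exact contDiffOn_zero.2 (hcont (by omega) hp)
  | succ j ih =>
    intro n p hnr hp
    have hD : ContDiffOn ℝ j (quadRatioDeriv r c p n) s := by
      refine ContDiffOn.sum fun a _ => ContDiffOn.sum fun b _ => ?_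
      exact contDiffOn_const.smulRight
        (ContDiffOn.const_smul (-(n : ℝ)) (ih (by omega) (hp.mul_homogPoly a b)))
    have hderiv : ∀ C ∈ s, HasFDerivAt (fun C => setNormFunctional r (quadRatio c p n C))
        (quadRatioDeriv r c p n C) C := fun C hC =>
      hasFDerivAt_of_forall_hasFDerivAt_apply hs
        (fun C hC φ => hasFDerivAt_setNormFunctional_apply hc hε hs hsub (by omega) hp hC φ) hC
        (hD.continuousOn.continuousAt (hs.mem_nhds hC))
    rw [show ((j + 1 : ℕ) : WithTop ℕ∞) = (j : WithTop ℕ∞) + 1 by norm_cast,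
      contDiffOn_succ_iff_fderiv_of_isOpen hs]
    refine ⟨fun C hC => (hderiv C hC).differentiableAt.differentiableWithinAt,
      fun h => by simp at h, ?_⟩
    exact hD.congr fun C hC => (hderiv C hC).fderiv

end Smoothness

/-! ### Uniform coercivity near a positive definite matrix. -/

section Coercivity

open Matrix

/-- Matrices close to a positive definite matrix have uniformly coercive quadratic forms. -/
theorem Matrix.PosDef.exists_coercive {ι : Type} [Fintype ι] [DecidableEq ι] {S₀ : Matrix ι ι ℝ}
    (hS₀ : S₀.PosDef) : ∃ ε > 0, ∀ S : Matrix ι ι ℝ, (∀ i j, |S i j - S₀ i j| < ε) →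
      ∀ v : ι → ℝ, ε * (v ⬝ᵥ v) ≤ v ⬝ᵥ S *ᵥ v := by
  -- Cauchy–Schwarz against the basis vectors gives v'v ≤ tr(S₀⁻¹) v'S₀v.
  set t : ℝ := ∑ i, S₀⁻¹ i i
  have ht : 0 ≤ t := Finset.sum_nonneg fun i _ => hS₀.inv.posSemidef.diag_nonneg
  have hlow : ∀ v : ι → ℝ, v ⬝ᵥ v ≤ t * (v ⬝ᵥ S₀ *ᵥ v) := fun v => by
    rw [dotProduct, Finset.sum_mul]
    refine Finset.sum_le_sum fun i _ => ?_
    have := hS₀.dotProduct_sq_le (Pi.single i 1) v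
    simpa [sq] using this
  set n : ℝ := (Fintype.card ι : ℝ) with hn_def
  have hn : 0 ≤ n := Nat.cast_nonneg _
  have hden : 0 < (1 + t) * (1 + n * n) := by positivity
  -- With this ε the form of S₀ is at least ε(1 + n²)v'v, while an entrywise perturbation below ε
  -- costs at most εn²v'v.
  refine ⟨((1 + t) * (1 + n * n))⁻¹, inv_pos.2 hden, fun S hS v => ?_⟩
  set ε := ((1 + t) * (1 + n * n))⁻¹ with hε
  have hεpos : 0 < ε := inv_pos.2 hden
  have hv := dotProduct_self_nonneg_real v
  have hdiff : |v ⬝ᵥ (S - S₀) *ᵥ v| ≤ n * n * ε * (v ⬝ᵥ v) := by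
    have h1 : v ⬝ᵥ (S - S₀) *ᵥ v = ∑ a, ∑ b, (S - S₀) a b * (v a * v b) := by
      rw [dotProduct]
      refine Finset.sum_congr rfl fun a _ => ?_
      rw [mulVec, dotProduct, Finset.mul_sum]
      exact Finset.sum_congr rfl fun b _ => by ring
    rw [h1]
    refine (Finset.abs_sum_le_sum_abs _ _).trans ((Finset.sum_le_sum fun a _ =>
      (Finset.abs_sum_le_sum_abs _ _).trans (Finset.sum_le_sum fun b _ =>
        (?_ : _ ≤ ε * (v ⬝ᵥ v)))).trans (le_of_eq ?_))
    · rw [abs_mul]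
      exact mul_le_mul (hS a b).le (abs_mul_le_dotProduct_self v a b) (abs_nonneg _) hεpos.le
    · simp only [Finset.sum_const, Finset.card_univ, nsmul_eq_mul, ← hn_def]
      ring
  have hsplit : v ⬝ᵥ S *ᵥ v = v ⬝ᵥ S₀ *ᵥ v + v ⬝ᵥ (S - S₀) *ᵥ v := by
    rw [sub_mulVec, dotProduct_sub]
    ring
  have hq : 0 ≤ v ⬝ᵥ S₀ *ᵥ v := hS₀.quadratic_nonneg v
  have h2 : ε * ((1 + t) * (1 + n * n)) = 1 := inv_mul_cancel₀ hden.ne'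
  have h3 : ε * (1 + n * n) * (v ⬝ᵥ v) ≤ v ⬝ᵥ S₀ *ᵥ v := by
    calc _ ≤ ε * (1 + n * n) * ((1 + t) * (v ⬝ᵥ S₀ *ᵥ v)) := by
          refine mul_le_mul_of_nonneg_left ?_ (by positivity)
          linarith [hlow v]
      _ = ε * ((1 + t) * (1 + n * n)) * (v ⬝ᵥ S₀ *ᵥ v) := by ring
      _ = _ := by rw [h2, one_mul]
  have h4 := (abs_le.1 hdiff).1
  rw [hsplit]
  linarith

theorem Matrix.IsSymm.posDef_of_coercive {ι : Type*} [Fintype ι] [DecidableEq ι]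
    {S : Matrix ι ι ℝ} (hS : S.IsSymm) {ε : ℝ} (hε : 0 < ε)
    (h : ∀ v : ι → ℝ, ε * (v ⬝ᵥ v) ≤ v ⬝ᵥ S *ᵥ v) : S.PosDef := by
  refine posDef_iff_dotProduct_mulVec.2
    ⟨(conjTranspose_eq_transpose_of_trivial S).trans hS, fun x hx => ?_⟩
  have := dotProduct_star_self_pos_iff.2 hx
  rw [star_trivial] at this ⊢
  exact (mul_pos hε this).trans_le (h x)

theorem Matrix.IsSymm.eq_zero_of_quadratic {ι : Type*} [Fintype ι] [DecidableEq ι]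
    {D : Matrix ι ι ℝ} (hD : D.IsSymm) (h : ∀ v : ι → ℝ, v ⬝ᵥ D *ᵥ v = 0) : D = 0 := by
  ext i j
  have h1 := h (Pi.single i 1 + Pi.single j 1)
  have h2 := h (Pi.single i 1)
  have h3 := h (Pi.single j 1)
  have h4 := hD.apply i j
  simp only [mulVec_add, dotProduct_add, add_dotProduct, single_one_dotProduct,
    mulVec_single_one, col_apply] at h1 h2 h3
  rw [zero_apply]
  linarith

end Coercivity

/-! ### The critical equation in matrix form and its derivative. -/

section Criticality

open Matrix

variable {d : ℕ}

theorem quadRatio_homogPoly_mul (c : ℝ) (C : ShapeSpace d) (i j : Fin d ⊕ Unit)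
    (y : EuclideanSpace ℝ (Fin d)) :
    quadRatio c (1 * (homogPoly d i * homogPoly d j)) 1 C y
      = homog y i * homog y j / (c + homog y ⬝ᵥ of C *ᵥ homog y) := by
  simp only [quadRatio, map_mul, one_mul, pow_one, eval_homogPoly]

/-- The matrix `a ∫ z z' / (c + z' C z)`, where `z = (y, 1)`. -/
noncomputable def weightedMoments (a c : ℝ) (Q : Measure (EuclideanSpace ℝ (Fin d)))
    (C : ShapeSpace d) : Matrix (Fin d ⊕ Unit) (Fin d ⊕ Unit) ℝ :=
  of fun i j => a * ∫ y, quadRatio c (1 * (homogPoly d i * homogPoly d j)) 1 C y ∂Q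

theorem isSymm_weightedMoments (a c : ℝ) (Q : Measure (EuclideanSpace ℝ (Fin d)))
    (C : ShapeSpace d) : (weightedMoments a c Q C).IsSymm := by
  ext i j
  simp only [weightedMoments, transpose_apply, of_apply, mul_comm (homogPoly d i)]

theorem quadratic_div_eq_sum (c : ℝ) (C : ShapeSpace d)
    (B : Matrix (Fin d ⊕ Unit) (Fin d ⊕ Unit) ℝ) (y : EuclideanSpace ℝ (Fin d)) :
    (homog y ⬝ᵥ B *ᵥ homog y) / (c + homog y ⬝ᵥ of C *ᵥ homog y) = ∑ i, ∑ j,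
      B i j * quadRatio c (1 * (homogPoly d i * homogPoly d j)) 1 C y := by
  rw [show B = of fun i j => B i j from rfl, dotProduct_of_mulVec_eq_sum, Finset.sum_div]
  refine Finset.sum_congr rfl fun i _ => ?_
  rw [Finset.sum_div]
  refine Finset.sum_congr rfl fun j _ => ?_
  rw [quadRatio_homogPoly_mul, mul_div_assoc, of_apply]

theorem quadratic_sq_div_eq_sum (c : ℝ) (C H : ShapeSpace d) (y : EuclideanSpace ℝ (Fin d)) :
    (homog y ⬝ᵥ of H *ᵥ homog y) ^ 2 / (c + homog y ⬝ᵥ of C *ᵥ homog y) ^ 2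
      = ∑ i, ∑ j, ∑ p, ∑ q, H i j * (H p q * quadRatio c
        (1 * (homogPoly d i * homogPoly d j) * (homogPoly d p * homogPoly d q)) 2 C y) := by
  rw [sq, dotProduct_of_mulVec_eq_sum, Finset.sum_mul, Finset.sum_div]
  refine Finset.sum_congr rfl fun i _ => ?_
  rw [Finset.sum_mul, Finset.sum_div]
  refine Finset.sum_congr rfl fun j _ => ?_
  rw [Finset.mul_sum, Finset.sum_div]
  refine Finset.sum_congr rfl fun p _ => ?_
  rw [Finset.mul_sum, Finset.sum_div]
  refine Finset.sum_congr rfl fun q _ => ?_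
  simp only [quadRatio, map_mul, one_mul, eval_homogPoly]
  ring

theorem integrable_quadratic_div {c ε : ℝ} (hc : 0 < c) (hε : 0 < ε) {C : ShapeSpace d}
    (hC : C ∈ coerciveSet d ε) (Q : Measure (EuclideanSpace ℝ (Fin d))) [IsFiniteMeasure Q]
    (B : Matrix (Fin d ⊕ Unit) (Fin d ⊕ Unit) ℝ) :
    Integrable (fun y => (homog y ⬝ᵥ B *ᵥ homog y) / (c + homog y ⬝ᵥ of C *ᵥ homog y)) Q := by
  simp only [quadratic_div_eq_sum]
  exact integrable_sum_sum (f := fun i j y =>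
    B i j * quadRatio c (1 * (homogPoly d i * homogPoly d j)) 1 C y) fun i j =>
    ((IsNumerator.one.mul_homogPoly i j).integrable_quadRatio hc hε hC Q).const_mul _

theorem integrable_quadratic_sq_div {c ε : ℝ} (hc : 0 < c) (hε : 0 < ε) {C : ShapeSpace d}
    (hC : C ∈ coerciveSet d ε) (Q : Measure (EuclideanSpace ℝ (Fin d))) [IsFiniteMeasure Q]
    (H : ShapeSpace d) : Integrable (fun y => (homog y ⬝ᵥ of H *ᵥ homog y) ^ 2 /
      (c + homog y ⬝ᵥ of C *ᵥ homog y) ^ 2) Q := by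
  simp only [quadratic_sq_div_eq_sum]
  exact integrable_sum_sum fun i j => integrable_sum_sum (f := fun p q y => H i j * (H p q *
    quadRatio c (1 * (homogPoly d i * homogPoly d j) * (homogPoly d p * homogPoly d q)) 2 C y))
    fun p q => ((((IsNumerator.one.mul_homogPoly i j).mul_homogPoly p q).integrable_quadRatio
      hc hε hC Q).const_mul _).const_mul _

theorem sum_mul_weightedMoments {a c ε : ℝ} (hc : 0 < c) (hε : 0 < ε) {C : ShapeSpace d}
    (hC : C ∈ coerciveSet d ε) (Q : Measure (EuclideanSpace ℝ (Fin d))) [IsFiniteMeasure Q]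
    (B : Matrix (Fin d ⊕ Unit) (Fin d ⊕ Unit) ℝ) :
    ∑ i, ∑ j, B i j * weightedMoments a c Q C i j
      = a * ∫ y, (homog y ⬝ᵥ B *ᵥ homog y) / (c + homog y ⬝ᵥ of C *ᵥ homog y) ∂Q := by
  have h := integral_sum_sum (μ := Q) (f := fun i j y =>
    B i j * quadRatio c (1 * (homogPoly d i * homogPoly d j)) 1 C y)
    fun i j => ((IsNumerator.one.mul_homogPoly i j).integrable_quadRatio hc hε hC Q).const_mul _
  simp only [quadratic_div_eq_sum, h, Finset.mul_sum, integral_const_mul, weightedMoments, of_apply]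
  exact Finset.sum_congr rfl fun i _ => Finset.sum_congr rfl fun j _ => by ring

theorem dotProduct_weightedMoments_mulVec {a c ε : ℝ} (hc : 0 < c) (hε : 0 < ε) {C : ShapeSpace d}
    (hC : C ∈ coerciveSet d ε) (Q : Measure (EuclideanSpace ℝ (Fin d))) [IsFiniteMeasure Q]
    (h : Fin d ⊕ Unit → ℝ) :
    h ⬝ᵥ weightedMoments a c Q C *ᵥ h
      = a * ∫ y, (h ⬝ᵥ homog y) ^ 2 / (c + homog y ⬝ᵥ of C *ᵥ homog y) ∂Q := by
  have h1 := sum_mul_weightedMoments (a := a) hc hε hC Q (vecMulVec h h)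
  have h2 : ∀ z : Fin d ⊕ Unit → ℝ, z ⬝ᵥ vecMulVec h h *ᵥ z = (h ⬝ᵥ z) ^ 2 := fun z => by
    rw [vecMulVec_mulVec, dotProduct_smul, dotProduct_comm z h, sq]
    rfl
  simp only [h2] at h1
  rw [← h1, show weightedMoments a c Q C = of fun i j => weightedMoments a c Q C i j from rfl,
    dotProduct_of_mulVec_eq_sum]
  exact Finset.sum_congr rfl fun i _ => Finset.sum_congr rfl fun j _ => by
    rw [vecMulVec_apply, mul_comm]; rfl

/-- Equality of quadratic forms gives equality of matrices because both sides are symmetric; for C⁻¹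
this uses the symmetry of C. -/
theorem isCriticalShape_iff_weightedMoments {a c ε : ℝ} (hc : 0 < c) (hε : 0 < ε)
    {C : ShapeSpace d} (hC : C ∈ coerciveSet d ε) (hCs : (of C).IsSymm)
    (Q : Measure (EuclideanSpace ℝ (Fin d))) [IsFiniteMeasure Q] :
    IsCriticalShape a c Q homog (of C) ↔ weightedMoments a c Q C = (of C)⁻¹ := by
  simp only [IsCriticalShape, ← dotProduct_weightedMoments_mulVec hc hε hC]
  refine ⟨fun h => sub_eq_zero.1 (IsSymm.eq_zero_of_quadratic ?_ fun v => ?_), fun h v => by rw [h]⟩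
  · rw [IsSymm, transpose_sub, isSymm_weightedMoments, transpose_nonsing_inv, hCs]
  · rw [sub_mulVec, dotProduct_sub, h v, sub_self]

/-- The derivative of the matrix `a ∫ z z' / (c + z' C z)` in the direction `H`, up to sign. -/
noncomputable def weightedMomentsDeriv (a c : ℝ) (Q : Measure (EuclideanSpace ℝ (Fin d)))
    (C : ShapeSpace d) (H : ShapeSpace d) : Matrix (Fin d ⊕ Unit) (Fin d ⊕ Unit) ℝ :=
  of fun i j => a * ∑ p, ∑ q, H p q * ∫ y, quadRatio c
    (1 * (homogPoly d i * homogPoly d j) * (homogPoly d p * homogPoly d q)) 2 C y ∂Q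

theorem isSymm_weightedMomentsDeriv (a c : ℝ) (Q : Measure (EuclideanSpace ℝ (Fin d)))
    (C H : ShapeSpace d) : (weightedMomentsDeriv a c Q C H).IsSymm := by
  ext i j
  simp only [weightedMomentsDeriv, transpose_apply, of_apply, mul_comm (homogPoly d i)]

theorem sum_mul_weightedMomentsDeriv {a c ε : ℝ} (hc : 0 < c) (hε : 0 < ε) {C : ShapeSpace d}
    (hC : C ∈ coerciveSet d ε) (Q : Measure (EuclideanSpace ℝ (Fin d))) [IsFiniteMeasure Q]
    (H : ShapeSpace d) :
    ∑ i, ∑ j, H i j * weightedMomentsDeriv a c Q C H i j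
      = a * ∫ y, (homog y ⬝ᵥ of H *ᵥ homog y) ^ 2 /
        (c + homog y ⬝ᵥ of C *ᵥ homog y) ^ 2 ∂Q := by
  have hint : ∀ i j p q, Integrable (fun y => H i j * (H p q * quadRatio c
      (1 * (homogPoly d i * homogPoly d j) * (homogPoly d p * homogPoly d q)) 2 C y)) Q :=
    fun i j p q => ((((IsNumerator.one.mul_homogPoly i j).mul_homogPoly p q).integrable_quadRatio
      hc hε hC Q).const_mul _).const_mul _
  simp only [quadratic_sq_div_eq_sum]
  rw [integral_sum_sum fun i j => integrable_sum_sum (hint i j)]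
  simp only [fun i j => integral_sum_sum (hint i j), integral_const_mul, weightedMomentsDeriv,
    of_apply, Finset.mul_sum]
  exact Finset.sum_congr rfl fun i _ => Finset.sum_congr rfl fun j _ =>
    Finset.sum_congr rfl fun p _ => Finset.sum_congr rfl fun q _ => by ring

end Criticality

/-! ### Injectivity of the linearized critical equation. -/

section Nondegeneracy

open Matrix

variable {d : ℕ}

/-- The linearization of the critical equation in the shape matrix is injective. -/
theorem eq_zero_of_weightedMoments_mul_eq {a c ε : ℝ} (ha : 0 < a) (hc : 0 < c) (hε : 0 < ε)
    {C : ShapeSpace d} (hC : C ∈ coerciveSet d ε) (hCs : (of C).IsSymm)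
    (Q : Measure (EuclideanSpace ℝ (Fin d))) [IsFiniteMeasure Q]
    (hQ : ∀ h : Fin d ⊕ Unit → ℝ, h ≠ 0 → ¬ ∀ᵐ y ∂Q, h ⬝ᵥ homog y = 0)
    (hcrit : weightedMoments a c Q C * of C = 1) {H : ShapeSpace d}
    (hH : weightedMoments a c Q C * of H = weightedMomentsDeriv a c Q C H * of C) : H = 0 := by
  set M := weightedMoments a c Q C with hM
  set K := weightedMomentsDeriv a c Q C H with hK
  have hcrit' : of C * M = 1 := mul_eq_one_comm.1 hcrit
  have hMs : Mᵀ = M := isSymm_weightedMoments a c Q C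
  have hKs : Kᵀ = K := isSymm_weightedMomentsDeriv a c Q C H
  have hCpos : (of C).PosDef := hCs.posDef_of_coercive hε hC
  have hMinv : (of C)⁻¹ = M := inv_eq_left_inv hcrit
  have hMpos : M.PosDef := hMinv ▸ hCpos.inv
  have hH1 : of H = of C * K * of C := by
    rw [mul_assoc, ← hH, ← mul_assoc, hcrit', one_mul]
  -- H ranges over all matrices; the equation H = CKC with C and K symmetric forces it to be
  -- symmetric.
  have hHs : (of H)ᵀ = of H := by
    rw [hH1, transpose_mul, transpose_mul, hKs, hCs, mul_assoc]
  have hK1 : K = M * of H * M := by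
    rw [hH, mul_assoc, hcrit', mul_one]
  have hquad : ∀ z : Fin d ⊕ Unit → ℝ,
      z ⬝ᵥ (of H * M * of H) *ᵥ z = (of H *ᵥ z) ⬝ᵥ M *ᵥ (of H *ᵥ z) := fun z => by
    rw [← mulVec_mulVec, ← mulVec_mulVec, dotProduct_mulVec, ← mulVec_transpose, hHs]
  have hnn : ∀ z : Fin d ⊕ Unit → ℝ, 0 ≤ z ⬝ᵥ (of H * M * of H) *ᵥ z := fun z => by
    rw [hquad]
    exact hMpos.quadratic_nonneg _
  -- Pairing K = MHM with H gives tr(HMHM), which is also the pairing of HMH with M. Both pairings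
  -- are integrals over Q.
  have htrace : ∑ i, ∑ j, H i j * K i j = ∑ i, ∑ j, (of H * M * of H) i j * M i j := by
    have h1 : ∀ A B : Matrix (Fin d ⊕ Unit) (Fin d ⊕ Unit) ℝ, B.IsSymm →
        ∑ i, ∑ j, A i j * B i j = (A * B).trace := fun A B hB => by
      simp only [trace, diag, mul_apply]
      exact Finset.sum_congr rfl fun i _ => Finset.sum_congr rfl fun j _ => by rw [hB.apply i j]
    refine (h1 (of H) K hKs).trans ((h1 _ M hMs).trans ?_).symm
    rw [hK1, ← mul_assoc, ← mul_assoc]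
  have hu := fun y : EuclideanSpace ℝ (Fin d) => add_quadratic_pos hc hε hC (homog y)
  have hint : ∫ y, (homog y ⬝ᵥ (of H * M * of H) *ᵥ homog y) /
        (c + homog y ⬝ᵥ of C *ᵥ homog y) ∂Q
      = ∫ y, (homog y ⬝ᵥ of H *ᵥ homog y) ^ 2 / (c + homog y ⬝ᵥ of C *ᵥ homog y) ^ 2 ∂Q := by
    have h2 := sum_mul_weightedMoments (a := a) hc hε hC Q (of H * M * of H)
    have h3 := sum_mul_weightedMomentsDeriv (a := a) hc hε hC Q H
    exact mul_left_cancel₀ ha.ne' (h2.symm.trans (htrace.symm.trans h3))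
  have hi1 : Integrable (fun y => (homog y ⬝ᵥ (of H * M * of H) *ᵥ homog y) /
      (c + homog y ⬝ᵥ of C *ᵥ homog y)) Q :=
    integrable_quadratic_div hc hε hC Q _
  have hi2 : Integrable (fun y => (homog y ⬝ᵥ of H *ᵥ homog y) ^ 2 /
      (c + homog y ⬝ᵥ of C *ᵥ homog y) ^ 2) Q :=
    integrable_quadratic_sq_div hc hε hC Q _
  -- Cauchy–Schwarz gives (z'Hz)² ≤ (z'HMHz)(z'Cz), and z'Cz = u - c, where u is the denominator,
  -- leaves the gain c z'HMHz/u². The right side integrates to zero, so Hz = 0 almost everywhere.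
  have hkey : ∀ y : EuclideanSpace ℝ (Fin d), c * ((homog y ⬝ᵥ (of H * M * of H) *ᵥ homog y) /
      (c + homog y ⬝ᵥ of C *ᵥ homog y) ^ 2) ≤ (homog y ⬝ᵥ (of H * M * of H) *ᵥ homog y) /
        (c + homog y ⬝ᵥ of C *ᵥ homog y) - (homog y ⬝ᵥ of H *ᵥ homog y) ^ 2 /
      (c + homog y ⬝ᵥ of C *ᵥ homog y) ^ 2 := fun y => by
    have h4 := hCpos.dotProduct_sq_le (of H *ᵥ homog y) (homog y)
    rw [hMinv, ← hquad, dotProduct_comm (of H *ᵥ homog y)] at h4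
    have h5 := hu y
    rw [div_sub_div _ _ h5.ne' (pow_pos h5 2).ne', ← mul_div_assoc,
      div_le_div_iff₀ (pow_pos h5 2) (mul_pos h5 (pow_pos h5 2))]
    have h6 : 0 < (c + homog y ⬝ᵥ of C *ᵥ homog y) ^ 3 := pow_pos h5 3
    nlinarith [mul_le_mul_of_nonneg_left h4 h6.le]
  have hzero : ∫ y, ((homog y ⬝ᵥ (of H * M * of H) *ᵥ homog y) /
        (c + homog y ⬝ᵥ of C *ᵥ homog y) - (homog y ⬝ᵥ of H *ᵥ homog y) ^ 2 /
      (c + homog y ⬝ᵥ of C *ᵥ homog y) ^ 2) ∂Q = 0 := by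
    rw [integral_sub hi1 hi2, hint, sub_self]
  have hnn' : ∀ y : EuclideanSpace ℝ (Fin d), 0 ≤ c * ((homog y ⬝ᵥ (of H * M * of H) *ᵥ homog y) /
      (c + homog y ⬝ᵥ of C *ᵥ homog y) ^ 2) := fun y =>
    mul_nonneg hc.le (div_nonneg (hnn _) (sq_nonneg _))
  rw [integral_eq_zero_iff_of_nonneg (fun y => (hnn' y).trans (hkey y)) (hi1.sub hi2)] at hzero
  have hae : ∀ᵐ y ∂Q, of H *ᵥ homog y = 0 := by
    filter_upwards [hzero] with y hy
    by_contra hne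
    have h7 := (posDef_iff_dotProduct_mulVec.1 hMpos).2 hne
    rw [star_trivial, ← hquad] at h7
    have h8 : 0 < c * ((homog y ⬝ᵥ (of H * M * of H) *ᵥ homog y) /
      (c + homog y ⬝ᵥ of C *ᵥ homog y) ^ 2) := mul_pos hc (div_pos h7 (pow_pos (hu y) 2))
    exact absurd (hkey y) (by rw [show _ = (0 : ℝ) from hy]; exact not_le.2 h8)
  funext i
  by_contra hi
  refine hQ (H i) hi ?_
  filter_upwards [hae] with y hy
  exact congrFun hy i

end Nondegeneracy

/-! ### Reading off location and scatter smoothly. -/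

section LocationScatter

open Matrix

variable {d : ℕ}

/-- The pair `(μ, Σ)` with `A = [[Σ + μ μ', μ], [μ', 1]]`. -/
noncomputable def locationScatter (A : Matrix (Fin d ⊕ Unit) (Fin d ⊕ Unit) ℝ) :
    EuclideanSpace ℝ (Fin d) × Matrix (Fin d) (Fin d) ℝ :=
  (WithLp.toLp 2 fun i => A (Sum.inl i) (Sum.inr ()),
    of fun i j => A (Sum.inl i) (Sum.inl j)
      - A (Sum.inl i) (Sum.inr ()) * A (Sum.inl j) (Sum.inr ()))

theorem isSymm_locationScatter_snd {A : Matrix (Fin d ⊕ Unit) (Fin d ⊕ Unit) ℝ}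
    (hA : A.IsSymm) : (locationScatter A).2.IsSymm := by
  ext i j
  simp only [locationScatter, transpose_apply, of_apply]
  rw [hA.apply (Sum.inl i) (Sum.inl j), mul_comm]

theorem contDiffAt_matrix {V : Type*} [NormedAddCommGroup V] [NormedSpace ℝ V] {m n : Type*}
    [Fintype m] [Fintype n] {k : WithTop ℕ∞} {f : V → Matrix m n ℝ} {x : V}
    (hf : ∀ i j, ContDiffAt ℝ k (fun x => f x i j) x) : ContDiffAt ℝ k f x := by
  classical
  have h : f = fun x => ∑ i, ∑ j, f x i j • Matrix.single i j (1 : ℝ) := by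
    funext x
    conv_lhs => rw [matrix_eq_sum_single (f x)]
    simp only [smul_single, smul_eq_mul, mul_one]
  rw [h]
  exact ContDiffAt.sum fun i _ => ContDiffAt.sum fun j _ => (hf i j).smul contDiffAt_const

theorem contDiffAt_locationScatter {V : Type*} [NormedAddCommGroup V] [NormedSpace ℝ V]
    {k : WithTop ℕ∞} {A : V → Matrix (Fin d ⊕ Unit) (Fin d ⊕ Unit) ℝ} {x : V}
    (hA : ∀ i j, ContDiffAt ℝ k (fun x => A x i j) x) :
    ContDiffAt ℝ k (fun x => locationScatter (A x)) x := by
  refine ContDiffAt.prodMk ?_ (contDiffAt_matrix fun i j => ?_)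
  · exact (contDiffAt_euclidean (n := k)).2 fun i => hA _ _
  · exact (hA _ _).sub ((hA _ _).mul (hA _ _))

end LocationScatter

/-! ### The critical equation on the Banach space. -/

section ShapeEquation

open Matrix

variable {d : ℕ}

/-- The functional `Q ↦ ∫ z_i z_j / (c + z' C z) dQ` on the space `SetNormSpace r d`. -/
noncomputable def momentFunctional (r : ℕ) (c : ℝ) (i j : Fin d ⊕ Unit) (C : ShapeSpace d) :
    SetNormSpace r d →L[ℝ] ℝ :=
  completionExtension
    (setNormFunctional r (quadRatio c (1 * (homogPoly d i * homogPoly d j)) 1 C))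

/-- The matrix `a ∫ z z' / (c + z' C z)` at a point `(Q, C)`. -/
noncomputable def momentMatrix (r : ℕ) (a c : ℝ) (u : SetNormSpace r d × ShapeSpace d) :
    Matrix (Fin d ⊕ Unit) (Fin d ⊕ Unit) ℝ :=
  of fun i j => a * momentFunctional r c i j u.2 u.1

/-- The function `(Q, C) ↦ a ∫ z z' / (c + z' C z) dQ · C - I`, whose zeros are the critical
points. -/
noncomputable def shapeEquation (r : ℕ) (a c : ℝ) (u : SetNormSpace r d × ShapeSpace d) :
    ShapeSpace d :=
  fun i l => ∑ j, momentMatrix r a c u i j * u.2 j l - (1 : Matrix _ _ ℝ) i l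

/-- This holds at every point of the Banach space, not only at laws, and keeps the scatter component
symmetric on the whole neighbourhood. -/
theorem isSymm_momentMatrix (r : ℕ) (a c : ℝ) (u : SetNormSpace r d × ShapeSpace d) :
    (momentMatrix r a c u).IsSymm := by
  ext i j
  simp only [momentMatrix, momentFunctional, transpose_apply, of_apply, mul_comm (homogPoly d i)]

theorem shapeEquation_eq_zero_iff (r : ℕ) (a c : ℝ) (u : SetNormSpace r d × ShapeSpace d) :
    shapeEquation r a c u = 0 ↔ momentMatrix r a c u * of u.2 = 1 := by
  rw [← sub_eq_zero (b := (1 : Matrix (Fin d ⊕ Unit) (Fin d ⊕ Unit) ℝ))]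
  exact Iff.rfl

variable {a c ε : ℝ} {r : ℕ}

theorem momentMatrix_lawPoint (hc : 0 < c) (hε : 0 < ε) {C : ShapeSpace d}
    (hC : C ∈ coerciveSet d ε) (hr : 2 ≤ r)
    (Q : ProbabilityMeasure (EuclideanSpace ℝ (Fin d))) :
    momentMatrix r a c (lawPoint r Q, C) = weightedMoments a c Q C := by
  ext i j
  simp only [momentMatrix, weightedMoments, of_apply, momentFunctional, lawPoint,
    completionExtension_coe]
  rw [setNormFunctional_of ((IsNumerator.one.mul_homogPoly i j).hasPositivityLevels hc hε hC hr)]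

theorem contDiffAt_momentMatrix (hc : 0 < c) (hε : 0 < ε) {s : Set (ShapeSpace d)}
    (hs : IsOpen s) (hconv : Convex ℝ s) (hsub : s ⊆ coerciveSet d ε) {k : ℕ}
    (hk : 2 * (1 + k + 1) ≤ r) {u : SetNormSpace r d × ShapeSpace d} (hu : u.2 ∈ s)
    (i j : Fin d ⊕ Unit) : ContDiffAt ℝ k (fun u => momentMatrix r a c u i j) u := by
  have h1 : ContDiffAt ℝ k (fun C => setNormFunctional r
      (quadRatio c (1 * (homogPoly d i * homogPoly d j)) 1 C)) u.2 :=
    (contDiffOn_setNormFunctional hc hε hs hconv hsub k hk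
      (IsNumerator.one.mul_homogPoly i j)).contDiffAt (hs.mem_nhds hu)
  have h2 : ContDiffAt ℝ k (momentFunctional r c i j) u.2 :=
    (completionExtension (E := SignedMeasureE r d)).contDiff.contDiffAt.comp u.2 h1
  have h3 : ContDiffAt ℝ k (fun u : SetNormSpace r d × ShapeSpace d =>
      momentFunctional r c i j u.2) u := h2.comp u contDiffAt_snd
  exact contDiffAt_const.mul (h3.clm_apply contDiffAt_fst)

theorem contDiffAt_shapeEquation (hc : 0 < c) (hε : 0 < ε) {s : Set (ShapeSpace d)}
    (hs : IsOpen s) (hconv : Convex ℝ s) (hsub : s ⊆ coerciveSet d ε) {k : ℕ}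
    (hk : 2 * (1 + k + 1) ≤ r) {u : SetNormSpace r d × ShapeSpace d} (hu : u.2 ∈ s) :
    ContDiffAt ℝ k (shapeEquation r a c) u := by
  refine contDiffAt_pi.2 fun i => contDiffAt_pi.2 fun l => ContDiffAt.sub ?_ contDiffAt_const
  refine ContDiffAt.sum fun j _ =>
    (contDiffAt_momentMatrix hc hε hs hconv hsub hk hu i j).mul ?_
  exact (entryCLM j l).contDiff.contDiffAt.comp u contDiffAt_snd

theorem hasFDerivAt_weightedMoments (hc : 0 < c) (hε : 0 < ε) {s : Set (ShapeSpace d)}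
    (hs : IsOpen s) (hsub : s ⊆ coerciveSet d ε) (Q : Measure (EuclideanSpace ℝ (Fin d)))
    [IsFiniteMeasure Q] {C : ShapeSpace d} (hC : C ∈ s) (i j : Fin d ⊕ Unit) :
    ∃ D : ShapeSpace d →L[ℝ] ℝ, HasFDerivAt (fun C => weightedMoments a c Q C i j) D C ∧
      ∀ H, D H = -weightedMomentsDeriv a c Q C H i j := by
  refine ⟨_, (hasFDerivAt_integral_quadRatio hc hε hs hsub Q
    (IsNumerator.one.mul_homogPoly i j) hC).const_mul a, fun H => ?_⟩
  simp only [_root_.smul_apply, _root_.sum_apply, smul_eq_mul, entryCLM_apply,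
    weightedMomentsDeriv, of_apply, ← mul_neg, ← Finset.sum_neg_distrib]
  congr 1
  refine Finset.sum_congr rfl fun p _ => Finset.sum_congr rfl fun q _ => ?_
  simp only [zero_add, Nat.cast_one, Nat.reduceAdd]
  ring

/-- At a law the equation is given by genuine integrals near C, so its partial derivative is found
entrywise from the product rule and uniqueness of derivatives. -/
theorem fderiv_shapeEquation_inr (hc : 0 < c) (hε : 0 < ε) {s : Set (ShapeSpace d)}
    (hs : IsOpen s) (hsub : s ⊆ coerciveSet d ε) (hr : 2 ≤ r)
    (Q : ProbabilityMeasure (EuclideanSpace ℝ (Fin d))) {C : ShapeSpace d} (hC : C ∈ s)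
    (hdiff : DifferentiableAt ℝ (shapeEquation r a c) (lawPoint r Q, C)) (H : ShapeSpace d) :
    of (fderiv ℝ (shapeEquation r a c) (lawPoint r Q, C) (0, H))
      = weightedMoments a c Q C * of H
        - weightedMomentsDeriv a c (Q : Measure (EuclideanSpace ℝ (Fin d))) C H * of C := by
  ext i l
  have h1 : HasFDerivAt (fun C' => shapeEquation r a c (lawPoint r Q, C'))
      (fderiv ℝ (shapeEquation r a c) (lawPoint r Q, C) ∘L .inr ℝ _ _) C :=
    hdiff.hasFDerivAt.comp C (hasFDerivAt_prodMk_right (lawPoint r Q) C)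
  have h2 := (entryCLM i l).hasFDerivAt.comp C h1
  choose D hD hDH using fun j => hasFDerivAt_weightedMoments (a := a) hc hε hs hsub
    (Q : Measure (EuclideanSpace ℝ (Fin d))) hC i j
  have h3 : HasFDerivAt (fun C' : ShapeSpace d => ∑ j, weightedMoments a c
      (Q : Measure (EuclideanSpace ℝ (Fin d))) C' i j * C' j l - (1 : Matrix _ _ ℝ) i l)
      (∑ j, (weightedMoments a c (Q : Measure (EuclideanSpace ℝ (Fin d))) C i j • entryCLM j l
        + C j l • D j)) C :=
    (HasFDerivAt.fun_sum fun j _ => (hD j).mul (entryCLM j l).hasFDerivAt).sub_const _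
  have h4 := h2.unique (h3.congr_of_eventuallyEq (by
    filter_upwards [hs.mem_nhds hC] with C' hC'
    simp only [Function.comp_apply, entryCLM_apply, shapeEquation,
      momentMatrix_lawPoint hc hε (hsub hC') hr]))
  refine (congrArg (fun L : ShapeSpace d →L[ℝ] ℝ => L H) h4).trans ?_
  simp only [_root_.sum_apply, _root_.add_apply, _root_.smul_apply, smul_eq_mul, hDH,
    entryCLM_apply, Matrix.sub_apply, mul_apply, of_apply, ← Finset.sum_sub_distrib]
  exact Finset.sum_congr rfl fun j _ => by ring

end ShapeEquation

/-! ### The implicit function theorem and the conclusion. -/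

section Main

open Matrix Topology

variable {d : ℕ}

theorem isInvertible_of_injective {V : Type*} [NormedAddCommGroup V] [NormedSpace ℝ V]
    [FiniteDimensional ℝ V] {L : V →L[ℝ] V} (hL : ∀ x, L x = 0 → x = 0) : L.IsInvertible := by
  have hinj : Function.Injective (L : V →ₗ[ℝ] V) :=
    (injective_iff_map_eq_zero (L : V →ₗ[ℝ] V)).2 hL
  exact ⟨(LinearEquiv.ofInjectiveEndo (L : V →ₗ[ℝ] V) hinj).toContinuousLinearEquiv,
    ContinuousLinearMap.ext fun x => rfl⟩

theorem Matrix.PosDef.eventually_posDef {X ι : Type} [TopologicalSpace X] [Fintype ι]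
    [DecidableEq ι] {S : X → Matrix ι ι ℝ} {x : X} (hx : (S x).PosDef)
    (hcont : ∀ i j, ContinuousAt (fun x => S x i j) x) (hS : ∀ x, (S x).IsSymm) :
    ∀ᶠ y in 𝓝 x, (S y).PosDef := by
  obtain ⟨ε, hε, h⟩ := hx.exists_coercive
  have : ∀ᶠ y in 𝓝 x, ∀ i j, |S y i j - S x i j| < ε :=
    Filter.eventually_all.2 fun i => Filter.eventually_all.2 fun j =>
      (Metric.continuousAt_iff'.1 (hcont i j)) ε hε
  filter_upwards [this] with y hy
  exact (hS y).posDef_of_coercive hε (h _ hy)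

theorem isTLocationScatter_of_weightedMoments {ν ε : ℝ} (hν : 1 < ν) (hε : 0 < ε)
    {Q : ProbabilityMeasure (EuclideanSpace ℝ (Fin d))} (hQ : Q ∈ lawsV d (ν + d))
    {C : ShapeSpace d} (hC : C ∈ coerciveSet d ε)
    (h : weightedMoments (ν + d) (ν - 1) (Q : Measure (EuclideanSpace ℝ (Fin d))) C * of C = 1) :
    IsTLocationScatter ν Q (locationScatter
      (weightedMoments (ν + d) (ν - 1) (Q : Measure (EuclideanSpace ℝ (Fin d))) C)) := by
  set M := weightedMoments (ν + d) (ν - 1) (Q : Measure (EuclideanSpace ℝ (Fin d))) C with hM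
  have hinv : (of C)⁻¹ = M := inv_eq_left_inv h
  -- The implicit function need not take symmetric values a priori; a solution at a law is symmetric
  -- as the inverse of M.
  have hCs : (of C).IsSymm := by
    have h1 : of C = M⁻¹ := (inv_eq_right_inv h).symm
    rw [IsSymm, h1, transpose_nonsing_inv, isSymm_weightedMoments]
  exact IsCriticalShape.isTLocationScatter hν Q
    (fun v hv => not_ae_dotProduct_homog_eq_zero hν hQ hv) (hCs.posDef_of_coercive hε hC) hinv
    ((isCriticalShape_iff_weightedMoments (sub_pos.2 hν) hε hC hCs _).2 hinv.symm)

end Main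

/-- For every law `P` in `𝒱_{d,ν+d}` the `t_ν` location-scatter functional is Fréchet `C^k` at `P`
for the norm `‖·‖_{ℰ(2k+4,d)}`: there are an open neighbourhood `U` of `P` in the Banach space
of that norm and a `C^k` map `T` from `U` into `ℝᵈ × 𝒫_d` such that every law `Q` in `U` belongs to
`𝒱_{d,ν+d}` and has `T(Q) = (μ_ν(Q), Σ_ν(Q))`. -/
theorem corollary8p1 (d k : ℕ) (hd : 1 ≤ d) (hk : 1 ≤ k) (ν : ℝ) (hν : 1 < ν)
    (P : MeasureTheory.ProbabilityMeasure (EuclideanSpace ℝ (Fin d)))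
    (hP : P ∈ lawsV d (ν + d)) :
    ∃ (U : Set (SetNormSpace (2 * k + 4) d))
      (T : SetNormSpace (2 * k + 4) d →
        EuclideanSpace ℝ (Fin d) × Matrix (Fin d) (Fin d) ℝ),
      IsOpen U ∧ lawPoint (2 * k + 4) P ∈ U ∧
      ContDiffOn ℝ (k : ℕ∞) T U ∧
      (∀ φ ∈ U, (T φ).2.PosDef) ∧
      ∀ Q : MeasureTheory.ProbabilityMeasure (EuclideanSpace ℝ (Fin d)),
        lawPoint (2 * k + 4) Q ∈ U →
          Q ∈ lawsV d (ν + d) ∧ IsTLocationScatter ν Q (T (lawPoint (2 * k + 4) Q)) := by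
  have ha : 0 < ν + d := by positivity
  have hc : 0 < ν - 1 := sub_pos.2 hν
  have hr : 2 ≤ 2 * k + 4 := by omega
  -- The moment entries have exponent 1, k derivatives add k, and continuity of the last adds 1:
  -- this is where degree 2k + 4 is spent.
  have hkr : 2 * (1 + k + 1) ≤ 2 * k + 4 := by omega
  obtain ⟨b, hab, hb⟩ := exists_measureReal_flat_le hν hP
  obtain ⟨C, hCpos, hCcrit⟩ := exists_isCriticalShape ha hc continuous_homog.measurable hab hb
  obtain ⟨ε, hε, hcoer⟩ := hCpos.exists_coercive
  set s : Set (ShapeSpace d) := Metric.ball (fun i j => C i j) ε with hs_def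
  have hs : IsOpen s := Metric.isOpen_ball
  have hconv : Convex ℝ s := convex_ball _ _
  have hsub : s ⊆ coerciveSet d ε := fun C' hC' => hcoer _ fun i j =>
    lt_of_le_of_lt ((dist_le_pi_dist (C' i) (C i) j).trans
      (dist_le_pi_dist C' (fun i j => C i j) i)) hC'
  set C₀ : ShapeSpace d := fun i j => C i j with hC₀
  have hC₀s : C₀ ∈ s := Metric.mem_ball_self hε
  have hC₀symm : (Matrix.of C₀).IsSymm :=
    (Matrix.conjTranspose_eq_transpose_of_trivial C).symm.trans hCpos.isHermitian
  have hdet : IsUnit (Matrix.of C₀).det := hCpos.det_pos.ne'.isUnit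
  set p := lawPoint (2 * k + 4) P with hp
  set F := shapeEquation (d := d) (2 * k + 4) (ν + d) (ν - 1) with hF
  have hmom : weightedMoments (ν + d) (ν - 1) (P : Measure (EuclideanSpace ℝ (Fin d))) C₀
      * Matrix.of C₀ = 1 := by
    rw [(isCriticalShape_iff_weightedMoments hc hε (hsub hC₀s) hC₀symm _).1 hCcrit,
      Matrix.nonsing_inv_mul _ hdet]
  have hF0 : F (p, C₀) = 0 := by
    rw [shapeEquation_eq_zero_iff, momentMatrix_lawPoint hc hε (hsub hC₀s) hr, hmom]
  have hFsmooth : ContDiffAt ℝ k F (p, C₀) :=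
    contDiffAt_shapeEquation hc hε hs hconv hsub hkr hC₀s
  have hk0 : (k : WithTop ℕ∞) ≠ 0 := by exact_mod_cast Nat.one_le_iff_ne_zero.1 hk
  have hinv : (fderiv ℝ F (p, C₀) ∘L .inr ℝ (SetNormSpace (2 * k + 4) d)
      (ShapeSpace d)).IsInvertible := by
    refine isInvertible_of_injective fun H hH => ?_
    refine eq_zero_of_weightedMoments_mul_eq ha hc hε (hsub hC₀s) hC₀symm _
      (fun v hv => not_ae_dotProduct_homog_eq_zero hν hP hv) hmom (H := H) ?_
    rw [← sub_eq_zero, ← fderiv_shapeEquation_inr hc hε hs hsub hr P hC₀s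
      (hFsmooth.differentiableAt hk0) H]
    exact hH
  set g := hFsmooth.implicitFunction hk0 hinv with hg
  have hg0 : g p = C₀ := hFsmooth.implicitFunction_apply_self hk0 hinv
  have hgsmooth : ContDiffAt ℝ k g p := hFsmooth.contDiffAt_implicitFunction hk0 hinv
  have hgF : ∀ᶠ φ in nhds p, F (φ, g φ) = 0 := by
    have := hFsmooth.eventually_apply_implicitFunction hk0 hinv
    rwa [hF0] at this
  have hgs : ∀ᶠ φ in nhds p, g φ ∈ s :=
    hgsmooth.continuousAt (hs.mem_nhds (hg0.symm ▸ hC₀s))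
  -- At laws A coincides with the inverse of g φ; using the moment matrix instead of the inverse
  -- makes it symmetric for every φ.
  set A := fun φ => momentMatrix (2 * k + 4) (ν + d) (ν - 1) (φ, g φ) with hA
  have hAsmooth : ∀ i j, ContDiffAt ℝ k (fun φ => A φ i j) p := fun i j =>
    ContDiffAt.comp (g := fun u => momentMatrix (2 * k + 4) (ν + d) (ν - 1) u i j) p
      (contDiffAt_momentMatrix hc hε hs hconv hsub hkr (by rw [hg0]; exact hC₀s) i j)
      (contDiffAt_id.prodMk hgsmooth)
  have hlaw : ∀ Q : ProbabilityMeasure (EuclideanSpace ℝ (Fin d)),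
      Q ∈ lawsV d (ν + d) → g (lawPoint (2 * k + 4) Q) ∈ s →
      F (lawPoint (2 * k + 4) Q, g (lawPoint (2 * k + 4) Q)) = 0 →
      IsTLocationScatter ν Q (locationScatter (A (lawPoint (2 * k + 4) Q))) := by
    intro Q hQ hgQ hFQ
    rw [shapeEquation_eq_zero_iff, momentMatrix_lawPoint hc hε (hsub hgQ) hr] at hFQ
    simp only [hA]
    rw [momentMatrix_lawPoint hc hε (hsub hgQ) hr]
    exact isTLocationScatter_of_weightedMoments hν hε hQ (hsub hgQ) hFQ
  have hTsmooth : ContDiffAt ℝ k (fun φ => locationScatter (A φ)) p :=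
    contDiffAt_locationScatter hAsmooth
  obtain ⟨u, hu, hTu⟩ := hTsmooth.contDiffOn le_rfl (by simp)
  -- Points of U need not be laws, so positive definiteness is propagated from P by continuity and
  -- symmetry.
  have hpos : ∀ᶠ φ in nhds p, (locationScatter (A φ)).2.PosDef := by
    refine Matrix.PosDef.eventually_posDef (S := fun φ => (locationScatter (A φ)).2)
      (hlaw P hP hgs.self_of_nhds hgF.self_of_nhds).1 (fun i j => ?_)
      fun φ => isSymm_locationScatter_snd (isSymm_momentMatrix _ _ _ _)
    exact ((hAsmooth _ _).sub ((hAsmooth _ _).mul (hAsmooth _ _))).continuousAt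
  have hball : ∀ᶠ φ in nhds p, ‖φ - p‖ < b - 1 / (ν + d) := by
    filter_upwards [Metric.ball_mem_nhds p (sub_pos.2 hab)] with φ hφ
    rwa [← dist_eq_norm]
  have hall := (Filter.eventually_of_mem hu fun φ hφ => hφ).and
    (hgF.and (hgs.and (hpos.and hball)))
  obtain ⟨U, hU, hUo, hpU⟩ := eventually_nhds_iff.1 hall
  refine ⟨U, fun φ => locationScatter (A φ), hUo, hpU, hTu.mono fun φ hφ => (hU φ hφ).1,
    fun φ hφ => (hU φ hφ).2.2.2.1, fun Q hQU => ?_⟩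
  obtain ⟨-, h1, h2, -, h3⟩ := hU _ hQU
  have hQ := mem_lawsV_of_norm_sub_lt hr hb (by positivity) h3
  exact ⟨hQ, hlaw Q hQ h2 h1⟩
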